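/- **Setting.** Let $n\ge 1$, let $\phi_k:\mathbb R\to\mathbb R^{q_k}$ ($1\le k\le n$) be feature maps and $\sigma_1,\dots,\sigma_n\in\mathbb R$. For bond dimensions $D=(D_1,\dots,D_n)$, with indices read cyclically ($D_{n+1}=D_1$), the matrix product state (MPS) with tensors $A=(A^{(k),s}_{ab})$, $1\le s\le q_k$, $1\le a\le D_k$, $1\le b\le D_{k+1}$, has at the input $x\in\mathbb R^n$ the output $$\Psi(x;A)=\sum_{s_1,\dots,s_n}\ \sum_{\alpha_1,\dots,\alpha_n}A^{(1),s_1}_{\alpha_1\alpha_2}A^{(2),s_2}_{\alpha_2\alpha_3}\cdots A^{(n),s_n}_{\alpha_n\alpha_1}\ \prod_{k=1}^n\phi_k(x_k)_{s_k}.$$ Its neural tangent kernel (NTK), with learning rates $\eta_k=(D_kD_{k+1})^{-1/2}$, is $$K_A(x,x')=\sum_{k=1}^n\ \sum_{s,a,b}\eta_k\,\frac{\partial\Psi(x;A)}{\partial A^{(k),s}_{ab}}\,\frac{\partial\Psi(x';A)}{\partial A^{(k),s}_{ab}}.$$ Let $x^{(1)},\dots,x^{(m)}\in\mathbb R^n$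 be data points with weights $w_j\ge 0$ (for instance $w_j=1/m$, or $w_j=1$). For a direction $d=(d(x^{(j)}))_{j\le m}$ let $\langle d,g\rangle=\sum_j w_j\,d(x^{(j)})\,g(x^{(j)})$ be the associated functional on functions $g:\mathbb R^n\to\mathbb R$, let $\|d\|=\big(\sum_j w_j\,d(x^{(j)})^2\big)^{1/2}$, and for a kernel $K$ let $\Phi_K(\langle d,\cdot\rangle)(x)=\langle d,K(x,\cdot)\rangle$. Let $T\ge 0$. For every $D$ let the tensors $A_t$, $t\in[0,T]$, be random (the probability space may depend on $D$) such that * at time $0$ all tensor entries are independent, with $A^{(k),s}_{ab}(0)\sim\mathcal N\big(0,\sigma_k^2/\sqrt{D_kD_{k+1}}\big)$; * almost surely they are trained by gradient flow with a (random, time-dependent) training direction $d_t$ (for a cost $\mathcal L$ this is $\langle d_t,\cdot\rangle=-\partial_\Psi\mathcal L$), that is, for all $t\in[0,T]$ and all entries, $$\frac{d}{dt}A^{(k),s}_{ab}=\eta_k\Big\langle d_t,\frac{\partial\Psi(\cdot\,;A_t)}{\partial A^{(k),s}_{ab}}\Big\rangle ,$$ where each $t\mapsto d_t(x^{(j)})$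 is almost surely integrable on $[0,T]$. **Theorem.** Assume that $\int_0^T\|d_t\|\,dt$ is bounded in probability as the bond dimensions go to infinity: for every $\delta>0$ there is $C$ with $\mathbb P\big(\int_0^T\|d_t\|\,dt>C\big)\le\delta$ whenever all $D_k$ are large enough. Put $$K_\infty(x,x')=\sum_{k=1}^n\phi_k(x_k)\cdot\phi_k(x'_k)\prod_{l\ne k}\sigma_l^2\,\phi_l(x_l)\cdot\phi_l(x'_l).$$ Then, as $D_1,\dots,D_n\to\infty$ (jointly, with no restriction on their relative growth), for all inputs $x,x'\in\mathbb R^n$: 1. $\sup_{t\in[0,T]}|K_{A_t}(x,x')-K_\infty(x,x')|\to 0$ in probability. 2. The outputs $\Psi_t(x)=\Psi(x;A_t)$ follow, in this limit, the differential equation $\frac{d}{dt}\Psi_t=\Phi_{K_\infty}(\langle d_t,\cdot\rangle)$. Precisely: for every $D$, almost surely $\frac{d}{dt}\Psi_t=\Phi_{K_{A_t}}(\langle d_t,\cdot\rangle)$ for all $t\in[0,T]$; and, in probability, $$\int_0^T\Big|\frac{d}{dt}\Psi_t(x)-\Phi_{K_\infty}(\langle d_t,\cdot\rangle)(x)\Big|dt\to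 0,\qquad \sup_{t\in[0,T]}\Big|\Psi_t(x)-\Psi_0(x)-\int_0^t\Phi_{K_\infty}(\langle d_s,\cdot\rangle)(x)\,ds\Big|\to 0 .$$ -/

import Mathlib

open MeasureTheory ProbabilityTheory Filter Topology

noncomputable section

/-- Index set of the parameters of a matrix product state on a ring of `n` sites, with physical
dimensions `q k` and bond dimensions `D k`: the index `⟨k, s, a, b⟩` stands for the entry
`A^{s}_{a b}` of the `k`-th tensor, whose left bond is `k` and whose right bond is `k + 1`
(cyclically, so the right bond of the last tensor is the first bond). -/
abbrev MPSIndex {n : ℕ} [NeZero n] (q D : Fin n → ℕ) : Type :=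
  Σ k : Fin n, Fin (q k) × Fin (D k) × Fin (D (k + 1))

/-- The output `Ψ(x; A)` of the matrix product state with site-wise feature maps `φ k`. -/
def mpsOutput {n : ℕ} [NeZero n] {q D : Fin n → ℕ} (φ : ∀ k : Fin n, ℝ → Fin (q k) → ℝ)
    (x : Fin n → ℝ) (A : MPSIndex q D → ℝ) : ℝ :=
  ∑ s : ∀ k : Fin n, Fin (q k), ∑ a : ∀ k : Fin n, Fin (D k),
    (∏ k : Fin n, A ⟨k, s k, a k, a (k + 1)⟩) * ∏ k : Fin n, φ k (x k) (s k)

/-- The partial derivative of `Ψ(x; A)` with respect to the tensor entry `e`. -/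
def mpsPartial {n : ℕ} [NeZero n] {q D : Fin n → ℕ} (φ : ∀ k : Fin n, ℝ → Fin (q k) → ℝ)
    (e : MPSIndex q D) (x : Fin n → ℝ) (A : MPSIndex q D → ℝ) : ℝ :=
  fderiv ℝ (mpsOutput φ x) A (Pi.single e 1)

/-- The learning rate `(|α_k| |α_{k+1}|)^{-1/2}` of the entries of the `k`-th tensor. -/
def mpsRate {n : ℕ} [NeZero n] (D : Fin n → ℕ) (k : Fin n) : ℝ :=
  ((D k : ℝ) * (D (k + 1) : ℝ)) ^ (-(1 / 2) : ℝ)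

/-- The neural tangent kernel of the matrix product state at the parameters `A`. -/
def mpsNTK {n : ℕ} [NeZero n] {q D : Fin n → ℕ} (φ : ∀ k : Fin n, ℝ → Fin (q k) → ℝ)
    (A : MPSIndex q D → ℝ) (x x' : Fin n → ℝ) : ℝ :=
  ∑ e : MPSIndex q D, mpsRate D e.1 * (mpsPartial φ e x A * mpsPartial φ e x' A)

/-- The deterministic limit kernel. -/
def mpsLimitKernel {n : ℕ} {q : Fin n → ℕ} (φ : ∀ k : Fin n, ℝ → Fin (q k) → ℝ) (σ : Fin n → ℝ)
    (x x' : Fin n → ℝ) : ℝ :=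
  ∑ k : Fin n, (φ k (x k) ⬝ᵥ φ k (x' k)) *
    ∏ l ∈ Finset.univ.erase k, σ l ^ 2 * (φ l (x l) ⬝ᵥ φ l (x' l))

/-- The law of the initial tensors: independent centred Gaussian entries, those of the `k`-th
tensor having variance `σ_k² / √(|α_k| |α_{k+1}|)`. -/
def mpsInitLaw {n : ℕ} [NeZero n] (q D : Fin n → ℕ) (σ : Fin n → ℝ) :
    Measure (MPSIndex q D → ℝ) :=
  Measure.pi fun e =>
    gaussianReal 0 (σ e.1 ^ 2 / √((D e.1 : ℝ) * (D (e.1 + 1) : ℝ))).toNNReal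

/-- The functional `⟨d, ·⟩` on the function space, for the input distribution that gives the
data point `X j` the weight `w j`; `d j` is the value of the direction at `X j`. -/
def dataPairing {n m : ℕ} (w : Fin m → ℝ) (X : Fin m → Fin n → ℝ) (d : Fin m → ℝ) :
    Module.Dual ℝ ((Fin n → ℝ) → ℝ) where
  toFun g := ∑ j : Fin m, w j * (d j * g (X j))
  map_add' f g := by
    simp only [Pi.add_apply, mul_add, Finset.sum_add_distrib]
  map_smul' c g := by
    simp only [Pi.smul_apply, smul_eq_mul, RingHom.id_apply, Finset.mul_sum]
    exact Finset.sum_congr rfl fun j _ => by ring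

/-- The norm `‖d‖ = ⟨d, d⟩^{1/2}` for the same input distribution. -/
def dataNorm {m : ℕ} (w : Fin m → ℝ) (d : Fin m → ℝ) : ℝ :=
  √(∑ j : Fin m, w j * d j ^ 2)

/-- The map `Φ_K` from the dual of the function space to the function space:
`Φ_K(μ)(x) = μ(K(x, ·))`. -/
def kernelMap {n : ℕ} (K : (Fin n → ℝ) → (Fin n → ℝ) → ℝ)
    (μ : Module.Dual ℝ ((Fin n → ℝ) → ℝ)) (x : Fin n → ℝ) : ℝ :=
  μ (K x)

/-- The curve `A` of parameters is trained on `[0, T]` by gradient flow with training direction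
`d`: `dA_e/dt = η_e ⟨d_t, ∂Ψ(·; A_t)/∂A_e⟩` for every tensor entry `e`. -/
def IsMPSTraining {n m : ℕ} [NeZero n] {q D : Fin n → ℕ}
    (φ : ∀ k : Fin n, ℝ → Fin (q k) → ℝ) (w : Fin m → ℝ) (X : Fin m → Fin n → ℝ) (T : ℝ)
    (d : ℝ → Fin m → ℝ) (A : ℝ → MPSIndex q D → ℝ) : Prop :=
  ∀ t ∈ Set.Icc (0 : ℝ) T, ∀ e : MPSIndex q D,
    HasDerivWithinAt (fun s => A s e)
      (mpsRate D e.1 * dataPairing w X (d t) (fun x => mpsPartial φ e x (A t)))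
      (Set.Icc (0 : ℝ) T) t

end

/-! Removing site `k` from the ring leaves the product of the `n - 1` other contracted tensors, a
"chain", and the gradient of the output in the `k`-th tensor is this chain times the feature vector
(`mpsPartial_eq`). Hence the kernel is a sum over `k` of `η_k (φ_k · φ_k')` times the trace of a
Gram matrix of two chains (`mpsNTK_eq`). Write `β` for the fourth root of the product of the two
bond dimensions at the ends of a chain. For the chain left by site `k`, `η_k = β⁻²`, and the claim
becomes a statement about chains on the scale `β`.

At initialization, appending a site conjugates the Gram matrix by independent Gaussian matrices.
Wick's formula shows that its second moments keep the form of an isotropic tensor with three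
coefficients, which obey a linear recursion; every term that leaves the leading form costs a factor
`1/D` (`exists_mpsGram_moments`). Two facts result: the trace of the Gram matrix concentrates at
`β²` times the product of the site factors, and the Frobenius norm of the Gram matrix is `o(β²)`.
The first gives convergence of the initial kernel and chains of Frobenius norm `O(β)`; the second
gives chains of operator norm `o(β)`. All errors are controlled by the largest `1/D_k` alone, so no
relative growth condition arises.

This gap between the two norms is what freezes the kernel. A gradient of Frobenius norm `O(β)` and a
rate `β⁻²` move each tensor by `O(β⁻¹ ∫‖d‖)`. In the telescoped difference of two chains, every
displacement stands between two chains of small operator norm, so the chain changes by `O(ε² β)`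
only (`norm_mpsChain_le`). The bound on the displacement needs bounded chains and conversely; a
first-exit-time argument closes the circle (`IsTypicalInit.tensorNorm_le`).

By the chain rule the outputs follow the current kernel exactly. Replacing it by a kernel at
distance `ζ` costs at most a constant times `ζ ‖d_t‖`, which integrates to a small error because
`∫‖d_t‖` is bounded in probability. -/

noncomputable section

/-! ### Gaussian moments and Wick's formula -/

/-- The fourth moment of a centred Gaussian. -/
theorem integral_pow_four_gaussianReal (v : NNReal) :
    ∫ x, x ^ 4 ∂(gaussianReal 0 v) = 3 * (v : ℝ) ^ 2 := by
  have h := iteratedDeriv_mgf_zero (X := id) (μ := gaussianReal 0 v)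
    (by rw [integrableExpSet_id_gaussianReal]; simp) 4
  simp only [Pi.pow_apply, id] at h
  rw [← h, mgf_id_gaussianReal]
  -- All derivatives of the moment generating function are polynomials times `exp (v t² / 2)`;
  -- differentiation acts on the polynomial by `p ↦ p' + v t p`. Four applications to `1` give the
  -- value `3 v²` at `0`.
  have key : ∀ p p' : ℝ → ℝ, (∀ t, HasDerivAt p (p' t) t) →
      deriv (fun t : ℝ => p t * Real.exp (0 * t + v * t ^ 2 / 2))
        = fun t => (p' t + p t * (v * t)) * Real.exp (0 * t + v * t ^ 2 / 2) := by
    intro p p' hp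
    funext t
    have h1 : HasDerivAt (fun t : ℝ => 0 * t + v * t ^ 2 / 2) (v * t) t := by
      have := ((hasDerivAt_id t).const_mul (0 : ℝ)).add
        (((hasDerivAt_pow 2 t).const_mul (v : ℝ)).div_const 2)
      convert! this using 1
      simp; ring
    rw [((hp t).fun_mul h1.exp).deriv]
    ring
  have h1 : (fun t : ℝ => Real.exp (0 * t + v * t ^ 2 / 2))
      = fun t => (fun _ => (1 : ℝ)) t * Real.exp (0 * t + v * t ^ 2 / 2) := by simp
  simp only [iteratedDeriv_succ, iteratedDeriv_zero]
  rw [h1, key _ (fun _ => 0) (fun t => hasDerivAt_const t 1),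
    key (fun t => 0 + 1 * (v * t)) (fun _ => v) (fun t => by
      simpa using (hasDerivAt_id t).const_mul (v : ℝ)),
    key (fun t => v + (0 + 1 * (v * t)) * (v * t)) (fun t => 2 * v ^ 2 * t) (fun t => by
      have := ((hasDerivAt_pow 2 t).const_mul ((v : ℝ) ^ 2)).const_add (v : ℝ)
      convert! this using 1
      · funext t; ring
      · simp; ring),
    key (fun t => 2 * v ^ 2 * t + (v + (0 + 1 * (v * t)) * (v * t)) * (v * t))
      (fun t => 3 * v ^ 2 + 3 * v ^ 3 * t ^ 2) (fun t => by
      have := ((hasDerivAt_id t).const_mul (3 * (v : ℝ) ^ 2)).add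
        ((hasDerivAt_pow 3 t).const_mul ((v : ℝ) ^ 3))
      convert! this using 1
      · funext t; simp; ring
      · simp; ring)]
  simp

section Wick

variable {ι : Type*} [Fintype ι] (v : ι → NNReal)

/-- A random variable with moments of all orders. -/
def HasAllMoments {Ω : Type*} [MeasurableSpace Ω] (f : Ω → ℝ) (μ : Measure Ω) : Prop :=
  ∀ p : NNReal, MemLp f p μ

namespace HasAllMoments

variable {Ω : Type*} [MeasurableSpace Ω] {μ : Measure Ω} {f g : Ω → ℝ}

theorem integrable (hf : HasAllMoments f μ) : Integrable f μ :=
  memLp_one_iff_integrable.1 (by simpa using hf 1)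

theorem add (hf : HasAllMoments f μ) (hg : HasAllMoments g μ) :
    HasAllMoments (fun ω => f ω + g ω) μ := fun p => (hf p).add (hg p)

theorem const [IsProbabilityMeasure μ] (c : ℝ) : HasAllMoments (fun _ => c) μ :=
  fun _ => memLp_const c

/-- Hölder's inequality with both factors in `L^{2p}`; closure under products is the reason to ask
for all moments at once. -/
theorem mul (hf : HasAllMoments f μ) (hg : HasAllMoments g μ) :
    HasAllMoments (fun ω => f ω * g ω) μ := by
  intro p
  have : ENNReal.HolderTriple ((2 * p : NNReal) : ENNReal) ((2 * p : NNReal) : ENNReal) p := by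
    constructor
    rcases eq_or_ne p 0 with rfl | hp
    · simp
    · rw [← ENNReal.coe_inv (by simpa using hp), ← ENNReal.coe_inv hp, ← ENNReal.coe_add]
      congr 1
      field_simp
      norm_num
  exact (hg (2 * p)).mul (hf (2 * p))

theorem sum [IsProbabilityMeasure μ] {κ : Type*} (s : Finset κ) {F : κ → Ω → ℝ}
    (hF : ∀ i ∈ s, HasAllMoments (F i) μ) :
    HasAllMoments (fun ω => ∑ i ∈ s, F i ω) μ :=
  fun p => memLp_finsetSum s fun i hi => hF i hi p

end HasAllMoments

/-- The product of centred Gaussians with variances `v`. -/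
abbrev gaussianPi : Measure (ι → ℝ) := Measure.pi fun e => gaussianReal 0 (v e)

theorem map_eval_gaussianPi (e : ι) :
    (gaussianPi v).map (fun A => A e) = gaussianReal 0 (v e) :=
  (measurePreserving_eval (fun e => gaussianReal 0 (v e)) e).map_eq

theorem hasAllMoments_eval (e : ι) : HasAllMoments (fun A : ι → ℝ => A e) (gaussianPi v) := by
  intro p
  have h := memLp_id_gaussianReal (μ := 0) (v := v e) p
  rw [← map_eval_gaussianPi] at h
  exact (memLp_map_measure_iff aestronglyMeasurable_id (measurable_pi_apply e).aemeasurable).1 h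

theorem hasAllMoments_linear (c : ι → ℝ) :
    HasAllMoments (fun A : ι → ℝ => ∑ e, c e * A e) (gaussianPi v) :=
  HasAllMoments.sum _ fun e _ => (HasAllMoments.const (c e)).mul (hasAllMoments_eval v e)

theorem map_linear_gaussianPi (c : ι → ℝ) :
    (gaussianPi v).map (fun A => ∑ e, c e * A e)
      = gaussianReal 0 (∑ e, (c e ^ 2).toNNReal * v e) := by
  have hind : iIndepFun (fun (e : ι) (A : ι → ℝ) => c e * A e) (gaussianPi v) :=
    iIndepFun_pi (X := fun e (y : ℝ) => c e * y) (fun e => by fun_prop)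
  have hlaw : ∀ e, HasLaw (fun A : ι → ℝ => c e * A e)
      (gaussianReal 0 ((c e ^ 2).toNNReal * v e)) (gaussianPi v) := by
    intro e
    have h := gaussianReal_const_mul (P := gaussianPi v) (X := fun A => A e)
      ⟨(measurable_pi_apply e).aemeasurable, map_eval_gaussianPi v e⟩ (c e)
    rw [mul_zero] at h
    convert! h using 3
    ext
    simp [sq_nonneg]
  have hG := (hind.hasGaussianLaw_fun_sum fun e => (hlaw e).hasGaussianLaw).map_eq_gaussianReal
  have hmean : ∫ A, ∑ e, c e * A e ∂(gaussianPi v) = 0 := by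
    rw [integral_finsetSum _ fun e _ =>
      ((HasAllMoments.const (c e)).mul (hasAllMoments_eval v e)).integrable]
    refine Finset.sum_eq_zero fun e _ => ?_
    rw [(hlaw e).integral_eq]
    simp
  have hvar : Var[fun A : ι → ℝ => ∑ e, c e * A e; gaussianPi v]
      = ∑ e, ((c e ^ 2).toNNReal * v e : NNReal) := by
    have h := IndepFun.variance_sum (s := Finset.univ) (μ := gaussianPi v)
      (X := fun (e : ι) (A : ι → ℝ) => c e * A e)
      (fun e _ => by
        simpa using ((HasAllMoments.const (c e)).mul (hasAllMoments_eval v e)) 2)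
      (fun i _ j _ hij => hind.indepFun hij)
    rw [show (∑ e, fun A : ι → ℝ => c e * A e) = fun A : ι → ℝ => ∑ e, c e * A e by
      ext; simp] at h
    rw [h, NNReal.coe_sum]
    refine Finset.sum_congr rfl fun e _ => ?_
    rw [(hlaw e).variance_eq]
    simp
  rw [hG, hmean, hvar, Real.toNNReal_coe]

/-- The covariance of two linear forms in independent centred Gaussians. -/
def linCov (c c' : ι → ℝ) : ℝ := ∑ e, c e * c' e * v e

theorem integral_linear_pow_two (c : ι → ℝ) :
    ∫ A, (∑ e, c e * A e) ^ 2 ∂(gaussianPi v) = linCov v c c := by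
  have h := map_linear_gaussianPi v c
  have h2 : ∫ x, x ^ 2 ∂(gaussianReal 0 (∑ e, (c e ^ 2).toNNReal * v e))
      = ((∑ e, (c e ^ 2).toNNReal * v e : NNReal) : ℝ) := by
    rw [← variance_fun_id_gaussianReal (μ := 0), variance_eq_integral (by fun_prop)]
    simp [integral_id_gaussianReal]
  rw [← h, integral_map (Measurable.aemeasurable (by fun_prop)) (by fun_prop)] at h2
  rw [h2, linCov, NNReal.coe_sum]
  refine Finset.sum_congr rfl fun e _ => ?_
  rw [NNReal.coe_mul, Real.coe_toNNReal _ (sq_nonneg _), sq]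

theorem integral_linear_pow_four (c : ι → ℝ) :
    ∫ A, (∑ e, c e * A e) ^ 4 ∂(gaussianPi v) = 3 * linCov v c c ^ 2 := by
  have h := map_linear_gaussianPi v c
  have h2 := integral_pow_four_gaussianReal (∑ e, (c e ^ 2).toNNReal * v e)
  rw [← h, integral_map (Measurable.aemeasurable (by fun_prop)) (by fun_prop)] at h2
  rw [h2, linCov, NNReal.coe_sum]
  congr 2
  refine Finset.sum_congr rfl fun e _ => ?_
  rw [NNReal.coe_mul, Real.coe_toNNReal _ (sq_nonneg _), sq]

theorem linCov_comm (c c' : ι → ℝ) : linCov v c c' = linCov v c' c := by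
  simp [linCov, mul_comm]

theorem linCov_add_left (c₁ c₂ c : ι → ℝ) :
    linCov v (c₁ + c₂) c = linCov v c₁ c + linCov v c₂ c := by
  simp [linCov, ← Finset.sum_add_distrib, add_mul]

theorem linCov_smul_left (r : ℝ) (c c' : ι → ℝ) :
    linCov v (r • c) c' = r * linCov v c c' := by
  simp [linCov, Finset.mul_sum, mul_assoc]

theorem linCov_add_right (c₁ c₂ c : ι → ℝ) :
    linCov v c (c₁ + c₂) = linCov v c c₁ + linCov v c c₂ := by
  rw [linCov_comm, linCov_add_left, linCov_comm v c₁, linCov_comm v c₂]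

theorem linCov_smul_right (r : ℝ) (c c' : ι → ℝ) :
    linCov v c (r • c') = r * linCov v c c' := by
  rw [linCov_comm, linCov_smul_left, linCov_comm]

theorem linear_add (c c' : ι → ℝ) (A : ι → ℝ) :
    ∑ e, (c + c') e * A e = ∑ e, c e * A e + ∑ e, c' e * A e := by
  simp [← Finset.sum_add_distrib, add_mul]

theorem linear_smul (r : ℝ) (c : ι → ℝ) (A : ι → ℝ) :
    ∑ e, (r • c) e * A e = r * ∑ e, c e * A e := by
  simp [Finset.mul_sum, mul_assoc]

theorem integral_linear_mul_linear (c c' : ι → ℝ) :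
    ∫ A, (∑ e, c e * A e) * (∑ e, c' e * A e) ∂(gaussianPi v) = linCov v c c' := by
  have hp : ∀ c : ι → ℝ, Integrable (fun A => (∑ e, c e * A e) ^ 2) (gaussianPi v) := by
    intro c
    simpa only [sq] using ((hasAllMoments_linear v c).mul (hasAllMoments_linear v c)).integrable
  have h1 := integral_linear_pow_two v (c + c')
  have h2 := integral_linear_pow_two v (c + (-1 : ℝ) • c')
  have e : (fun A : ι → ℝ => (∑ e, c e * A e) * (∑ e, c' e * A e)) = fun A =>
      (1 / 4) * ((∑ e, (c + c') e * A e) ^ 2 - (∑ e, (c + (-1 : ℝ) • c') e * A e) ^ 2) := by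
    funext A
    rw [linear_add, linear_add, linear_smul]
    ring
  rw [e, integral_const_mul, integral_sub (hp _) (hp _), h1, h2]
  simp only [linCov_add_left, linCov_add_right, linCov_smul_left, linCov_smul_right,
    linCov_comm v c' c]
  ring

/-- **Wick's formula** for four linear forms in independent centred Gaussians. -/
theorem integral_linear_four (a b c d : ι → ℝ) :
    ∫ A, (∑ e, a e * A e) * (∑ e, b e * A e) * ((∑ e, c e * A e) * (∑ e, d e * A e))
        ∂(gaussianPi v)
      = linCov v a b * linCov v c d + linCov v a c * linCov v b d
        + linCov v a d * linCov v b c := by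
  have hp : ∀ c : ι → ℝ, Integrable (fun A => (∑ e, c e * A e) ^ 4) (gaussianPi v) := by
    intro c
    have h := (hasAllMoments_linear v c).mul (hasAllMoments_linear v c)
    refine (h.mul h).integrable.congr (Eventually.of_forall fun A => ?_)
    simp only
    ring
  -- Polarization: summing `s₁ s₂ s₃ (a + s₁ b + s₂ c + s₃ d)⁴` over all signs keeps only monomials
  -- odd in `b`, `c` and `d`, that is `abcd`, with coefficient `8 · 24 = 192`. Fourth moments of
  -- single linear forms then suffice.
  let s : Bool → ℝ := fun t => if t then 1 else -1
  let u : Bool × Bool × Bool → ι → ℝ := fun t => a + s t.1 • b + s t.2.1 • c + s t.2.2 • d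
  have e : (fun A : ι → ℝ =>
      (∑ e, a e * A e) * (∑ e, b e * A e) * ((∑ e, c e * A e) * (∑ e, d e * A e))) = fun A =>
      ∑ t : Bool × Bool × Bool, (1 / 192) * (s t.1 * s t.2.1 * s t.2.2)
        * (∑ e, u t e * A e) ^ 4 := by
    funext A
    simp only [u, linear_add, linear_smul, Fintype.sum_prod_type, Fintype.sum_bool, s]
    simp only [if_true, Bool.false_eq_true, if_false]
    ring
  rw [e, integral_finsetSum _ fun t _ => (hp _).const_mul _]
  simp_rw [integral_const_mul, integral_linear_pow_four]
  simp only [u, linCov_add_left, linCov_add_right, linCov_smul_left, linCov_smul_right,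
    Fintype.sum_prod_type, Fintype.sum_bool, s]
  simp only [if_true, Bool.false_eq_true, if_false]
  rw [linCov_comm v b a, linCov_comm v c a, linCov_comm v d a, linCov_comm v c b,
    linCov_comm v d b, linCov_comm v d c]
  ring

/-- Functions of disjoint sets of coordinates are independent under a product measure. -/
theorem indepFun_of_dependsOn {f g : (ι → ℝ) → ℝ} (hf : Measurable f) (hg : Measurable g)
    {S T : Set ι} (hST : Disjoint S T) (hfS : DependsOn f S) (hgT : DependsOn g T) :
    IndepFun f g (gaussianPi v) := by
  classical
  have hind : iIndepFun (fun (e : ι) (A : ι → ℝ) => A e) (gaussianPi v) :=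
    iIndepFun_pi (X := fun _ (y : ℝ) => y) (fun e => by fun_prop)
  have h := hind.indepFun_finset S.toFinset T.toFinset
    (by rwa [Set.disjoint_toFinset]) (fun e => by fun_prop)
  -- Extension by zero turns a function that depends only on the coordinates in `R` into a function
  -- of the restriction to `R`, to which independence of disjoint families applies.
  let ext : ∀ R : Finset ι, (R → ℝ) → ι → ℝ := fun R y e => if h : e ∈ R then y ⟨e, h⟩ else 0
  have hext : ∀ R, Measurable (ext R) := by
    intro R
    refine measurable_pi_lambda _ fun e => ?_
    by_cases h : e ∈ R <;> simp only [ext, h, dite_true, dite_false] <;> fun_prop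
  have := h.comp (hf.comp (hext _)) (hg.comp (hext _))
  convert! this using 1
  · funext A
    refine hfS fun e he => ?_
    simp [ext, he]
  · funext A
    refine hgT fun e he => ?_
    simp [ext, he]

end Wick

/-! ### Moments of Gram matrices multiplied by an independent Gaussian matrix -/

/-- Kronecker's delta with real values. -/
def kron {κ : Type*} [DecidableEq κ] (i j : κ) : ℝ := if i = j then 1 else 0

section Kron

variable {κ : Type*} [DecidableEq κ]

theorem kron_self (i : κ) : kron i i = 1 := if_pos rfl

theorem kron_comm (i j : κ) : kron i j = kron j i := by
  simp [kron, eq_comm]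

theorem kron_mul_self (i j : κ) : kron i j * kron i j = kron i j := by
  by_cases h : i = j <;> simp [kron, h]

theorem kron_mul_eq (i j : κ) (f : κ → ℝ) : kron i j * f i = kron i j * f j := by
  by_cases h : i = j <;> simp [kron, h]

/-- The isotropic tensor of order four with coefficients `α`, `β`, `γ`, supported where `r` is
nonzero. -/
def isoTensor (r : κ → ℝ) (α β γ : ℝ) (i j k l : κ) : ℝ :=
  α * (kron i j * r i * (kron k l * r k)) + β * (kron i k * r i * (kron j l * r j))
    + γ * (kron i l * r i * (kron j k * r j))

theorem kron_mul_mul {r : κ → ℝ} (hr : ∀ i, r i * r i = r i) (i j : κ) :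
    kron i j * (r i * r j) = kron i j * r i := by
  by_cases h : i = j
  · rw [← h, hr]
  · simp [kron, h]

/-- Since `r` is idempotent, the surplus factors `r` that the covariances of the next site produce
are absorbed by the tensor. The same holds for the next two slots. -/
theorem mul_isoTensor_left {r : κ → ℝ} (hr : ∀ i, r i * r i = r i) (α β γ : ℝ) (i j k l : κ) :
    r i * isoTensor r α β γ i j k l = isoTensor r α β γ i j k l := by
  simp only [isoTensor]
  linear_combination (α * (kron i j * (kron k l * r k)) + β * (kron i k * (kron j l * r j))
    + γ * (kron i l * (kron j k * r j))) * hr i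

theorem mul_isoTensor_snd {r : κ → ℝ} (hr : ∀ i, r i * r i = r i) (α β γ : ℝ) (i j k l : κ) :
    r j * isoTensor r α β γ i j k l = isoTensor r α β γ i j k l := by
  simp only [isoTensor]
  linear_combination (β * (kron i k * r i * kron j l) + γ * (kron i l * r i * kron j k)) * hr j
    + α * (kron k l * r k) * kron_mul_mul hr i j

theorem mul_isoTensor_trd {r : κ → ℝ} (hr : ∀ i, r i * r i = r i) (α β γ : ℝ) (i j k l : κ) :
    r k * isoTensor r α β γ i j k l = isoTensor r α β γ i j k l := by
  simp only [isoTensor]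
  linear_combination α * (kron i j * r i * kron k l) * hr k
    + β * (kron j l * r j) * kron_mul_mul hr i k + γ * (kron i l * r i) * kron_mul_mul hr j k

variable [Fintype κ]

theorem sum_mul_kron (i : κ) (f : κ → ℝ) : ∑ j, f j * kron i j = f i := by
  simp [kron]

theorem sum_kron_kron_left (T : κ → κ → κ → κ → ℝ) :
    ∑ i, ∑ j, ∑ k, ∑ l, T i j k l * (kron i j * kron k l) = ∑ i, ∑ k, T i i k k := by
  simp [kron]

theorem sum_kron_kron_mid (T : κ → κ → κ → κ → ℝ) :
    ∑ i, ∑ j, ∑ k, ∑ l, T i j k l * (kron i k * kron j l) = ∑ i, ∑ j, T i j i j := by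
  simp [kron]

theorem sum_kron_kron_right (T : κ → κ → κ → κ → ℝ) :
    ∑ i, ∑ j, ∑ k, ∑ l, T i j k l * (kron i l * kron j k) = ∑ i, ∑ j, T i j j i := by
  simp [kron]

variable {r : κ → ℝ}

theorem sum_kron_mul_mul (hr : ∀ i, r i * r i = r i) :
    ∑ i, ∑ j, kron i j * r i * (kron i j * r j) = ∑ i, r i := by
  refine Finset.sum_congr rfl fun i _ => ?_
  have : ∀ j, kron i j * r i * (kron i j * r j) = (r i * r j) * kron i j := fun j => by
    linear_combination r i * r j * kron_mul_self i j
  simp_rw [this]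
  rw [sum_mul_kron, hr]

/-- The pairing that matches the contraction leaves two free indices and gives `(∑ r)²`; the other
two force the indices to agree and give a single `∑ r`. With `∑ r` equal to a bond dimension, this
is the source of every gain `1/D`. -/
theorem sum_isoTensor_left (hr : ∀ i, r i * r i = r i) (α β γ : ℝ) :
    ∑ i, ∑ k, isoTensor r α β γ i i k k = α * (∑ i, r i) ^ 2 + (β + γ) * ∑ i, r i := by
  have h : ∀ i k, isoTensor r α β γ i i k k
      = α * (r i * r k) + (β + γ) * (kron i k * r i * (kron i k * r k)) := by
    intro i k
    have := kron_mul_eq i k r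
    simp only [isoTensor, kron_self]
    linear_combination (β + γ) * kron i k * r i * this
  simp_rw [h, Finset.sum_add_distrib, ← Finset.mul_sum]
  rw [sum_kron_mul_mul hr, sq, Finset.sum_mul_sum]
  simp_rw [← Finset.mul_sum]

theorem sum_isoTensor_mid (hr : ∀ i, r i * r i = r i) (α β γ : ℝ) :
    ∑ i, ∑ j, isoTensor r α β γ i j i j = β * (∑ i, r i) ^ 2 + (α + γ) * ∑ i, r i := by
  have h : ∀ i k, isoTensor r α β γ i k i k
      = β * (r i * r k) + (α + γ) * (kron i k * r i * (kron i k * r k)) := by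
    intro i k
    have := kron_mul_eq i k r
    simp only [isoTensor, kron_self, kron_comm k i]
    linear_combination α * kron i k * r i * this
  simp_rw [h, Finset.sum_add_distrib, ← Finset.mul_sum]
  rw [sum_kron_mul_mul hr, sq, Finset.sum_mul_sum]
  simp_rw [← Finset.mul_sum]

theorem sum_isoTensor_right (hr : ∀ i, r i * r i = r i) (α β γ : ℝ) :
    ∑ i, ∑ j, isoTensor r α β γ i j j i = γ * (∑ i, r i) ^ 2 + (α + β) * ∑ i, r i := by
  have h : ∀ i k, isoTensor r α β γ i k k i
      = γ * (r i * r k) + (α + β) * (kron i k * r i * (kron i k * r k)) := by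
    intro i k
    simp only [isoTensor, kron_self, kron_comm k i]
    ring
  simp_rw [h, Finset.sum_add_distrib, ← Finset.mul_sum]
  rw [sum_kron_mul_mul hr, sq, Finset.sum_mul_sum]
  simp_rw [← Finset.mul_sum]

end Kron

theorem DependsOn.mul {ι : Type*} {α : ι → Type*} {f g : (∀ i, α i) → ℝ} {S : Set ι}
    (hf : DependsOn f S) (hg : DependsOn g S) : DependsOn (fun A => f A * g A) S :=
  fun _ _ h => congrArg₂ (· * ·) (hf h) (hg h)

/-! ### Conjugation of a random matrix by independent Gaussian matrices. -/

section Step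

variable {ι : Type*} [Fintype ι] {v : ι → NNReal} {κ : Type*} [Fintype κ] [DecidableEq κ]
  {B : κ → κ → (ι → ℝ) → ℝ} {g g' : κ → κ → ι → ℝ} {S T : Set ι}

theorem dependsOn_linear {c : ι → ℝ} {T : Set ι} (hc : ∀ e ∉ T, c e = 0) :
    DependsOn (fun A : ι → ℝ => ∑ e, c e * A e) T := by
  intro A A' h
  refine Finset.sum_congr rfl fun e _ => ?_
  by_cases he : e ∈ T
  · rw [h e he]
  · simp [hc e he]

/-- The first moment of `G'ᵀ B G`. -/
theorem integral_conj_entry (hB : ∀ i j, HasAllMoments (B i j) (gaussianPi v))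
    (hBm : ∀ i j, Measurable (B i j)) (hBS : ∀ i j, DependsOn (B i j) S) (hST : Disjoint S T)
    (hg : ∀ i j, ∀ e ∉ T, g i j e = 0) (hg' : ∀ i j, ∀ e ∉ T, g' i j e = 0)
    {r ρ : κ → ℝ} (hr : ∀ i, r i * r i = r i) {c e₀ : ℝ}
    (hc : ∀ i a j b, linCov v (g' i a) (g j b) = c * (kron i j * r i * (kron a b * ρ a)))
    (h1 : ∀ i j, ∫ A, B i j A ∂(gaussianPi v) = e₀ * (kron i j * r i)) (a b : κ) :
    ∫ A, ∑ i, ∑ j, (∑ e, g' i a e * A e) * B i j A * (∑ e, g j b e * A e) ∂(gaussianPi v)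
      = c * e₀ * (∑ i, r i) * (kron a b * ρ a) := by
  have hint : ∀ i j, HasAllMoments (fun A : ι → ℝ =>
      (∑ e, g' i a e * A e) * B i j A * (∑ e, g j b e * A e)) (gaussianPi v) := fun i j =>
    ((hasAllMoments_linear v _).mul (hB i j)).mul (hasAllMoments_linear v _)
  rw [integral_finsetSum _ fun i _ => (HasAllMoments.sum _ fun j _ => hint i j).integrable]
  have : ∀ i j, ∫ A, (∑ e, g' i a e * A e) * B i j A * (∑ e, g j b e * A e) ∂(gaussianPi v)
      = (c * e₀ * (kron a b * ρ a)) * (r i * kron i j) := by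
    intro i j
    have e1 : (fun A : ι → ℝ => (∑ e, g' i a e * A e) * B i j A * (∑ e, g j b e * A e))
        = fun A => B i j A * ((∑ e, g' i a e * A e) * (∑ e, g j b e * A e)) := by
      funext A; ring
    rw [e1, (indepFun_of_dependsOn v (hBm i j) (by fun_prop) hST (hBS i j)
      ((dependsOn_linear (hg' i a)).mul
        (dependsOn_linear (hg j b)))).integral_fun_mul_eq_mul_integral
        (hBm i j).aestronglyMeasurable (Measurable.aestronglyMeasurable (by fun_prop)),
      integral_linear_mul_linear, hc, h1]
    linear_combination c * e₀ * kron a b * ρ a * (kron i j * kron i j * hr i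
      + r i * kron_mul_self i j)
  have h2 : ∀ i, ∫ A, ∑ j, (∑ e, g' i a e * A e) * B i j A * (∑ e, g j b e * A e) ∂(gaussianPi v)
      = (c * e₀ * (kron a b * ρ a)) * r i := by
    intro i
    rw [integral_finsetSum _ fun j _ => (hint i j).integrable]
    simp_rw [this]
    rw [← Finset.mul_sum, sum_mul_kron]
  simp_rw [h2]
  rw [← Finset.mul_sum]
  ring

/-- The second moments of `G'ᵀ B G`. -/
theorem integral_conj_entry_mul (hB : ∀ i j, HasAllMoments (B i j) (gaussianPi v))
    (hBm : ∀ i j, Measurable (B i j)) (hBS : ∀ i j, DependsOn (B i j) S) (hST : Disjoint S T)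
    (hg : ∀ i j, ∀ e ∉ T, g i j e = 0) (hg' : ∀ i j, ∀ e ∉ T, g' i j e = 0)
    {r ρ : κ → ℝ} (hr : ∀ i, r i * r i = r i) {c c₁ c₂ α β γ : ℝ}
    (hc : ∀ i a j b, linCov v (g' i a) (g j b) = c * (kron i j * r i * (kron a b * ρ a)))
    (hc₁ : ∀ i a j b, linCov v (g i a) (g j b) = c₁ * (kron i j * r i * (kron a b * ρ a)))
    (hc₂ : ∀ i a j b, linCov v (g' i a) (g' j b) = c₂ * (kron i j * r i * (kron a b * ρ a)))
    (h2 : ∀ i j k l, ∫ A, B i j A * B k l A ∂(gaussianPi v) = isoTensor r α β γ i j k l)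
    (a b a' b' : κ) :
    ∫ A, (∑ i, ∑ j, (∑ e, g' i a e * A e) * B i j A * (∑ e, g j b e * A e))
        * (∑ k, ∑ l, (∑ e, g' k a' e * A e) * B k l A * (∑ e, g l b' e * A e)) ∂(gaussianPi v)
      = isoTensor ρ (c ^ 2 * (α * (∑ i, r i) ^ 2 + (β + γ) * ∑ i, r i))
          (c₁ * c₂ * (β * (∑ i, r i) ^ 2 + (α + γ) * ∑ i, r i))
          (c ^ 2 * (γ * (∑ i, r i) ^ 2 + (α + β) * ∑ i, r i)) a b a' b' := by
  have e0 : (fun A : ι → ℝ =>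
      (∑ i, ∑ j, (∑ e, g' i a e * A e) * B i j A * (∑ e, g j b e * A e))
        * (∑ k, ∑ l, (∑ e, g' k a' e * A e) * B k l A * (∑ e, g l b' e * A e)))
      = fun A => ∑ i, ∑ j, ∑ k, ∑ l, (B i j A * B k l A) *
        ((∑ e, g' i a e * A e) * (∑ e, g j b e * A e)
          * ((∑ e, g' k a' e * A e) * (∑ e, g l b' e * A e))) := by
    funext A
    rw [Finset.sum_mul]
    refine Finset.sum_congr rfl fun i _ => ?_
    rw [Finset.sum_mul]
    refine Finset.sum_congr rfl fun j _ => ?_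
    rw [Finset.mul_sum]
    refine Finset.sum_congr rfl fun k _ => ?_
    rw [Finset.mul_sum]
    refine Finset.sum_congr rfl fun l _ => ?_
    ring
  have hint : ∀ i j k l, HasAllMoments (fun A : ι → ℝ => (B i j A * B k l A) *
        ((∑ e, g' i a e * A e) * (∑ e, g j b e * A e)
          * ((∑ e, g' k a' e * A e) * (∑ e, g l b' e * A e)))) (gaussianPi v) := fun i j k l =>
    ((hB i j).mul (hB k l)).mul (((hasAllMoments_linear v _).mul (hasAllMoments_linear v _)).mul
      ((hasAllMoments_linear v _).mul (hasAllMoments_linear v _)))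
  -- By independence the expectation factors, and Wick's formula pairs the four Gaussian entries in
  -- three ways. The direct and the crossed pairing match each `g'` with a `g` and give `c²`; the
  -- remaining one matches `g'` with `g'` and `g` with `g`, giving `c₂ c₁`. Each pairing brings the
  -- deltas that contract the isotropic tensor in the corresponding way.
  have hterm : ∀ i j k l, ∫ A, (B i j A * B k l A) *
        ((∑ e, g' i a e * A e) * (∑ e, g j b e * A e)
          * ((∑ e, g' k a' e * A e) * (∑ e, g l b' e * A e))) ∂(gaussianPi v)
      = (c ^ 2 * (kron a b * ρ a * (kron a' b' * ρ a')))
          * (isoTensor r α β γ i j k l * (kron i j * kron k l))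
        + (c₁ * c₂ * (kron a a' * ρ a * (kron b b' * ρ b)))
          * (isoTensor r α β γ i j k l * (kron i k * kron j l))
        + (c ^ 2 * (kron a b' * ρ a * (kron b a' * ρ b)))
          * (isoTensor r α β γ i j k l * (kron i l * kron j k)) := by
    intro i j k l
    have hm : Measurable fun A => B i j A * B k l A := (hBm i j).mul (hBm k l)
    rw [(indepFun_of_dependsOn v hm (by fun_prop) hST
      ((hBS i j).mul (hBS k l)) (((dependsOn_linear (hg' i a)).mul
        (dependsOn_linear (hg j b))).mul ((dependsOn_linear (hg' k a')).mul
        (dependsOn_linear (hg l b'))))).integral_fun_mul_eq_mul_integral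
        hm.aestronglyMeasurable
        (Measurable.aestronglyMeasurable (by fun_prop)),
      integral_linear_four, hc, hc, hc₁, hc₂, hc, linCov_comm v (g j b), hc, h2]
    have E1 := mul_isoTensor_left hr α β γ i j k l
    have E2 := mul_isoTensor_snd hr α β γ i j k l
    have E3 := mul_isoTensor_trd hr α β γ i j k l
    rw [kron_comm k j, kron_comm a' b]
    have h7 : kron b a' * ρ a' = kron b a' * ρ b := (kron_mul_eq b a' ρ).symm
    have h8 : kron j k * r k = kron j k * r j := (kron_mul_eq j k r).symm
    have h9 : r i * (r k * isoTensor r α β γ i j k l) = isoTensor r α β γ i j k l := by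
      rw [E3, E1]
    have h10 : r i * (r j * isoTensor r α β γ i j k l) = isoTensor r α β γ i j k l := by
      rw [E2, E1]
    linear_combination (c ^ 2 * kron i j * kron a b * ρ a * kron k l * kron a' b' * ρ a') * h9
      + (c₁ * c₂ * kron i k * kron a a' * ρ a * kron j l * kron b b' * ρ b) * h10
      + (c ^ 2 * kron i l * r i * kron a b' * ρ a * isoTensor r α β γ i j k l) *
        (kron j k * r k) * h7
      + (c ^ 2 * kron i l * r i * kron a b' * ρ a * isoTensor r α β γ i j k l) *
        (kron b a' * ρ b) * h8
      + (c ^ 2 * kron i l * kron a b' * ρ a * kron b a' * ρ b * kron j k) * h10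
  rw [e0, integral_finsetSum _ fun i _ => (HasAllMoments.sum _ fun j _ => HasAllMoments.sum _
    fun k _ => HasAllMoments.sum _ fun l _ => hint i j k l).integrable]
  have h3 : ∀ i, ∫ A, ∑ j, ∑ k, ∑ l, (B i j A * B k l A) *
        ((∑ e, g' i a e * A e) * (∑ e, g j b e * A e)
          * ((∑ e, g' k a' e * A e) * (∑ e, g l b' e * A e))) ∂(gaussianPi v)
      = ∑ j, ∑ k, ∑ l, ∫ A, (B i j A * B k l A) *
        ((∑ e, g' i a e * A e) * (∑ e, g j b e * A e)
          * ((∑ e, g' k a' e * A e) * (∑ e, g l b' e * A e))) ∂(gaussianPi v) := by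
    intro i
    rw [integral_finsetSum _ fun j _ => (HasAllMoments.sum _
      fun k _ => HasAllMoments.sum _ fun l _ => hint i j k l).integrable]
    refine Finset.sum_congr rfl fun j _ => ?_
    rw [integral_finsetSum _ fun k _ =>
      (HasAllMoments.sum _ fun l _ => hint i j k l).integrable]
    refine Finset.sum_congr rfl fun k _ => ?_
    rw [integral_finsetSum _ fun l _ => (hint i j k l).integrable]
  simp_rw [h3, hterm, Finset.sum_add_distrib, ← Finset.mul_sum]
  rw [sum_kron_kron_left, sum_kron_kron_mid, sum_kron_kron_right, sum_isoTensor_left hr,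
    sum_isoTensor_mid hr, sum_isoTensor_right hr]
  simp only [isoTensor]
  ring

end Step

/-! ### Chains of site matrices -/

/-- The site with the natural number `l` as its index, read cyclically. -/
def ringSite (n : ℕ) [NeZero n] (l : ℕ) : Fin n := Fin.ofNat n l

section RingSite

variable {n : ℕ} [NeZero n]

theorem ringSite_succ (l : ℕ) : ringSite n (l + 1) = ringSite n l + 1 := by
  ext
  simp [ringSite, Fin.val_add]

theorem ringSite_val (k : Fin n) : ringSite n k = k := by
  ext
  simp [ringSite]

theorem ringSite_add_self (l : ℕ) : ringSite n (l + n) = ringSite n l := by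
  ext
  simp [ringSite]

/-- A window of at most `n` consecutive sites meets no site twice; this is what makes the tensors in
a chain independent. -/
theorem ringSite_ne {l l' : ℕ} (h : l < l') (h' : l' < l + n) : ringSite n l ≠ ringSite n l' := by
  intro e
  have e' : l % n = l' % n := congrArg Fin.val e
  have h1 : n ∣ l' - l := (Nat.modEq_iff_dvd' h.le).1 e'
  exact absurd (Nat.le_of_dvd (by omega) h1) (by omega)

end RingSite

/-- The indicator of the indices below the bond dimension `d`. -/
def bondInd (d i : ℕ) : ℝ := if i < d then 1 else 0

theorem bondInd_mul_self (d i : ℕ) : bondInd d i * bondInd d i = bondInd d i := by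
  by_cases h : i < d <;> simp [bondInd, h]

theorem sum_bondInd {d N : ℕ} (h : d ≤ N) : ∑ i : Fin N, bondInd d i = d := by
  rw [Fin.sum_univ_eq_sum_range (fun i => bondInd d i)]
  have e : (Finset.range N).filter (· < d) = Finset.range d := by
    ext i
    simp only [Finset.mem_filter, Finset.mem_range]
    omega
  simp only [bondInd, Finset.sum_ite, Finset.sum_const_zero, add_zero, Finset.sum_const,
    nsmul_eq_mul, mul_one, e, Finset.card_range]

section Factor

variable {n : ℕ} {q : Fin n → ℕ} (φ : ∀ k : Fin n, ℝ → Fin (q k) → ℝ)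

/-- The factor contributed to the limit kernel by the site `k`. -/
def siteFactor (σ : Fin n → ℝ) (x x' : Fin n → ℝ) (k : Fin n) : ℝ :=
  σ k ^ 2 * (φ k (x k) ⬝ᵥ φ k (x' k))

end Factor

section Chain

variable {n : ℕ} [NeZero n] {q D : Fin n → ℕ} (φ : ∀ k : Fin n, ℝ → Fin (q k) → ℝ)

/-- The coefficients of the entry `(i, j)` of the `k`-th tensor contracted with the feature
vector, as a linear form in all parameters. -/
def siteCoeff (k : Fin n) (x : Fin n → ℝ) (i j : ℕ) (e : MPSIndex q D) : ℝ :=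
  if e.1 = k ∧ (e.2.2.1 : ℕ) = i ∧ (e.2.2.2 : ℕ) = j then φ e.1 (x e.1) e.2.1 else 0

variable (N : ℕ)

/-- The `k`-th tensor contracted with the feature vector, as a matrix padded with zeros. -/
def siteMatrix (k : Fin n) (x : Fin n → ℝ) (A : MPSIndex q D → ℝ) :
    Matrix (Fin N) (Fin N) ℝ :=
  Matrix.of fun i j => ∑ e, siteCoeff φ k x i j e * A e

/-- The product of the `p` consecutive site matrices starting at the site `i`. -/
def mpsChain (x : Fin n → ℝ) (A : MPSIndex q D → ℝ) (i : ℕ) : ℕ → Matrix (Fin N) (Fin N) ℝ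
  | 0 => Matrix.diagonal fun a => bondInd (D (ringSite n i)) a
  | p + 1 => mpsChain x A i p * siteMatrix φ N (ringSite n (i + p)) x A

/-- The Gram matrix of two chains over the same sites. -/
def mpsGram (x x' : Fin n → ℝ) (i p : ℕ) (A : MPSIndex q D → ℝ) : Matrix (Fin N) (Fin N) ℝ :=
  (mpsChain φ N x' A i p).transpose * mpsChain φ N x A i p

variable {N}

theorem siteMatrix_apply (k : Fin n) (x : Fin n → ℝ) (A : MPSIndex q D → ℝ) (i j : Fin N) :
    siteMatrix φ N k x A i j = ∑ e, siteCoeff φ k x i j e * A e := rfl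

theorem siteCoeff_eq_zero {k : Fin n} {x : Fin n → ℝ} {i j : ℕ} {e : MPSIndex q D}
    (h : e ∉ {e : MPSIndex q D | e.1 = k}) : siteCoeff φ k x i j e = 0 :=
  if_neg fun h' => h h'.1

theorem siteMatrix_congr {k : Fin n} {x : Fin n → ℝ} {A A' : MPSIndex q D → ℝ}
    (h : ∀ e : MPSIndex q D, e.1 = k → A e = A' e) :
    siteMatrix φ N k x A = siteMatrix φ N k x A' := by
  ext i j
  exact dependsOn_linear (T := {e : MPSIndex q D | e.1 = k})
    (fun e he => siteCoeff_eq_zero φ he) h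

theorem mpsChain_congr {x : Fin n → ℝ} {A A' : MPSIndex q D → ℝ} (i p : ℕ)
    (h : ∀ e : MPSIndex q D, (∃ j < p, e.1 = ringSite n (i + j)) → A e = A' e) :
    mpsChain φ N x A i p = mpsChain φ N x A' i p := by
  induction p with
  | zero => rfl
  | succ p ih =>
    rw [mpsChain, mpsChain, ih fun e ⟨j, hj, he⟩ => h e ⟨j, by omega, he⟩,
      siteMatrix_congr φ fun e he => h e ⟨p, by omega, he⟩]

/-- Appending a site conjugates the Gram matrix by the new site matrices, `G ↦ S'ᵀ G S`. All moment
computations run through this recursion. -/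
theorem mpsGram_succ_apply (x x' : Fin n → ℝ) (i p : ℕ) (A : MPSIndex q D → ℝ) (a b : Fin N) :
    mpsGram φ N x x' i (p + 1) A a b = ∑ c : Fin N, ∑ d : Fin N,
      (∑ e, siteCoeff φ (ringSite n (i + p)) x' c a e * A e) * mpsGram φ N x x' i p A c d
        * (∑ e, siteCoeff φ (ringSite n (i + p)) x d b e * A e) := by
  have h : mpsGram φ N x x' i (p + 1) A = (siteMatrix φ N (ringSite n (i + p)) x' A).transpose
      * mpsGram φ N x x' i p A * siteMatrix φ N (ringSite n (i + p)) x A := by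
    simp only [mpsGram, mpsChain, Matrix.transpose_mul, Matrix.mul_assoc]
  rw [h, Matrix.mul_apply]
  simp only [Matrix.mul_apply, Matrix.transpose_apply, Finset.sum_mul, siteMatrix_apply]
  rw [Finset.sum_comm]

theorem mpsGram_zero_apply (x x' : Fin n → ℝ) (i : ℕ) (A : MPSIndex q D → ℝ) (a b : Fin N) :
    mpsGram φ N x x' i 0 A a b = kron a b * bondInd (D (ringSite n i)) a := by
  rw [mpsGram, mpsChain, mpsChain, Matrix.diagonal_transpose, Matrix.diagonal_mul_diagonal,
    Matrix.diagonal_apply, bondInd_mul_self]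
  simp [kron]

theorem hasAllMoments_mpsGram (v : MPSIndex q D → NNReal) (x x' : Fin n → ℝ) (i p : ℕ)
    (a b : Fin N) : HasAllMoments (fun A => mpsGram φ N x x' i p A a b) (gaussianPi v) := by
  induction p generalizing a b with
  | zero =>
    simp_rw [mpsGram_zero_apply]
    exact HasAllMoments.const _
  | succ p ih =>
    simp_rw [mpsGram_succ_apply]
    exact HasAllMoments.sum _ fun c _ => HasAllMoments.sum _ fun d _ =>
      ((hasAllMoments_linear v _).mul (ih c d)).mul (hasAllMoments_linear v _)

theorem measurable_mpsGram (x x' : Fin n → ℝ) (i p : ℕ) (a b : Fin N) :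
    Measurable fun A : MPSIndex q D → ℝ => mpsGram φ N x x' i p A a b := by
  induction p generalizing a b with
  | zero =>
    simp_rw [mpsGram_zero_apply]
    fun_prop
  | succ p ih =>
    simp_rw [mpsGram_succ_apply]
    fun_prop

theorem dependsOn_mpsGram (x x' : Fin n → ℝ) (i p : ℕ) (a b : Fin N) :
    DependsOn (fun A : MPSIndex q D → ℝ => mpsGram φ N x x' i p A a b)
      {e | ∃ j < p, e.1 = ringSite n (i + j)} := by
  intro A A' h
  simp only [mpsGram, mpsChain_congr φ i p h]

/-- The variances of the initial tensors. -/
def initVar (q D : Fin n → ℕ) (σ : Fin n → ℝ) (e : MPSIndex q D) : NNReal :=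
  (σ e.1 ^ 2 / √((D e.1 : ℝ) * (D (e.1 + 1) : ℝ))).toNNReal

theorem mpsInitLaw_eq (q D : Fin n → ℕ) (σ : Fin n → ℝ) :
    mpsInitLaw q D σ = gaussianPi (initVar q D σ) := rfl

theorem sum_fin_ite_val (d i : ℕ) (c : ℝ) :
    ∑ a : Fin d, (if (a : ℕ) = i then c else 0) = bondInd d i * c := by
  by_cases h : i < d
  · rw [Finset.sum_eq_single ⟨i, h⟩]
    · simp [bondInd, h]
    · intro a _ ha
      exact if_neg fun e => ha (Fin.ext e)
    · simp
  · rw [Finset.sum_eq_zero]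
    · simp [bondInd, h]
    · intro a _
      exact if_neg (by omega)

/-- Entries of a contracted tensor at different positions involve disjoint sets of parameters, hence
the two deltas. The sum over the physical index produces the inner product of the features, and the
indicators account for the padding by zeros. -/
theorem linCov_siteCoeff (σ : Fin n → ℝ) (k : Fin n) (x x' : Fin n → ℝ) (i a j b : Fin N) :
    linCov (initVar q D σ) (siteCoeff φ k x' i a) (siteCoeff φ k x j b)
      = siteFactor φ σ x x' k / √((D k : ℝ) * (D (k + 1) : ℝ))
        * (kron i j * bondInd (D k) i * (kron a b * bondInd (D (k + 1)) a)) := by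
  rw [linCov, Fintype.sum_sigma, Finset.sum_eq_single k]
  · rw [Fintype.sum_prod_type]
    have h : ∀ s : Fin (q k), ∑ y : Fin (D k) × Fin (D (k + 1)),
        siteCoeff (q := q) (D := D) φ k x' i a ⟨k, s, y⟩ * siteCoeff φ k x j b ⟨k, s, y⟩
          * (initVar q D σ ⟨k, s, y⟩ : ℝ)
        = (φ k (x k) s * φ k (x' k) s) * (σ k ^ 2 / √((D k : ℝ) * (D (k + 1) : ℝ))
        * (kron i j * bondInd (D k) i * (kron a b * bondInd (D (k + 1)) a))) := by
      intro s
      rw [Fintype.sum_prod_type]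
      have h2 : ∀ (y : Fin (D k)) (z : Fin (D (k + 1))),
          siteCoeff (q := q) (D := D) φ k x' i a ⟨k, s, y, z⟩ * siteCoeff φ k x j b ⟨k, s, y, z⟩
          * (initVar q D σ ⟨k, s, y, z⟩ : ℝ)
          = if (y : ℕ) = i then (if (z : ℕ) = a then
            (φ k (x k) s * φ k (x' k) s) * (σ k ^ 2 / √((D k : ℝ) * (D (k + 1) : ℝ)))
              * (kron i j * kron a b) else 0) else 0 := by
        intro y z
        have hv : (initVar q D σ ⟨k, s, y, z⟩ : ℝ) = σ k ^ 2 / √((D k : ℝ) * (D (k + 1) : ℝ)) :=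
          Real.coe_toNNReal _ (by positivity)
        rw [hv]
        by_cases hy : (y : ℕ) = i
        · by_cases hz : (z : ℕ) = a
          · simp only [siteCoeff, hy, hz, true_and, and_self, if_true, kron, ← Fin.ext_iff]
            by_cases h3 : i = j
            · by_cases h4 : a = b
              · simp only [h3, h4, and_self, if_true]; ring
              · simp [h3, h4]
            · simp [h3]
          · simp [siteCoeff, hz]
        · simp [siteCoeff, hy]
      have h3 : ∀ y : Fin (D k), ∑ z : Fin (D (k + 1)),
          siteCoeff (q := q) (D := D) φ k x' i a ⟨k, s, y, z⟩ * siteCoeff φ k x j b ⟨k, s, y, z⟩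
          * (initVar q D σ ⟨k, s, y, z⟩ : ℝ)
          = if (y : ℕ) = i then bondInd (D (k + 1)) a * ((φ k (x k) s * φ k (x' k) s)
              * (σ k ^ 2 / √((D k : ℝ) * (D (k + 1) : ℝ))) * (kron i j * kron a b)) else 0 := by
        intro y
        simp_rw [h2]
        split_ifs
        · rw [sum_fin_ite_val]
        · simp
      simp_rw [h3, sum_fin_ite_val]
      ring
    rw [Finset.sum_congr rfl fun s _ => h s, ← Finset.sum_mul]
    simp only [siteFactor, dotProduct]
    ring
  · intro k' _ hk
    refine Finset.sum_eq_zero fun y _ => ?_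
    rw [siteCoeff, if_neg fun h => hk h.1, zero_mul, zero_mul]
  · simp

theorem integral_mpsGram_succ (σ : Fin n → ℝ) (x x' : Fin n → ℝ) (i p : ℕ) (hp : p < n)
    (hN : ∀ k, D k ≤ N) {e₀ : ℝ}
    (h : ∀ a b : Fin N, ∫ A, mpsGram φ N x x' i p A a b ∂(gaussianPi (initVar q D σ))
      = e₀ * (kron a b * bondInd (D (ringSite n (i + p))) a)) (a b : Fin N) :
    ∫ A, mpsGram φ N x x' i (p + 1) A a b ∂(gaussianPi (initVar q D σ))
      = siteFactor φ σ x x' (ringSite n (i + p))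
          / √((D (ringSite n (i + p)) : ℝ) * (D (ringSite n (i + (p + 1))) : ℝ))
        * e₀ * D (ringSite n (i + p))
        * (kron a b * bondInd (D (ringSite n (i + (p + 1)))) a) := by
  simp_rw [mpsGram_succ_apply]
  -- As `p < n`, the new site is not among the `p` sites of the chain, so the Gram matrix so far is
  -- independent of the new tensor.
  have hST : Disjoint {e : MPSIndex q D | ∃ j < p, e.1 = ringSite n (i + j)}
      {e : MPSIndex q D | e.1 = ringSite n (i + p)} := by
    rw [Set.disjoint_left]
    rintro e ⟨j, hj, he⟩ he'
    exact ringSite_ne (by omega : i + j < i + p) (by omega) (he.symm.trans he')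
  rw [integral_conj_entry (fun _ _ => hasAllMoments_mpsGram φ _ x x' i p _ _)
    (fun _ _ => measurable_mpsGram φ x x' i p _ _) (fun _ _ => dependsOn_mpsGram φ x x' i p _ _)
    hST (fun _ _ _ he => siteCoeff_eq_zero φ he) (fun _ _ _ he => siteCoeff_eq_zero φ he)
    (r := fun a : Fin N => bondInd (D (ringSite n (i + p))) a)
    (fun _ => bondInd_mul_self _ _) (fun i' a j b => linCov_siteCoeff φ σ _ x x' i' a j b) h,
    sum_bondInd (hN _), ← add_assoc, ringSite_succ]

/-- In the first and third coefficients only covariances between the inputs `x` and `x'` enter. In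
the second, each tensor contraction is paired with one at the same input, which brings in the
factors at `(x, x)` and `(x', x')`. -/
theorem integral_mpsGram_mul_succ (σ : Fin n → ℝ) (x x' : Fin n → ℝ) (i p : ℕ) (hp : p < n)
    (hN : ∀ k, D k ≤ N) {α β γ : ℝ}
    (h : ∀ a b a' b' : Fin N, ∫ A, mpsGram φ N x x' i p A a b * mpsGram φ N x x' i p A a' b'
        ∂(gaussianPi (initVar q D σ))
      = isoTensor (fun a : Fin N => bondInd (D (ringSite n (i + p))) a) α β γ a b a' b')
    {d m : ℝ} (hd : d = D (ringSite n (i + p))) (hm : m = D (ringSite n (i + (p + 1))))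
    (a b a' b' : Fin N) :
    ∫ A, mpsGram φ N x x' i (p + 1) A a b * mpsGram φ N x x' i (p + 1) A a' b'
        ∂(gaussianPi (initVar q D σ))
      = isoTensor (fun a : Fin N => bondInd (D (ringSite n (i + (p + 1)))) a)
        ((siteFactor φ σ x x' (ringSite n (i + p)) / √(d * m)) ^ 2
          * (α * d ^ 2 + (β + γ) * d))
        (siteFactor φ σ x x (ringSite n (i + p)) / √(d * m)
          * (siteFactor φ σ x' x' (ringSite n (i + p)) / √(d * m))
          * (β * d ^ 2 + (α + γ) * d))
        ((siteFactor φ σ x x' (ringSite n (i + p)) / √(d * m)) ^ 2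
          * (γ * d ^ 2 + (α + β) * d)) a b a' b' := by
  simp_rw [mpsGram_succ_apply]
  have hST : Disjoint {e : MPSIndex q D | ∃ j < p, e.1 = ringSite n (i + j)}
      {e : MPSIndex q D | e.1 = ringSite n (i + p)} := by
    rw [Set.disjoint_left]
    rintro e ⟨j, hj, he⟩ he'
    exact ringSite_ne (by omega : i + j < i + p) (by omega) (he.symm.trans he')
  rw [integral_conj_entry_mul (fun _ _ => hasAllMoments_mpsGram φ _ x x' i p _ _)
    (fun _ _ => measurable_mpsGram φ x x' i p _ _) (fun _ _ => dependsOn_mpsGram φ x x' i p _ _)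
    hST (fun _ _ _ he => siteCoeff_eq_zero φ he) (fun _ _ _ he => siteCoeff_eq_zero φ he)
    (r := fun a : Fin N => bondInd (D (ringSite n (i + p))) a)
    (fun _ => bondInd_mul_self _ _) (fun i' a j b => linCov_siteCoeff φ σ _ x x' i' a j b)
    (fun i' a j b => linCov_siteCoeff φ σ _ x x i' a j b)
    (fun i' a j b => linCov_siteCoeff φ σ _ x' x' i' a j b) h,
    sum_bondInd (hN _), hd, hm, ← add_assoc, ringSite_succ]

end Chain

/-! ### Moment bounds for Gram matrices of chains -/

section MomentBounds

variable {n : ℕ} [NeZero n] {q : Fin n → ℕ} (φ : ∀ k : Fin n, ℝ → Fin (q k) → ℝ)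
  (σ : Fin n → ℝ)

/-- The expected normalised trace of the Gram matrix of a chain of `p` sites. -/
def chainFactor (x x' : Fin n → ℝ) (i p : ℕ) : ℝ :=
  ∏ j ∈ Finset.range p, siteFactor φ σ x x' (ringSite n (i + j))

/-- Induction on the length. Once `D_i / D_{i+p}` is split off, the coefficients evolve by `α ↦ κ²
(α + (β + γ)/d)`, `β ↦ κ₁κ₂ (β + (α + γ)/d)`, `γ ↦ κ² (γ + (α + β)/d)`. For `d → ∞` the three
decouple, so from the start `(1, 0, 0)` only `α` survives. The constant depends neither on the bond
dimensions nor on the padding. -/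
theorem exists_mpsGram_moments (x x' : Fin n → ℝ) (i p : ℕ) (hp : p ≤ n) :
    ∃ C : ℝ, 0 ≤ C ∧ ∀ (D : Fin n → ℕ) (N : ℕ) (θ : ℝ), (∀ k, D k ≤ N) → (∀ k, 0 < D k) →
      (∀ k, 1 / (D k : ℝ) ≤ θ) → θ ≤ 1 → ∃ α β γ : ℝ,
        |α - chainFactor φ σ x x' i p ^ 2| ≤ C * θ ∧ |β| ≤ C * θ ∧ |γ| ≤ C * θ ∧
        (∀ a b : Fin N, ∫ A, mpsGram φ N x x' i p A a b ∂(gaussianPi (initVar q D σ))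
          = chainFactor φ σ x x' i p * √((D (ringSite n i) : ℝ) / D (ringSite n (i + p)))
            * (kron a b * bondInd (D (ringSite n (i + p))) a)) ∧
        (∀ a b a' b' : Fin N, ∫ A, mpsGram φ N x x' i p A a b * mpsGram φ N x x' i p A a' b'
            ∂(gaussianPi (initVar q D σ))
          = isoTensor (fun a : Fin N => bondInd (D (ringSite n (i + p))) a)
            ((D (ringSite n i) : ℝ) / D (ringSite n (i + p)) * α)
            ((D (ringSite n i) : ℝ) / D (ringSite n (i + p)) * β)
            ((D (ringSite n i) : ℝ) / D (ringSite n (i + p)) * γ) a b a' b') := by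
  induction p with
  | zero =>
    refine ⟨0, le_rfl, fun D N θ hN hD hθ hθ1 => ⟨1, 0, 0, ?_, ?_, ?_, ?_, ?_⟩⟩
    · simp [chainFactor]
    · simp
    · simp
    · intro a b
      have : (D (ringSite n i) : ℝ) ≠ 0 := by exact_mod_cast (hD _).ne'
      simp [mpsGram_zero_apply, chainFactor, div_self this]
    · intro a b a' b'
      have : (D (ringSite n i) : ℝ) ≠ 0 := by exact_mod_cast (hD _).ne'
      simp [mpsGram_zero_apply, isoTensor, div_self this]
  | succ p ih =>
    obtain ⟨C, hC, ih⟩ := ih (by omega)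
    set κ := siteFactor φ σ x x' (ringSite n (i + p)) with hκ
    set κ₁ := siteFactor φ σ x x (ringSite n (i + p)) with hκ₁
    set κ₂ := siteFactor φ σ x' x' (ringSite n (i + p)) with hκ₂
    set L := chainFactor φ σ x x' i p with hL
    have hLs : chainFactor φ σ x x' i (p + 1) = L * κ := by
      rw [chainFactor, Finset.prod_range_succ]; rfl
    -- Of `3 C + L²`, one `C` bounds the inherited error, and `2 C + L²` bounds the two coefficients
    -- that enter with the factor `1/d`.
    refine ⟨(κ ^ 2 + |κ₁ * κ₂|) * (3 * C + L ^ 2), by positivity,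
      fun D N θ hN hD hθ hθ1 => ?_⟩
    obtain ⟨α, β, γ, hα, hβ, hγ, h1, h2⟩ := ih D N θ hN hD hθ hθ1
    set d : ℝ := (D (ringSite n (i + p)) : ℝ) with hd
    set m : ℝ := (D (ringSite n (i + (p + 1))) : ℝ) with hm
    set d₀ : ℝ := (D (ringSite n i) : ℝ) with hd₀
    have hd0 : 0 < d := by rw [hd]; exact_mod_cast hD _
    have hm0 : 0 < m := by rw [hm]; exact_mod_cast hD _
    have hd₀0 : 0 < d₀ := by rw [hd₀]; exact_mod_cast hD _
    have hθd : 1 / d ≤ θ := hθ _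
    have hθ0 : 0 ≤ θ := (by positivity : 0 ≤ 1 / d).trans hθd
    have small : ∀ (u B : ℝ), |u| ≤ B → |u / d| ≤ B * θ := by
      intro u B hu
      rw [div_eq_mul_one_div, abs_mul, abs_of_pos (a := 1 / d) (by positivity)]
      exact mul_le_mul hu hθd (by positivity) ((abs_nonneg _).trans hu)
    have hCθ : C * θ ≤ C := mul_le_of_le_one_right hC hθ1
    have hα' : |α| ≤ C + L ^ 2 := by
      have := abs_sub_abs_le_abs_sub α (L ^ 2)
      rw [abs_of_nonneg (sq_nonneg L)] at this
      linarith
    have hsq : √(d * m) ^ 2 = d * m := Real.sq_sqrt (by positivity)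
    have hsum : ∀ u w : ℝ, |u| ≤ C + L ^ 2 → |w| ≤ C → |(u + w) / d| ≤ (2 * C + L ^ 2) * θ :=
      fun u w hu hw => small _ _ ((abs_add_le u w).trans (by linarith))
    refine ⟨κ ^ 2 * (α + (β + γ) / d), κ₁ * κ₂ * (β + (α + γ) / d),
      κ ^ 2 * (γ + (α + β) / d), ?_, ?_, ?_, ?_, ?_⟩
    · rw [hLs, show κ ^ 2 * (α + (β + γ) / d) - (L * κ) ^ 2
        = κ ^ 2 * ((α - L ^ 2) + (β + γ) / d) by ring, abs_mul, abs_of_nonneg (sq_nonneg κ)]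
      have h3 := hsum β γ (by nlinarith [sq_nonneg L]) (hγ.trans hCθ)
      calc κ ^ 2 * |(α - L ^ 2) + (β + γ) / d|
          ≤ (κ ^ 2 + |κ₁ * κ₂|) * (C * θ + (2 * C + L ^ 2) * θ) :=
            mul_le_mul (by linarith [abs_nonneg (κ₁ * κ₂)])
              ((abs_add_le _ _).trans (add_le_add hα h3)) (abs_nonneg _) (by positivity)
        _ = _ := by ring
    · rw [abs_mul]
      have h3 := hsum α γ hα' (hγ.trans hCθ)
      calc |κ₁ * κ₂| * |β + (α + γ) / d|
          ≤ (κ ^ 2 + |κ₁ * κ₂|) * (C * θ + (2 * C + L ^ 2) * θ) :=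
            mul_le_mul (by linarith [sq_nonneg κ])
              ((abs_add_le _ _).trans (add_le_add hβ h3)) (abs_nonneg _) (by positivity)
        _ = _ := by ring
    · rw [abs_mul, abs_of_nonneg (sq_nonneg κ)]
      have h3 := hsum α β hα' (hβ.trans hCθ)
      calc κ ^ 2 * |γ + (α + β) / d|
          ≤ (κ ^ 2 + |κ₁ * κ₂|) * (C * θ + (2 * C + L ^ 2) * θ) :=
            mul_le_mul (by linarith [abs_nonneg (κ₁ * κ₂)])
              ((abs_add_le _ _).trans (add_le_add hγ h3)) (abs_nonneg _) (by positivity)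
        _ = _ := by ring
    · intro a b
      rw [integral_mpsGram_succ φ σ x x' i p (by omega) hN h1, hLs]
      congr 1
      rw [← hκ, ← hd, ← hm, Real.sqrt_div hd₀0.le, Real.sqrt_div hd₀0.le, Real.sqrt_mul hd0.le]
      have e1 : d = √d * √d := (Real.mul_self_sqrt hd0.le).symm
      have e2 : √d ≠ 0 := (Real.sqrt_pos.2 hd0).ne'
      have e3 : √m ≠ 0 := (Real.sqrt_pos.2 hm0).ne'
      calc κ / (√d * √m) * (L * (√d₀ / √d)) * d
          = κ / (√d * √m) * (L * (√d₀ / √d)) * (√d * √d) := by rw [← e1]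
        _ = L * κ * (√d₀ / √m) := by field_simp
    · intro a b a' b'
      rw [integral_mpsGram_mul_succ φ σ x x' i p (by omega) hN h2 hd hm]
      congr 1 <;> simp only [← hκ, ← hκ₁, ← hκ₂, div_mul_div_comm, div_pow, ← sq, hsq] <;>
        field_simp

/-- The normalised trace of the Gram matrix concentrates, and its normalised Frobenius norm
vanishes. -/
theorem exists_mpsGram_bounds (x x' : Fin n → ℝ) (i p : ℕ) (hp : p ≤ n) :
    ∃ C : ℝ, 0 ≤ C ∧ ∀ (D : Fin n → ℕ) (N : ℕ) (θ : ℝ), (∀ k, D k ≤ N) → (∀ k, 0 < D k) →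
      (∀ k, 1 / (D k : ℝ) ≤ θ) → θ ≤ 1 →
        (∫ A, ((mpsGram φ N x x' i p A).trace
            - chainFactor φ σ x x' i p * √((D (ringSite n i) : ℝ) * D (ringSite n (i + p)))) ^ 2
            ∂(mpsInitLaw q D σ)
          ≤ C * θ * ((D (ringSite n i) : ℝ) * D (ringSite n (i + p)))) ∧
        (∫ A, ∑ a, ∑ b, mpsGram φ N x x' i p A a b ^ 2 ∂(mpsInitLaw q D σ)
          ≤ C * θ * ((D (ringSite n i) : ℝ) * D (ringSite n (i + p)))) := by
  obtain ⟨C, hC, h⟩ := exists_mpsGram_moments φ σ x x' i p hp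
  set L := chainFactor φ σ x x' i p with hL
  refine ⟨3 * C + L ^ 2, by positivity, fun D N θ hN hD hθ hθ1 => ?_⟩
  obtain ⟨α, β, γ, hα, hβ, hγ, h1, h2⟩ := h D N θ hN hD hθ hθ1
  rw [mpsInitLaw_eq]
  set d : ℝ := (D (ringSite n (i + p)) : ℝ) with hd
  set d₀ : ℝ := (D (ringSite n i) : ℝ) with hd₀
  have hd0 : 0 < d := by rw [hd]; exact_mod_cast hD _
  have hd₀0 : 0 < d₀ := by rw [hd₀]; exact_mod_cast hD _
  have hθd : 1 / d ≤ θ := hθ _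
  have hθ0 : 0 ≤ θ := (by positivity : 0 ≤ 1 / d).trans hθd
  have hCθ : C * θ ≤ C := mul_le_of_le_one_right hC hθ1
  have hM := hasAllMoments_mpsGram φ (N := N) (initVar q D σ) x x' i p
  have hr : ∀ a : Fin N, bondInd (D (ringSite n (i + p))) a * bondInd (D (ringSite n (i + p))) a
    = bondInd (D (ringSite n (i + p))) a := fun a => bondInd_mul_self _ _
  have small : ∀ (u w : ℝ), u ≤ C * θ → w ≤ 2 * C + L ^ 2 →
      d₀ * d * (u + w / d) ≤ (3 * C + L ^ 2) * θ * (d₀ * d) := by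
    intro u w hu hw
    have h3 : w / d ≤ (2 * C + L ^ 2) * θ := by
      rw [div_eq_mul_one_div]
      exact mul_le_mul hw hθd (by positivity) (by positivity)
    calc d₀ * d * (u + w / d) ≤ d₀ * d * ((3 * C + L ^ 2) * θ) :=
          mul_le_mul_of_nonneg_left (by linarith) (by positivity)
      _ = _ := by ring
  have hβ' := (abs_le.1 hβ).2
  have hγ' := (abs_le.1 hγ).2
  have hα' := (abs_le.1 hα).2
  constructor
  · have htr : HasAllMoments (fun A => (mpsGram φ N x x' i p A).trace)
        (gaussianPi (initVar q D σ)) := HasAllMoments.sum _ fun a _ => hM a a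
    have e1 : ∫ A, (mpsGram φ N x x' i p A).trace ∂(gaussianPi (initVar q D σ))
        = L * √(d₀ * d) := by
      simp only [Matrix.trace, Matrix.diag_apply]
      rw [integral_finsetSum _ fun a _ => (hM a a).integrable]
      simp_rw [h1, kron_self, one_mul]
      rw [← Finset.mul_sum, sum_bondInd (hN _), ← hd, Real.sqrt_div hd₀0.le,
        Real.sqrt_mul hd₀0.le]
      have e1 : d = √d * √d := (Real.mul_self_sqrt hd0.le).symm
      have e2 : √d ≠ 0 := (Real.sqrt_pos.2 hd0).ne'
      calc L * (√d₀ / √d) * d = L * (√d₀ / √d) * (√d * √d) := by rw [← e1]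
        _ = _ := by field_simp
    have e2 : ∫ A, (mpsGram φ N x x' i p A).trace * (mpsGram φ N x x' i p A).trace
        ∂(gaussianPi (initVar q D σ)) = d₀ * d * (α + (β + γ) / d) := by
      simp only [Matrix.trace, Matrix.diag_apply, Finset.sum_mul_sum]
      rw [integral_finsetSum _ fun a _ =>
        (HasAllMoments.sum _ fun b _ => (hM a a).mul (hM b b)).integrable]
      have : ∀ a : Fin N, ∫ A, ∑ b, mpsGram φ N x x' i p A a a * mpsGram φ N x x' i p A b b
          ∂(gaussianPi (initVar q D σ)) = ∑ b, isoTensor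
            (fun a : Fin N => bondInd (D (ringSite n (i + p))) a)
            (d₀ / d * α) (d₀ / d * β) (d₀ / d * γ) a a b b := by
        intro a
        rw [integral_finsetSum _ fun b _ => ((hM a a).mul (hM b b)).integrable]
        simp_rw [h2]
      simp_rw [this]
      rw [sum_isoTensor_left hr, sum_bondInd (hN _), ← hd]
      field_simp
    -- Since the mean of the trace is exactly `L √(d₀ d)`, this expansion reduces the claim to the
    -- variance, where the leading part `L² d₀ d` cancels.
    have e3 : ∀ A : MPSIndex q D → ℝ, ((mpsGram φ N x x' i p A).trace - L * √(d₀ * d)) ^ 2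
        = (mpsGram φ N x x' i p A).trace * (mpsGram φ N x x' i p A).trace
          - 2 * (L * √(d₀ * d)) * (mpsGram φ N x x' i p A).trace + (L * √(d₀ * d)) ^ 2 :=
      fun A => by ring
    simp_rw [e3]
    have hsub : Integrable (fun A => (mpsGram φ N x x' i p A).trace
        * (mpsGram φ N x x' i p A).trace - 2 * (L * √(d₀ * d)) * (mpsGram φ N x x' i p A).trace)
        (gaussianPi (initVar q D σ)) := (htr.mul htr).integrable.sub (htr.integrable.const_mul _)
    rw [integral_add hsub (integrable_const _),
      integral_sub (htr.mul htr).integrable (htr.integrable.const_mul _),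
      integral_const_mul, e1, e2, integral_const]
    have h4 : √(d₀ * d) ^ 2 = d₀ * d := Real.sq_sqrt (by positivity)
    have h5 := small (α - L ^ 2) (β + γ) hα' (by nlinarith [sq_nonneg L])
    simp only [probReal_univ, one_smul]
    linear_combination h5 - L ^ 2 * h4
  · rw [integral_finsetSum _ fun a _ => (HasAllMoments.sum _ fun b _ => by
      simpa only [sq] using (hM a b).mul (hM a b)).integrable]
    have : ∀ a : Fin N, ∫ A, ∑ b, mpsGram φ N x x' i p A a b ^ 2
        ∂(gaussianPi (initVar q D σ)) = ∑ b, isoTensor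
          (fun a : Fin N => bondInd (D (ringSite n (i + p))) a)
          (d₀ / d * α) (d₀ / d * β) (d₀ / d * γ) a b a b := by
      intro a
      simp_rw [sq]
      rw [integral_finsetSum _ fun b _ => ((hM a b).mul (hM a b)).integrable]
      simp_rw [h2]
    simp_rw [this]
    -- In this contraction only the coefficient `β` is multiplied by the square of the dimension,
    -- and it is `O(θ)`; the coefficient `α` of order one gets only one factor `d`.
    rw [sum_isoTensor_mid hr, sum_bondInd (hN _), ← hd]
    have e : d₀ / d * β * d ^ 2 + (d₀ / d * α + d₀ / d * γ) * d
        = d₀ * d * (β + (α + γ) / d) := by field_simp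
    rw [e]
    exact small _ _ hβ' (by linarith)

end MomentBounds

/-! ### Frobenius and operator norms -/

section Norms

open scoped Matrix.Norms.L2Operator

variable {κ : Type*} [Fintype κ]

/-- The Frobenius norm of a square matrix. -/
def fro (M : Matrix κ κ ℝ) : ℝ := ‖WithLp.toLp 2 fun p : κ × κ => M p.1 p.2‖

theorem fro_nonneg (M : Matrix κ κ ℝ) : 0 ≤ fro M := norm_nonneg _

theorem fro_sq (M : Matrix κ κ ℝ) : fro M ^ 2 = ∑ a, ∑ b, M a b ^ 2 := by
  rw [fro, EuclideanSpace.real_norm_sq_eq, Fintype.sum_prod_type]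

theorem fro_add_le (M M' : Matrix κ κ ℝ) : fro (M + M') ≤ fro M + fro M' :=
  norm_add_le (WithLp.toLp 2 fun p : κ × κ => M p.1 p.2) (WithLp.toLp 2 fun p : κ × κ => M' p.1 p.2)

theorem fro_zero : fro (0 : Matrix κ κ ℝ) = 0 :=
  norm_zero (E := EuclideanSpace ℝ (κ × κ))

theorem fro_sum_le {ι : Type*} (s : Finset ι) (M : ι → Matrix κ κ ℝ) :
    fro (∑ i ∈ s, M i) ≤ ∑ i ∈ s, fro (M i) := by
  classical
  induction s using Finset.induction_on with
  | empty => simp [fro_zero]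
  | insert i s hi ih =>
    rw [Finset.sum_insert hi, Finset.sum_insert hi]
    exact (fro_add_le _ _).trans (by linarith)

theorem fro_transpose (M : Matrix κ κ ℝ) : fro M.transpose = fro M := by
  rw [← sq_eq_sq₀ (fro_nonneg _) (fro_nonneg _), fro_sq, fro_sq, Finset.sum_comm]
  rfl

theorem abs_trace_transpose_mul_le (M M' : Matrix κ κ ℝ) :
    |(M.transpose * M').trace| ≤ fro M * fro M' := by
  have h := abs_real_inner_le_norm (WithLp.toLp 2 fun p : κ × κ => M p.1 p.2)
    (WithLp.toLp 2 fun p : κ × κ => M' p.1 p.2)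
  refine le_trans (le_of_eq ?_) h
  congr 1
  rw [PiLp.inner_apply, Fintype.sum_prod_type, Finset.sum_comm]
  simp [Matrix.trace, Matrix.mul_apply, mul_comm]

variable [DecidableEq κ]

/-- The operator norm bound applied to each column of `M'`, squared and summed. -/
theorem fro_mul_le_left (M M' : Matrix κ κ ℝ) : fro (M * M') ≤ ‖M‖ * fro M' := by
  refine abs_le_of_sq_le_sq' ?_ (mul_nonneg (norm_nonneg _) (fro_nonneg _)) |>.2
  rw [mul_pow, fro_sq, fro_sq, Finset.sum_comm, Finset.sum_comm (f := fun a b => M' a b ^ 2),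
    Finset.mul_sum]
  refine Finset.sum_le_sum fun b _ => ?_
  have h := Matrix.l2_opNorm_mulVec M (WithLp.toLp 2 fun i => M' i b)
  have h2 := pow_le_pow_left₀ (norm_nonneg _) h 2
  rw [mul_pow, EuclideanSpace.real_norm_sq_eq, EuclideanSpace.real_norm_sq_eq] at h2
  exact h2

theorem norm_transpose_eq (M : Matrix κ κ ℝ) : ‖M.transpose‖ = ‖M‖ := by
  rw [← Matrix.conjTranspose_eq_transpose_of_trivial, Matrix.l2_opNorm_conjTranspose]

theorem fro_mul_le_right (M M' : Matrix κ κ ℝ) : fro (M * M') ≤ fro M * ‖M'‖ := by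
  rw [← fro_transpose, Matrix.transpose_mul, mul_comm, ← norm_transpose_eq M', ← fro_transpose M]
  exact fro_mul_le_left _ _

theorem norm_le_fro (M : Matrix κ κ ℝ) : ‖M‖ ≤ fro M := by
  rw [Matrix.l2_opNorm_def]
  refine ContinuousLinearMap.opNorm_le_bound _ (fro_nonneg _) fun y => ?_
  refine abs_le_of_sq_le_sq' ?_ (mul_nonneg (fro_nonneg _) (norm_nonneg _)) |>.2
  rw [mul_pow, fro_sq, EuclideanSpace.real_norm_sq_eq, EuclideanSpace.real_norm_sq_eq,
    Finset.sum_mul]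
  refine Finset.sum_le_sum fun a _ => ?_
  have := Finset.sum_mul_sq_le_sq_mul_sq Finset.univ (fun b => M a b) (fun b => y b)
  exact this

/-- The C*-identity followed by the domination of the operator norm by the Frobenius norm. It
converts second moments of a Gram matrix into operator norm bounds for the chain itself. -/
theorem norm_sq_le_fro_gram (M : Matrix κ κ ℝ) : ‖M‖ ^ 2 ≤ fro (M.transpose * M) := by
  have h := Matrix.l2_opNorm_conjTranspose_mul_self M
  rw [Matrix.conjTranspose_eq_transpose_of_trivial] at h
  rw [sq, ← h]
  exact norm_le_fro _

end Norms

/-! ### Perturbation of chains -/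

theorem sum_castLE {d N : ℕ} (h : d ≤ N) (f : Fin N → ℝ) (hf : ∀ a : Fin N, d ≤ a → f a = 0) :
    ∑ a : Fin d, f (Fin.castLE h a) = ∑ a, f a := by
  refine Fintype.sum_of_injective (Fin.castLE h) (Fin.castLE_injective h) _ _ (fun a ha => ?_)
    fun _ => rfl
  refine hf a ?_
  by_contra hlt
  exact ha ⟨⟨a, by omega⟩, rfl⟩

section Chain

open scoped Matrix.Norms.L2Operator

variable {n : ℕ} [NeZero n] {q D : Fin n → ℕ} (φ : ∀ k : Fin n, ℝ → Fin (q k) → ℝ) {N : ℕ}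

theorem siteMatrix_sub (k : Fin n) (x : Fin n → ℝ) (A A' : MPSIndex q D → ℝ) :
    siteMatrix φ N k x (A - A') = siteMatrix φ N k x A - siteMatrix φ N k x A' := by
  ext i j
  simp [siteMatrix_apply, mul_sub]

theorem siteMatrix_add_smul (k : Fin n) (x : Fin n → ℝ) (A A' : MPSIndex q D → ℝ) (t : ℝ) :
    siteMatrix φ N k x (A + t • A') = siteMatrix φ N k x A + t • siteMatrix φ N k x A' := by
  ext i j
  simp [siteMatrix_apply, mul_add, Finset.sum_add_distrib, Finset.mul_sum, mul_left_comm]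

theorem siteMatrix_apply_eq_zero {k : Fin n} (x : Fin n → ℝ) (A : MPSIndex q D → ℝ) {i j : Fin N}
    (h : D k ≤ i ∨ D (k + 1) ≤ j) : siteMatrix φ N k x A i j = 0 := by
  refine Finset.sum_eq_zero fun e _ => ?_
  rw [siteCoeff, if_neg, zero_mul]
  rintro ⟨rfl, h1, h2⟩
  have := e.2.2.1.2
  have := e.2.2.2.2
  omega

theorem siteMatrix_castLE (hN : ∀ k, D k ≤ N) (k : Fin n) (x : Fin n → ℝ)
    (A : MPSIndex q D → ℝ) (a : Fin (D k)) (b : Fin (D (k + 1))) :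
    siteMatrix φ N k x A (Fin.castLE (hN k) a) (Fin.castLE (hN (k + 1)) b)
      = ∑ s, φ k (x k) s * A ⟨k, s, a, b⟩ := by
  rw [siteMatrix_apply, Fintype.sum_sigma, Finset.sum_eq_single k]
  · rw [Fintype.sum_prod_type]
    refine Finset.sum_congr rfl fun s _ => ?_
    rw [Finset.sum_eq_single (a, b)]
    · simp [siteCoeff]
    · rintro ⟨a', b'⟩ _ h
      rw [siteCoeff, if_neg, zero_mul]
      rintro ⟨-, h1, h2⟩
      exact h (Prod.ext (Fin.ext h1) (Fin.ext h2))
    · simp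
  · intro k' _ hk
    refine Finset.sum_eq_zero fun y _ => ?_
    rw [siteCoeff, if_neg fun h => hk h.1, zero_mul]
  · simp

theorem siteMatrix_mul_diagonal (k : Fin n) (x : Fin n → ℝ) (A : MPSIndex q D → ℝ) :
    siteMatrix φ N k x A * Matrix.diagonal (fun a : Fin N => bondInd (D (k + 1)) a)
      = siteMatrix φ N k x A := by
  ext i j
  rw [Matrix.mul_diagonal]
  by_cases h : (j : ℕ) < D (k + 1)
  · simp [bondInd, h]
  · rw [siteMatrix_apply_eq_zero φ x A (Or.inr (by omega)), zero_mul]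

theorem diagonal_mul_siteMatrix (k : Fin n) (x : Fin n → ℝ) (A : MPSIndex q D → ℝ) :
    Matrix.diagonal (fun a : Fin N => bondInd (D k) a) * siteMatrix φ N k x A
      = siteMatrix φ N k x A := by
  ext i j
  rw [Matrix.diagonal_mul]
  by_cases h : (i : ℕ) < D k
  · simp [bondInd, h]
  · rw [siteMatrix_apply_eq_zero φ x A (Or.inl (by omega)), mul_zero]

/-- The Euclidean norm of the `k`-th tensor. -/
def tensorNorm (A : MPSIndex q D → ℝ) (k : Fin n) : ℝ :=
  √(∑ y : Fin (q k) × Fin (D k) × Fin (D (k + 1)), A ⟨k, y⟩ ^ 2)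

theorem tensorNorm_nonneg (A : MPSIndex q D → ℝ) (k : Fin n) : 0 ≤ tensorNorm A k :=
  Real.sqrt_nonneg _

theorem tensorNorm_sq (A : MPSIndex q D → ℝ) (k : Fin n) :
    tensorNorm A k ^ 2 = ∑ y : Fin (q k) × Fin (D k) × Fin (D (k + 1)), A ⟨k, y⟩ ^ 2 :=
  Real.sq_sqrt (Finset.sum_nonneg fun _ _ => sq_nonneg _)

/-- Cauchy–Schwarz in the physical index, entry by entry. -/
theorem fro_siteMatrix_le (hN : ∀ k, D k ≤ N) (k : Fin n) (x : Fin n → ℝ)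
    (A : MPSIndex q D → ℝ) :
    fro (siteMatrix φ N k x A) ≤ √(∑ s, φ k (x k) s ^ 2) * tensorNorm A k := by
  refine abs_le_of_sq_le_sq' ?_ (mul_nonneg (Real.sqrt_nonneg _) (tensorNorm_nonneg A k)) |>.2
  rw [mul_pow, Real.sq_sqrt (Finset.sum_nonneg fun _ _ => sq_nonneg _), tensorNorm_sq, fro_sq,
    ← sum_castLE (hN k) (fun a => ∑ b, siteMatrix φ N k x A a b ^ 2) (fun a ha =>
      Finset.sum_eq_zero fun b _ => by rw [siteMatrix_apply_eq_zero φ x A (Or.inl ha)]; simp)]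
  have h : ∀ a : Fin (D k), ∑ b, siteMatrix φ N k x A (Fin.castLE (hN k) a) b ^ 2
      ≤ ∑ b : Fin (D (k + 1)), (∑ s, φ k (x k) s ^ 2) * ∑ s, A ⟨k, s, a, b⟩ ^ 2 := by
    intro a
    rw [← sum_castLE (hN (k + 1)) (fun b => siteMatrix φ N k x A (Fin.castLE (hN k) a) b ^ 2)
      (fun b hb => by rw [siteMatrix_apply_eq_zero φ x A (Or.inr hb)]; simp)]
    refine Finset.sum_le_sum fun b _ => ?_
    rw [siteMatrix_castLE]
    exact Finset.sum_mul_sq_le_sq_mul_sq _ _ _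
  refine (Finset.sum_le_sum fun a _ => h a).trans (le_of_eq ?_)
  simp_rw [← Finset.mul_sum]
  congr 1
  rw [Fintype.sum_prod_type_right, Fintype.sum_prod_type]

theorem mpsChain_succ_left (x : Fin n → ℝ) (A : MPSIndex q D → ℝ) (i p : ℕ) :
    mpsChain φ N x A i (p + 1)
      = siteMatrix φ N (ringSite n i) x A * mpsChain φ N x A (i + 1) p := by
  induction p with
  | zero =>
    rw [mpsChain, mpsChain, mpsChain, ringSite_succ, siteMatrix_mul_diagonal]
    exact diagonal_mul_siteMatrix φ _ x A
  | succ p ih =>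
    rw [mpsChain, ih, mpsChain, Matrix.mul_assoc, show i + (p + 1) = i + 1 + p by ring]

theorem mpsChain_apply_eq_zero (x : Fin n → ℝ) (A : MPSIndex q D → ℝ) {i p : ℕ} {a b : Fin N}
    (h : D (ringSite n i) ≤ a ∨ D (ringSite n (i + p)) ≤ b) : mpsChain φ N x A i p a b = 0 := by
  rcases h with h | h
  · cases p with
    | zero =>
      rw [mpsChain, Matrix.diagonal_apply]
      split_ifs with hab
      · exact if_neg (by omega)
      · rfl
    | succ p =>
      rw [mpsChain_succ_left, Matrix.mul_apply]
      exact Finset.sum_eq_zero fun c _ => by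
        rw [siteMatrix_apply_eq_zero φ x A (Or.inl h), zero_mul]
  · cases p with
    | zero =>
      rw [mpsChain, Matrix.diagonal_apply]
      split_ifs with hab
      · subst hab
        exact if_neg (not_lt.2 h)
      · rfl
    | succ p =>
      rw [mpsChain, Matrix.mul_apply]
      refine Finset.sum_eq_zero fun c _ => ?_
      rw [siteMatrix_apply_eq_zero φ x A (Or.inr (by rwa [← ringSite_succ])), mul_zero]

/-- Telescoping: the tensors of `A₀` are exchanged for those of `A` one site at a time, so each term
contains a single displacement with a chain of `A` before it and a chain of `A₀` after it. -/
theorem mpsChain_sub (x : Fin n → ℝ) (A A₀ : MPSIndex q D → ℝ) (i p : ℕ) :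
    mpsChain φ N x A i p - mpsChain φ N x A₀ i p
      = ∑ j ∈ Finset.range p, mpsChain φ N x A i j
        * siteMatrix φ N (ringSite n (i + j)) x (A - A₀)
        * mpsChain φ N x A₀ (i + j + 1) (p - (j + 1)) := by
  induction p with
  | zero => simp [mpsChain]
  | succ p ih =>
    have h : ∀ j ∈ Finset.range p, mpsChain φ N x A i j
        * siteMatrix φ N (ringSite n (i + j)) x (A - A₀)
        * mpsChain φ N x A₀ (i + j + 1) (p + 1 - (j + 1))
        = mpsChain φ N x A i j * siteMatrix φ N (ringSite n (i + j)) x (A - A₀)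
        * mpsChain φ N x A₀ (i + j + 1) (p - (j + 1))
        * siteMatrix φ N (ringSite n (i + p)) x A₀ := by
      intro j hj
      have hj := Finset.mem_range.1 hj
      rw [show p + 1 - (j + 1) = p - (j + 1) + 1 by omega, mpsChain,
        show i + j + 1 + (p - (j + 1)) = i + p by omega]
      simp only [Matrix.mul_assoc]
    rw [Finset.sum_range_succ, Finset.sum_congr rfl h, ← Finset.sum_mul, ← ih, Nat.sub_self,
      mpsChain, mpsChain, mpsChain, Matrix.mul_assoc _ _ (Matrix.diagonal _), ringSite_succ,
      siteMatrix_mul_diagonal, siteMatrix_sub, Matrix.sub_mul, Matrix.mul_sub]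
    abel

/-- A chain whose initial sub-chains have operator norms of relative size `ε` keeps this
property under perturbations of its tensors of relative Frobenius size `U`. -/
theorem norm_mpsChain_le {x : Fin n → ℝ} {A A₀ : MPSIndex q D → ℝ} {b : Fin n → ℝ} {ε U : ℝ}
    (hb : ∀ k, 0 < b k) (hε : 0 ≤ ε) (hε1 : ε ≤ 1) (hU : 0 ≤ U)
    (h₀ : ∀ i p, p < n → ‖mpsChain φ N x A₀ i p‖ ≤ ε * (b (ringSite n i) * b (ringSite n (i + p))))
    (hΔ : ∀ k, fro (siteMatrix φ N k x (A - A₀)) ≤ U / (b k * b (k + 1))) (i p : ℕ) (hp : p < n) :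
    fro (mpsChain φ N x A i p - mpsChain φ N x A₀ i p)
        ≤ ε ^ 2 * (1 + U) ^ p * (b (ringSite n i) * b (ringSite n (i + p)))
      ∧ ‖mpsChain φ N x A i p‖
        ≤ ε * (1 + U) ^ p * (b (ringSite n i) * b (ringSite n (i + p))) := by
  induction p using Nat.strong_induction_on with
  | _ p ih =>
    set B := b (ringSite n i) * b (ringSite n (i + p)) with hB
    have hB0 : 0 < B := mul_pos (hb _) (hb _)
    -- The displacement is measured in Frobenius norm and its neighbours in operator norm. Each
    -- neighbour brings a factor `ε`, and the scales `b` at the two inner bonds cancel against those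
    -- in the bound for the displacement.
    have hterm : ∀ j ∈ Finset.range p, fro (mpsChain φ N x A i j
        * siteMatrix φ N (ringSite n (i + j)) x (A - A₀)
        * mpsChain φ N x A₀ (i + j + 1) (p - (j + 1))) ≤ ε ^ 2 * B * (U * (1 + U) ^ j) := by
      intro j hj
      have hj := Finset.mem_range.1 hj
      have h1 := (ih j hj (by omega)).2
      have h2 := hΔ (ringSite n (i + j))
      have h3 := h₀ (i + j + 1) (p - (j + 1)) (by omega)
      rw [show i + j + 1 + (p - (j + 1)) = i + p by omega, ringSite_succ] at h3
      have hb1 := hb (ringSite n (i + j))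
      have hb2 := hb (ringSite n (i + j) + 1)
      have hb0 := hb (ringSite n i)
      calc _ ≤ fro (mpsChain φ N x A i j * siteMatrix φ N (ringSite n (i + j)) x (A - A₀))
            * ‖mpsChain φ N x A₀ (i + j + 1) (p - (j + 1))‖ := fro_mul_le_right _ _
        _ ≤ (‖mpsChain φ N x A i j‖ * fro (siteMatrix φ N (ringSite n (i + j)) x (A - A₀)))
            * ‖mpsChain φ N x A₀ (i + j + 1) (p - (j + 1))‖ :=
          mul_le_mul_of_nonneg_right (fro_mul_le_left _ _) (norm_nonneg _)
        _ ≤ ((ε * (1 + U) ^ j * (b (ringSite n i) * b (ringSite n (i + j))))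
            * (U / (b (ringSite n (i + j)) * b (ringSite n (i + j) + 1))))
            * (ε * (b (ringSite n (i + j) + 1) * b (ringSite n (i + p)))) :=
          mul_le_mul (mul_le_mul h1 h2 (fro_nonneg _) (by positivity)) h3 (norm_nonneg _)
            (by positivity)
        _ = _ := by rw [hB]; field_simp
    have hgeom : ∑ j ∈ Finset.range p, U * (1 + U) ^ j = (1 + U) ^ p - 1 := by
      rw [← Finset.mul_sum, ← mul_geom_sum]
      ring
    have hfro : fro (mpsChain φ N x A i p - mpsChain φ N x A₀ i p)
        ≤ ε ^ 2 * B * ((1 + U) ^ p - 1) := by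
      rw [mpsChain_sub, ← hgeom, Finset.mul_sum]
      exact (fro_sum_le _ _).trans (Finset.sum_le_sum hterm)
    have hpos : 0 ≤ ε ^ 2 * B := by positivity
    constructor
    · linarith
    · have h1 : ‖mpsChain φ N x A i p‖ ≤ ‖mpsChain φ N x A₀ i p‖
          + fro (mpsChain φ N x A i p - mpsChain φ N x A₀ i p) := by
        have := norm_add_le (mpsChain φ N x A₀ i p) (mpsChain φ N x A i p - mpsChain φ N x A₀ i p)
        rw [add_sub_cancel] at this
        exact this.trans (by linarith [norm_le_fro (mpsChain φ N x A i p - mpsChain φ N x A₀ i p)])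
      have h2 := h₀ i p hp
      have h3 : ε ^ 2 * B * ((1 + U) ^ p - 1) ≤ ε * B * ((1 + U) ^ p - 1) := by
        -- Giving up one factor `ε` lets the growth `(1 + U) ^ p` absorb the increment and closes
        -- the induction for the operator norm.
        have : ε ^ 2 ≤ ε := by nlinarith
        have h4 : 1 ≤ (1 + U) ^ p := one_le_pow₀ (by linarith)
        gcongr
      linarith

end Chain

/-! ### The output and the kernel in terms of chains -/

section Output

variable {n : ℕ} [NeZero n] {q D : Fin n → ℕ} (φ : ∀ k : Fin n, ℝ → Fin (q k) → ℝ) {N : ℕ}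

theorem mpsOutput_eq_sum_prod (x : Fin n → ℝ) (A : MPSIndex q D → ℝ) :
    mpsOutput φ x A = ∑ a : ∀ k : Fin n, Fin (D k),
      ∏ k, ∑ s, φ k (x k) s * A ⟨k, s, a k, a (k + 1)⟩ := by
  rw [mpsOutput, Finset.sum_comm]
  refine Finset.sum_congr rfl fun a _ => ?_
  rw [Finset.prod_univ_sum, Fintype.piFinset_univ]
  refine Finset.sum_congr rfl fun s _ => ?_
  rw [← Finset.prod_mul_distrib]
  exact Finset.prod_congr rfl fun k _ => mul_comm _ _

theorem mpsOutput_eq_sum_siteMatrix (hN : ∀ k, D k ≤ N) (x : Fin n → ℝ)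
    (A : MPSIndex q D → ℝ) :
    mpsOutput φ x A = ∑ a : Fin n → Fin N, ∏ k, siteMatrix φ N k x A (a k) (a (k + 1)) := by
  rw [mpsOutput_eq_sum_prod]
  refine Fintype.sum_of_injective (fun a k => Fin.castLE (hN k) (a k)) ?_ _ _ ?_ ?_
  · intro a a' h
    funext k
    exact Fin.castLE_injective (hN k) (congrFun h k)
  · intro a ha
    by_contra h0
    refine ha ⟨fun k => ⟨a k, ?_⟩, rfl⟩
    by_contra hk
    exact h0 (Finset.prod_eq_zero (Finset.mem_univ k)
      (siteMatrix_apply_eq_zero φ x A (Or.inl (not_lt.1 hk))))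
  · intro a
    exact Finset.prod_congr rfl fun k _ => (siteMatrix_castLE φ hN k x A _ _).symm

/-- A matrix product as a sum over paths. The weight `F` on the two endpoints is kept free for the
induction, and later becomes the last site matrix, which closes the ring. -/
theorem sum_paths_eq_sum_mpsChain (x : Fin n → ℝ) (A : MPSIndex q D → ℝ) (p : ℕ)
    (F : Fin N → Fin N → ℝ) :
    ∑ f : Fin (p + 1) → Fin N, bondInd (D (ringSite n 0)) (f 0)
        * (∏ l : Fin p, siteMatrix φ N (ringSite n l) x A (f l.castSucc) (f l.succ))
        * F (f 0) (f (Fin.last p))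
      = ∑ a, ∑ b, mpsChain φ N x A 0 p a b * F a b := by
  induction p generalizing F with
  | zero =>
    rw [← (Equiv.funUnique (Fin 1) (Fin N)).symm.sum_comp]
    simp [mpsChain, Matrix.diagonal_apply]
  | succ p ih =>
    have h := ih fun a c => ∑ b, siteMatrix φ N (ringSite n p) x A c b * F a b
    have hR : ∑ a, ∑ b, mpsChain φ N x A 0 (p + 1) a b * F a b
        = ∑ a, ∑ c, mpsChain φ N x A 0 p a c
          * ∑ b, siteMatrix φ N (ringSite n p) x A c b * F a b := by
      refine Finset.sum_congr rfl fun a _ => ?_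
      simp_rw [mpsChain, Matrix.mul_apply, Finset.sum_mul, Finset.mul_sum, zero_add]
      rw [Finset.sum_comm]
      simp_rw [mul_assoc]
    rw [hR, ← h, ← (Fin.snocEquiv fun _ : Fin (p + 2) => Fin N).sum_comp,
      Fintype.sum_prod_type_right]
    refine Finset.sum_congr rfl fun f _ => ?_
    rw [Finset.mul_sum]
    refine Finset.sum_congr rfl fun b _ => ?_
    have h0 : (Fin.snocEquiv (fun _ : Fin (p + 2) => Fin N) (b, f)) 0 = f 0 := by
      rw [← Fin.castSucc_zero]
      simp [Fin.snocEquiv]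
    rw [Fin.prod_univ_castSucc, h0]
    simp only [Fin.snocEquiv, Equiv.coe_fn_mk, Fin.snoc_castSucc, Fin.snoc_last, Fin.succ_last,
      Fin.val_castSucc, Fin.val_last, Fin.succ_castSucc]
    ring

theorem mpsOutput_eq_trace_zero (hN : ∀ k, D k ≤ N) (x : Fin n → ℝ) (A : MPSIndex q D → ℝ) :
    mpsOutput φ x A = (mpsChain φ N x A 0 n).trace := by
  rw [mpsOutput_eq_sum_siteMatrix φ hN]
  obtain ⟨p, rfl⟩ : ∃ p, n = p + 1 := ⟨n - 1, by have := NeZero.pos n; omega⟩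
  have h := sum_paths_eq_sum_mpsChain φ x A p
    fun a b => siteMatrix φ N (Fin.last p) x A b a
  have hl : ringSite (p + 1) (0 + p) = Fin.last p := by
    rw [zero_add]; exact ringSite_val (Fin.last p)
  rw [mpsChain, hl, Matrix.trace]
  simp only [Matrix.diag_apply, Matrix.mul_apply]
  rw [← h]
  refine Finset.sum_congr rfl fun f _ => ?_
  rw [Fin.prod_univ_castSucc, Fin.last_add_one]
  -- The indicator at the first bond is redundant, because the last site matrix already vanishes
  -- outside the range of that bond.
  have hz : bondInd (D (ringSite (p + 1) 0)) (f 0)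
      * siteMatrix φ N (Fin.last p) x A (f (Fin.last p)) (f 0)
      = siteMatrix φ N (Fin.last p) x A (f (Fin.last p)) (f 0) := by
    have := congrFun (congrFun (siteMatrix_mul_diagonal φ (N := N) (Fin.last p) x A)
      (f (Fin.last p))) (f 0)
    rw [Matrix.mul_diagonal, Fin.last_add_one] at this
    rw [mul_comm]
    exact this
  have hp : ∀ l : Fin p, ringSite (p + 1) l = l.castSucc := fun l =>
    ringSite_val l.castSucc
  simp_rw [hp, Fin.coeSucc_eq_succ]
  linear_combination -(∏ l : Fin p, siteMatrix φ N l.castSucc x A (f l.castSucc) (f l.succ)) * hz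

/-- The output is the trace of the product of the site matrices around the ring, starting at
any site. -/
theorem mpsOutput_eq_trace (hN : ∀ k, D k ≤ N) (x : Fin n → ℝ) (A : MPSIndex q D → ℝ) (i : ℕ) :
    mpsOutput φ x A
      = (siteMatrix φ N (ringSite n i) x A * mpsChain φ N x A (i + 1) (n - 1)).trace := by
  have h1 : ∀ i, mpsChain φ N x A i n
      = siteMatrix φ N (ringSite n i) x A * mpsChain φ N x A (i + 1) (n - 1) := by
    intro i
    rw [← mpsChain_succ_left, Nat.sub_add_cancel (NeZero.pos n)]
  rw [← h1]
  -- Cyclicity of the trace moves the first factor to the end, where it is the site matrix of the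
  -- same site after a full turn.
  induction i with
  | zero => exact mpsOutput_eq_trace_zero φ hN x A
  | succ i ih =>
    rw [ih, h1, Matrix.trace_mul_comm]
    congr 1
    have h2 : mpsChain φ N x A (i + 1) n = mpsChain φ N x A (i + 1) (n - 1)
        * siteMatrix φ N (ringSite n (i + 1 + (n - 1))) x A := by
      rw [← mpsChain, Nat.succ_eq_add_one, Nat.sub_add_cancel (NeZero.pos n)]
    rw [h2, show i + 1 + (n - 1) = i + n by have := NeZero.pos n; omega, ringSite_add_self]

theorem differentiable_mpsOutput (x : Fin n → ℝ) :
    Differentiable ℝ (mpsOutput (D := D) φ x) := by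
  unfold mpsOutput
  fun_prop

theorem continuous_mpsPartial (x : Fin n → ℝ) (e : MPSIndex q D) :
    Continuous (mpsPartial φ e x) := by
  have h : ContDiff ℝ 1 (mpsOutput (D := D) φ x) := by
    unfold mpsOutput
    fun_prop
  unfold mpsPartial
  exact (h.continuous_fderiv one_ne_zero).clm_apply continuous_const

/-- The output is affine in a single tensor entry: the complementary chain of `n - 1` sites does not
contain site `k`. Its slope is the trace of that chain against a multiple of an elementary matrix,
which picks out one entry. -/
theorem mpsPartial_eq (hN : ∀ k, D k ≤ N) (x : Fin n → ℝ) (A : MPSIndex q D → ℝ) (k : Fin n)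
    (s : Fin (q k)) (a : Fin (D k)) (b : Fin (D (k + 1))) :
    mpsPartial φ ⟨k, s, a, b⟩ x A = φ k (x k) s * mpsChain φ N x A (k + 1) (n - 1)
      (Fin.castLE (hN (k + 1)) b) (Fin.castLE (hN k) a) := by
  set E : MPSIndex q D → ℝ := Pi.single ⟨k, s, a, b⟩ 1 with hE
  set M := mpsChain φ N x A (k + 1) (n - 1) with hM
  have hchain : ∀ t : ℝ, mpsChain φ N x (A + t • E) (k + 1) (n - 1) = M := by
    intro t
    refine mpsChain_congr φ _ _ fun e ⟨j, hj, he⟩ => ?_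
    have hne : e ≠ ⟨k, s, a, b⟩ := by
      rintro rfl
      have h1 : (k : Fin n) = ringSite n ((k : ℕ) + 1 + j) := he
      rw [← ringSite_val k] at h1
      simp only [ringSite_val] at h1
      refine ringSite_ne (n := n) (l := k) (l' := (k : ℕ) + 1 + j) (by omega) (by omega) ?_
      rw [ringSite_val]; exact h1
    simp [hE, hne]
  have hline : ∀ t : ℝ, mpsOutput φ x (A + t • E)
      = mpsOutput φ x A + t * (siteMatrix φ N k x E * M).trace := by
    intro t
    rw [mpsOutput_eq_trace φ hN x (A + t • E) k, mpsOutput_eq_trace φ hN x A k, hchain,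
      ringSite_val, siteMatrix_add_smul, Matrix.add_mul, Matrix.trace_add, Matrix.smul_mul,
      Matrix.trace_smul, smul_eq_mul]
  have hder : mpsPartial φ ⟨k, s, a, b⟩ x A = (siteMatrix φ N k x E * M).trace := by
    rw [mpsPartial, ← (differentiable_mpsOutput φ x A).lineDeriv_eq_fderiv, lineDeriv]
    simp_rw [← hE, hline]
    simp
  rw [hder, Matrix.trace]
  simp only [Matrix.diag_apply, Matrix.mul_apply]
  have hs : ∀ i j : Fin N, siteMatrix φ N k x E i j
      = kron (Fin.castLE (hN k) a) i * (kron (Fin.castLE (hN (k + 1)) b) j * φ k (x k) s) := by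
    intro i j
    rw [siteMatrix_apply, Finset.sum_eq_single (⟨k, s, a, b⟩ : MPSIndex q D)]
    · by_cases h1 : (a : ℕ) = i <;> by_cases h2 : (b : ℕ) = j <;>
        simp [hE, siteCoeff, kron, Fin.ext_iff, h1, h2]
    · intro e _ he
      simp [hE, he]
    · simp
  simp_rw [hs]
  have h3 : ∀ i, ∑ j, kron (Fin.castLE (hN k) a) i
      * (kron (Fin.castLE (hN (k + 1)) b) j * φ k (x k) s) * M j i
      = (φ k (x k) s * M (Fin.castLE (hN (k + 1)) b) i) * kron (Fin.castLE (hN k) a) i := by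
    intro i
    rw [← sum_mul_kron (Fin.castLE (hN (k + 1)) b) fun j => M j i, Finset.mul_sum,
      Finset.sum_mul]
    exact Finset.sum_congr rfl fun j _ => by ring
  simp_rw [h3]
  rw [sum_mul_kron]

theorem sum_mpsChain_castLE (hN : ∀ k, D k ≤ N) (x x' : Fin n → ℝ) (A : MPSIndex q D → ℝ)
    (k : Fin n) :
    ∑ a : Fin (D k), ∑ b : Fin (D (k + 1)),
      mpsChain φ N x A (k + 1) (n - 1) (Fin.castLE (hN (k + 1)) b) (Fin.castLE (hN k) a)
        * mpsChain φ N x' A (k + 1) (n - 1) (Fin.castLE (hN (k + 1)) b) (Fin.castLE (hN k) a)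
      = (mpsGram φ N x x' (k + 1) (n - 1) A).trace := by
  have hk : ringSite n ((k : ℕ) + 1 + (n - 1)) = k := by
    rw [show (k : ℕ) + 1 + (n - 1) = k + n by have := NeZero.pos n; omega, ringSite_add_self,
      ringSite_val]
  have hk1 : ringSite n ((k : ℕ) + 1) = k + 1 := by rw [ringSite_succ, ringSite_val]
  rw [sum_castLE (hN k) (fun a => ∑ b : Fin (D (k + 1)),
      mpsChain φ N x A (k + 1) (n - 1) (Fin.castLE (hN (k + 1)) b) a
        * mpsChain φ N x' A (k + 1) (n - 1) (Fin.castLE (hN (k + 1)) b) a)]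
  · rw [mpsGram, Matrix.trace]
    simp only [Matrix.diag_apply, Matrix.mul_apply, Matrix.transpose_apply]
    refine Finset.sum_congr rfl fun a _ => ?_
    rw [sum_castLE (hN (k + 1)) (fun b => mpsChain φ N x A (k + 1) (n - 1) b a
        * mpsChain φ N x' A (k + 1) (n - 1) b a)]
    · exact Finset.sum_congr rfl fun b _ => mul_comm _ _
    · intro b hb
      rw [mpsChain_apply_eq_zero φ x A (Or.inl (by rwa [hk1])), zero_mul]
  · intro a ha
    refine Finset.sum_eq_zero fun b _ => ?_
    rw [mpsChain_apply_eq_zero φ x A (Or.inr (by rwa [hk])), zero_mul]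

/-- The gradient in one tensor is a feature vector tensored with a chain, so inner products of
gradients factor into a feature part and a Gram trace. -/
theorem sum_mpsPartial_mul (hN : ∀ k, D k ≤ N) (x x' : Fin n → ℝ) (A : MPSIndex q D → ℝ)
    (k : Fin n) :
    ∑ y : Fin (q k) × Fin (D k) × Fin (D (k + 1)),
        mpsPartial φ ⟨k, y⟩ x A * mpsPartial φ ⟨k, y⟩ x' A
      = (φ k (x k) ⬝ᵥ φ k (x' k)) * (mpsGram φ N x x' (k + 1) (n - 1) A).trace := by
  rw [← sum_mpsChain_castLE φ hN, Fintype.sum_prod_type, dotProduct, Finset.sum_mul]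
  refine Finset.sum_congr rfl fun s _ => ?_
  rw [Fintype.sum_prod_type, Finset.mul_sum]
  refine Finset.sum_congr rfl fun a _ => ?_
  rw [Finset.mul_sum]
  refine Finset.sum_congr rfl fun b _ => ?_
  rw [mpsPartial_eq φ hN, mpsPartial_eq φ hN]
  ring

theorem mpsNTK_eq (hN : ∀ k, D k ≤ N) (A : MPSIndex q D → ℝ) (x x' : Fin n → ℝ) :
    mpsNTK φ A x x' = ∑ k, mpsRate D k * ((φ k (x k) ⬝ᵥ φ k (x' k))
      * (mpsGram φ N x x' (k + 1) (n - 1) A).trace) := by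
  rw [mpsNTK, Fintype.sum_sigma]
  refine Finset.sum_congr rfl fun k _ => ?_
  rw [← sum_mpsPartial_mul φ hN, Finset.mul_sum]

theorem sum_mpsPartial_sq (hN : ∀ k, D k ≤ N) (x : Fin n → ℝ) (A : MPSIndex q D → ℝ)
    (k : Fin n) :
    √(∑ y : Fin (q k) × Fin (D k) × Fin (D (k + 1)), mpsPartial φ ⟨k, y⟩ x A ^ 2)
      = √(∑ s, φ k (x k) s ^ 2) * fro (mpsChain φ N x A (k + 1) (n - 1)) := by
  simp_rw [sq]
  rw [sum_mpsPartial_mul φ hN, Real.sqrt_mul (by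
    simp only [dotProduct]; exact Finset.sum_nonneg fun _ _ => mul_self_nonneg _)]
  congr 1
  rw [← Real.sqrt_sq (fro_nonneg _), fro_sq, Finset.sum_comm]
  simp [mpsGram, Matrix.trace, Matrix.mul_apply, sq]

theorem continuous_mpsNTK (x x' : Fin n → ℝ) :
    Continuous fun A : MPSIndex q D → ℝ => mpsNTK φ A x x' := by
  unfold mpsNTK
  exact continuous_finsetSum _ fun e _ => continuous_const.mul
    ((continuous_mpsPartial φ x e).mul (continuous_mpsPartial φ x' e))

end Output

/-! ### Gradient-flow training -/

section Increments

theorem intervalIntegrable_fun_sum {ι : Type*} (s : Finset ι) {f : ι → ℝ → ℝ} {a b : ℝ}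
    (h : ∀ i ∈ s, IntervalIntegrable (f i) volume a b) :
    IntervalIntegrable (fun t => ∑ i ∈ s, f i t) volume a b := by
  convert! IntervalIntegrable.sum s h using 1
  funext t
  simp

theorem sqrt_sum_sq_sum_le {κ ι : Type*} [Fintype κ] (s : Finset ι) (c : ι → ℝ) (v : ι → κ → ℝ) :
    √(∑ y, (∑ j ∈ s, c j * v j y) ^ 2) ≤ ∑ j ∈ s, |c j| * √(∑ y, v j y ^ 2) := by
  have h := norm_sum_le s fun j => c j • (WithLp.toLp 2 (v j) : EuclideanSpace ℝ κ)
  simp_rw [norm_smul, Real.norm_eq_abs, EuclideanSpace.norm_eq, Real.norm_eq_abs, sq_abs] at h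
  simpa using h

/-- A curve whose velocity has Euclidean norm at most `ν` moves by at most `∫ ν`. -/
theorem sqrt_sum_sq_sub_le_integral {κ : Type*} [Fintype κ] {a a' : ℝ → κ → ℝ} {ν : ℝ → ℝ}
    {t : ℝ} (ht : 0 ≤ t) (hcont : ∀ e, ContinuousOn (fun s => a s e) (Set.Icc 0 t))
    (hderiv : ∀ s ∈ Set.Ioo 0 t, ∀ e, HasDerivAt (fun s => a s e) (a' s e) s)
    (hint : ∀ e, IntervalIntegrable (fun s => a' s e) volume 0 t)
    (hν : IntervalIntegrable ν volume 0 t)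
    (hle : ∀ s ∈ Set.Ioo 0 t, √(∑ e, a' s e ^ 2) ≤ ν s) :
    √(∑ e, (a t e - a 0 e) ^ 2) ≤ ∫ s in (0 : ℝ)..t, ν s := by
  set δ : κ → ℝ := fun e => a t e - a 0 e with hδ
  set r := √(∑ e, δ e ^ 2) with hr
  have hr0 : 0 ≤ r := Real.sqrt_nonneg _
  have hr2 : r * r = ∑ e, δ e ^ 2 := Real.mul_self_sqrt (Finset.sum_nonneg fun _ _ => sq_nonneg _)
  have hftc : ∀ e, ∫ s in (0 : ℝ)..t, a' s e = δ e := fun e =>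
    intervalIntegral.integral_eq_sub_of_hasDerivAt_of_le ht (hcont e)
      (fun s hs => hderiv s hs e) (hint e)
  -- The velocity is tested against the total displacement `δ`: then `r² ≤ r ∫ ν`, and one factor
  -- `r` is divided out.
  have h1 : ∑ e, δ e ^ 2 = ∫ s in (0 : ℝ)..t, ∑ e, δ e * a' s e := by
    rw [intervalIntegral.integral_finsetSum fun e _ => (hint e).const_mul _]
    refine Finset.sum_congr rfl fun e _ => ?_
    rw [intervalIntegral.integral_const_mul, hftc, sq]
  have hI : IntervalIntegrable (fun s => ∑ e, δ e * a' s e) volume 0 t :=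
    intervalIntegrable_fun_sum _ fun e _ => (hint e).const_mul (δ e)
  have h2 : ∫ s in (0 : ℝ)..t, ∑ e, δ e * a' s e ≤ ∫ s in (0 : ℝ)..t, r * ν s := by
    refine intervalIntegral.integral_mono_on_of_le_Ioo ht hI (hν.const_mul r) fun s hs => ?_
    exact (Real.sum_mul_le_sqrt_mul_sqrt _ _ _).trans
      (mul_le_mul_of_nonneg_left (hle s hs) hr0)
  rw [intervalIntegral.integral_const_mul] at h2
  have h0 : 0 ≤ ∫ s in (0 : ℝ)..t, ν s := by
    rw [intervalIntegral.integral_of_le ht, integral_Ioc_eq_integral_Ioo]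
    exact setIntegral_nonneg measurableSet_Ioo fun s hs => (Real.sqrt_nonneg _).trans (hle s hs)
  rcases hr0.eq_or_lt with h | h
  · rw [← h]; exact h0
  · refine le_of_mul_le_mul_left ?_ h
    rw [hr2, h1]
    exact h2

end Increments

/-! ### The weighted norm of training directions. -/

section DataNorm

variable {m : ℕ} {w : Fin m → ℝ}

theorem dataNorm_nonneg (w d : Fin m → ℝ) : 0 ≤ dataNorm w d := Real.sqrt_nonneg _

theorem sum_weight_abs_le (hw : ∀ j, 0 ≤ w j) (d : Fin m → ℝ) :
    ∑ j, w j * |d j| ≤ √(∑ j, w j) * dataNorm w d := by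
  have h := Real.sum_mul_le_sqrt_mul_sqrt Finset.univ (fun j => √(w j)) fun j => √(w j) * |d j|
  refine le_trans (le_of_eq ?_) (h.trans (le_of_eq ?_))
  · refine Finset.sum_congr rfl fun j _ => ?_
    rw [← mul_assoc, Real.mul_self_sqrt (hw j)]
  · simp_rw [mul_pow, Real.sq_sqrt (hw _), sq_abs]
    rfl

theorem dataNorm_le_sum (hw : ∀ j, 0 ≤ w j) (d : Fin m → ℝ) :
    dataNorm w d ≤ ∑ j, √(w j) * |d j| := by
  have h0 : ∀ j, 0 ≤ √(w j) * |d j| := fun j => mul_nonneg (Real.sqrt_nonneg _) (abs_nonneg _)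
  rw [dataNorm, Real.sqrt_le_left (Finset.sum_nonneg fun j _ => h0 j), sq, Finset.sum_mul]
  refine Finset.sum_le_sum fun j _ => ?_
  calc w j * d j ^ 2 = (√(w j) * |d j|) * (√(w j) * |d j|) := by
        rw [mul_mul_mul_comm, Real.mul_self_sqrt (hw j), abs_mul_abs_self, sq]
    _ ≤ _ := mul_le_mul_of_nonneg_left
        (Finset.single_le_sum (fun i _ => h0 i) (Finset.mem_univ j)) (h0 j)

theorem intervalIntegrable_dataNorm (hw : ∀ j, 0 ≤ w j) {d : ℝ → Fin m → ℝ} {a b : ℝ}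
    (hd : ∀ j, IntervalIntegrable (fun t => d t j) volume a b) :
    IntervalIntegrable (fun t => dataNorm w (d t)) volume a b := by
  have hs : IntervalIntegrable (fun t => ∑ j, √(w j) * |d t j|) volume a b :=
    intervalIntegrable_fun_sum _ fun j _ => (hd j).abs.const_mul √(w j)
  refine hs.mono_fun ?_ (Eventually.of_forall fun t => ?_)
  · refine Real.continuous_sqrt.comp_aestronglyMeasurable ?_
    refine Finset.aestronglyMeasurable_fun_sum _ fun j _ => ?_
    exact ((hd j).aestronglyMeasurable_restrict_uIoc.pow 2).const_mul (w j)
  · simp only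
    rw [Real.norm_of_nonneg (dataNorm_nonneg _ _), Real.norm_of_nonneg
      (Finset.sum_nonneg fun j _ => mul_nonneg (Real.sqrt_nonneg _) (abs_nonneg _))]
    exact dataNorm_le_sum hw _

end DataNorm

/-! ### The natural scale of the bonds. -/

section BondScale

variable {n : ℕ}

/-- The fourth root of a bond dimension. -/
def bondScale (D : Fin n → ℕ) (k : Fin n) : ℝ := (D k : ℝ) ^ (1 / 4 : ℝ)

theorem bondScale_pos {D : Fin n → ℕ} (hD : ∀ k, 0 < D k) (k : Fin n) : 0 < bondScale D k :=
  Real.rpow_pos_of_pos (by exact_mod_cast hD k) _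

theorem bondScale_mul_sq (D : Fin n → ℕ) (k l : Fin n) :
    (bondScale D k * bondScale D l) ^ 2 = √((D k : ℝ) * D l) := by
  rw [bondScale, bondScale, ← Real.mul_rpow (by positivity) (by positivity), ← Real.rpow_natCast,
    ← Real.rpow_mul (by positivity), Real.sqrt_eq_rpow]
  norm_num

end BondScale

/-! ### Stability of typical parameters along the gradient flow. -/

section Training

open scoped Matrix.Norms.L2Operator

variable {n m : ℕ} [NeZero n] {q D : Fin n → ℕ} (φ : ∀ k : Fin n, ℝ → Fin (q k) → ℝ) {N : ℕ}

theorem mpsRate_eq (D : Fin n → ℕ) (k : Fin n) :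
    mpsRate D k = 1 / (bondScale D k * bondScale D (k + 1)) ^ 2 := by
  rw [bondScale_mul_sq, mpsRate, Real.rpow_neg (by positivity), Real.sqrt_eq_rpow, one_div, one_div]

/-- Initial parameters whose chains have small operator norms and bounded Frobenius norms on the
scale of the bond dimensions, for all inputs in `S`. -/
structure IsTypicalInit (N : ℕ) (S : Set (Fin n → ℝ)) (ε R : ℝ) (A : MPSIndex q D → ℝ) :
    Prop where
  norm_le : ∀ x ∈ S, ∀ i p, p < n → ‖mpsChain φ N x A i p‖
    ≤ ε * (bondScale D (ringSite n i) * bondScale D (ringSite n (i + p)))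
  fro_le : ∀ x ∈ S, ∀ k : Fin n, fro (mpsChain φ N x A (k + 1) (n - 1))
    ≤ R * (bondScale D k * bondScale D (k + 1))

variable {φ}

/-- Application of `norm_mpsChain_le` to the chain that omits site `k`, with relative displacement
`U = Φ V`. The smallness condition keeps the change below one unit of the scale, hence `R + 1`. -/
theorem IsTypicalInit.fro_perturbed {S : Set (Fin n → ℝ)} {ε R V Φ : ℝ} {A A₀ : MPSIndex q D → ℝ}
    (hA₀ : IsTypicalInit φ N S ε R A₀) (hN : ∀ k, D k ≤ N) (hD : ∀ k, 0 < D k)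
    (hε : 0 ≤ ε) (hε1 : ε ≤ 1) (hV : 0 ≤ V) (hΦ : 0 ≤ Φ)
    (hφ : ∀ x ∈ S, ∀ k, √(∑ s, φ k (x k) s ^ 2) ≤ Φ)
    (hsmall : ε ^ 2 * (1 + Φ * V) ^ (n - 1) ≤ 1)
    (hA : ∀ k, tensorNorm (A - A₀) k ≤ V / (bondScale D k * bondScale D (k + 1)))
    {x : Fin n → ℝ} (hx : x ∈ S) (k : Fin n) :
    fro (mpsChain φ N x A (k + 1) (n - 1) - mpsChain φ N x A₀ (k + 1) (n - 1))
        ≤ ε ^ 2 * (1 + Φ * V) ^ (n - 1) * (bondScale D k * bondScale D (k + 1))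
      ∧ fro (mpsChain φ N x A (k + 1) (n - 1))
        ≤ (R + 1) * (bondScale D k * bondScale D (k + 1)) := by
  have hb := bondScale_pos hD
  have h := (norm_mpsChain_le φ (N := N) hb hε hε1 (mul_nonneg hΦ hV)
    (fun i p hp => hA₀.norm_le x hx i p hp) (A := A) (fun l => by
      have h1 := fro_siteMatrix_le φ hN l x (A - A₀)
      refine h1.trans ?_
      rw [mul_div_assoc]
      exact mul_le_mul (hφ x hx l) (hA l) (tensorNorm_nonneg _ _) hΦ) ((k : ℕ) + 1) (n - 1)
      (Nat.sub_lt (NeZero.pos n) one_pos)).1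
  have e1 : ringSite n ((k : ℕ) + 1 + (n - 1)) = k := by
    rw [show (k : ℕ) + 1 + (n - 1) = k + n by have := NeZero.pos n; omega, ringSite_add_self,
      ringSite_val]
  rw [e1, ringSite_succ, ringSite_val, mul_comm (bondScale D (k + 1))] at h
  refine ⟨h, ?_⟩
  have h2 := fro_add_le (mpsChain φ N x A₀ (k + 1) (n - 1))
    (mpsChain φ N x A (k + 1) (n - 1) - mpsChain φ N x A₀ (k + 1) (n - 1))
  rw [add_sub_cancel] at h2
  have h3 := hA₀.fro_le x hx k
  have h4 := mul_le_mul_of_nonneg_right hsmall (mul_pos (hb k) (hb (k + 1))).le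
  linarith

/-- At each site the Gram trace is bilinear in two chains of Frobenius size `O(β)` that change by
`O(ε² β)`, and the learning rate `β⁻²` cancels the scale. -/
theorem IsTypicalInit.ntk_perturbed {S : Set (Fin n → ℝ)} {ε R V Φ : ℝ} {A A₀ : MPSIndex q D → ℝ}
    (hA₀ : IsTypicalInit φ N S ε R A₀) (hN : ∀ k, D k ≤ N) (hD : ∀ k, 0 < D k)
    (hε : 0 ≤ ε) (hε1 : ε ≤ 1) (hV : 0 ≤ V) (hΦ : 0 ≤ Φ)
    (hφ : ∀ x ∈ S, ∀ k, √(∑ s, φ k (x k) s ^ 2) ≤ Φ)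
    (hsmall : ε ^ 2 * (1 + Φ * V) ^ (n - 1) ≤ 1)
    (hA : ∀ k, tensorNorm (A - A₀) k ≤ V / (bondScale D k * bondScale D (k + 1)))
    {x x' : Fin n → ℝ} (hx : x ∈ S) (hx' : x' ∈ S) :
    |mpsNTK φ A x x' - mpsNTK φ A₀ x x'|
      ≤ n * (Φ ^ 2 * ((2 * R + 1) * (ε ^ 2 * (1 + Φ * V) ^ (n - 1)))) := by
  have hb := bondScale_pos hD
  rw [mpsNTK_eq φ hN, mpsNTK_eq φ hN, ← Finset.sum_sub_distrib]
  refine (Finset.abs_sum_le_sum_abs _ _).trans ?_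
  have hn : (n : ℝ) * (Φ ^ 2 * ((2 * R + 1) * (ε ^ 2 * (1 + Φ * V) ^ (n - 1))))
      = ∑ _k : Fin n, Φ ^ 2 * ((2 * R + 1) * (ε ^ 2 * (1 + Φ * V) ^ (n - 1))) := by
    simp
  rw [hn]
  refine Finset.sum_le_sum fun k _ => ?_
  set β := bondScale D k * bondScale D (k + 1) with hβ
  have hβ0 : 0 < β := mul_pos (hb k) (hb (k + 1))
  set η := ε ^ 2 * (1 + Φ * V) ^ (n - 1) with hη
  have hη0 : 0 ≤ η := by positivity
  obtain ⟨h1, h2⟩ := hA₀.fro_perturbed hN hD hε hε1 hV hΦ hφ hsmall hA hx k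
  obtain ⟨h1', h2'⟩ := hA₀.fro_perturbed hN hD hε hε1 hV hΦ hφ hsmall hA hx' k
  have h3' := hA₀.fro_le x' hx' k
  set M := mpsChain φ N x A (k + 1) (n - 1)
  set M' := mpsChain φ N x' A (k + 1) (n - 1)
  set M₀ := mpsChain φ N x A₀ (k + 1) (n - 1)
  set M₀' := mpsChain φ N x' A₀ (k + 1) (n - 1)
  have htr : (mpsGram φ N x x' (k + 1) (n - 1) A).trace
      - (mpsGram φ N x x' (k + 1) (n - 1) A₀).trace
      = ((M' - M₀').transpose * M).trace + (M₀'.transpose * (M - M₀)).trace := by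
    rw [← Matrix.trace_sub, ← Matrix.trace_add]
    congr 1
    simp only [mpsGram, Matrix.transpose_sub, Matrix.sub_mul, Matrix.mul_sub]
    abel
  have htr2 : |(mpsGram φ N x x' (k + 1) (n - 1) A).trace
      - (mpsGram φ N x x' (k + 1) (n - 1) A₀).trace| ≤ (2 * R + 1) * η * β ^ 2 := by
    rw [htr]
    calc _ ≤ fro (M' - M₀') * fro M + fro M₀' * fro (M - M₀) :=
          (abs_add_le _ _).trans (add_le_add (abs_trace_transpose_mul_le _ _)
            (abs_trace_transpose_mul_le _ _))
      _ ≤ (η * β) * ((R + 1) * β) + (R * β) * (η * β) :=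
          add_le_add (mul_le_mul h1' h2 (fro_nonneg _) (by positivity))
            (mul_le_mul h3' h1 (fro_nonneg _) ((fro_nonneg _).trans h3'))
      _ = _ := by ring
  have hdot : |φ k (x k) ⬝ᵥ φ k (x' k)| ≤ Φ ^ 2 := by
    refine (Finset.abs_sum_le_sum_abs _ _).trans ?_
    have := Real.sum_mul_le_sqrt_mul_sqrt Finset.univ (fun s => |φ k (x k) s|)
      fun s => |φ k (x' k) s|
    simp_rw [sq_abs] at this
    simp_rw [abs_mul]
    refine this.trans ?_
    rw [sq]
    exact mul_le_mul (hφ x hx k) (hφ x' hx' k) (Real.sqrt_nonneg _) hΦ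
  rw [mpsRate_eq, ← hβ, ← mul_sub, ← mul_sub, abs_mul, abs_mul, abs_of_pos (by positivity)]
  calc 1 / β ^ 2 * (|φ k (x k) ⬝ᵥ φ k (x' k)| * _)
      ≤ 1 / β ^ 2 * (Φ ^ 2 * ((2 * R + 1) * η * β ^ 2)) :=
        mul_le_mul_of_nonneg_left (mul_le_mul hdot htr2 (abs_nonneg _) (by positivity))
          (by positivity)
    _ = _ := by field_simp

variable {w : Fin m → ℝ} {X : Fin m → Fin n → ℝ} {T : ℝ} {d : ℝ → Fin m → ℝ}
  {A : ℝ → MPSIndex q D → ℝ}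

theorem IsMPSTraining.continuousOn (hA : IsMPSTraining φ w X T d A) :
    ContinuousOn A (Set.Icc 0 T) :=
  continuousOn_pi.2 fun e t ht => (hA t ht e).continuousWithinAt

theorem IsMPSTraining.intervalIntegrable_deriv (hA : IsMPSTraining φ w X T d A)
    (hd : ∀ j, IntervalIntegrable (fun t => d t j) volume 0 T) {t : ℝ} (ht : t ∈ Set.Icc 0 T)
    (e : MPSIndex q D) :
    IntervalIntegrable (fun s => mpsRate D e.1 * dataPairing w X (d s)
      (fun x => mpsPartial φ e x (A s))) volume 0 t := by
  refine IntervalIntegrable.const_mul ?_ _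
  have h : ∀ j ∈ Finset.univ, IntervalIntegrable
      (fun s => w j * (d s j * mpsPartial φ e (X j) (A s))) volume 0 t := by
    intro j _
    refine IntervalIntegrable.const_mul (IntervalIntegrable.mul_continuousOn
      ((hd j).mono_set ?_) ?_) _
    · rw [Set.uIcc_of_le ht.1, Set.uIcc_of_le (ht.1.trans ht.2)]
      exact Set.Icc_subset_Icc_right ht.2
    · rw [Set.uIcc_of_le ht.1]
      exact (continuous_mpsPartial φ (X j) e).comp_continuousOn
        (hA.continuousOn.mono (Set.Icc_subset_Icc_right ht.2))
  exact intervalIntegrable_fun_sum _ h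

/-- The tensors move by at most `∫ ‖d‖` on the scale of the bond dimensions, as long as their
displacements stay bounded on this scale. -/
theorem IsTypicalInit.tensorNorm_step {S : Set (Fin n → ℝ)} {ε R V Φ C₀ : ℝ}
    (hA₀ : IsTypicalInit φ N S ε R (A 0)) (hN : ∀ k, D k ≤ N) (hD : ∀ k, 0 < D k)
    (hε : 0 ≤ ε) (hε1 : ε ≤ 1) (hV : 0 ≤ V) (hΦ : 0 ≤ Φ) (hR : 0 ≤ R)
    (hφ : ∀ x ∈ S, ∀ k, √(∑ s, φ k (x k) s ^ 2) ≤ Φ)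
    (hsmall : ε ^ 2 * (1 + Φ * V) ^ (n - 1) ≤ 1)
    (hw : ∀ j, 0 ≤ w j) (hX : ∀ j, X j ∈ S) (hA : IsMPSTraining φ w X T d A)
    (hd : ∀ j, IntervalIntegrable (fun t => d t j) volume 0 T)
    (hC₀ : ∫ t in (0 : ℝ)..T, dataNorm w (d t) ≤ C₀) {t : ℝ} (ht : t ∈ Set.Icc 0 T)
    (hs : ∀ s ∈ Set.Ioo 0 t, ∀ k,
      tensorNorm (A s - A 0) k ≤ V / (bondScale D k * bondScale D (k + 1))) (k : Fin n) :
    tensorNorm (A t - A 0) k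
      ≤ Φ * (R + 1) * √(∑ j, w j) * C₀ / (bondScale D k * bondScale D (k + 1)) := by
  have hb := bondScale_pos hD
  set β := bondScale D k * bondScale D (k + 1) with hβ
  have hβ0 : 0 < β := mul_pos (hb k) (hb (k + 1))
  have hdn := intervalIntegrable_dataNorm hw hd
  have hsub : Set.uIcc 0 t ⊆ Set.uIcc 0 T := by
    rw [Set.uIcc_of_le ht.1, Set.uIcc_of_le (ht.1.trans ht.2)]
    exact Set.Icc_subset_Icc_right ht.2
  have h := sqrt_sum_sq_sub_le_integral (a := fun s y => A s ⟨k, y⟩)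
    (a' := fun s y => mpsRate D k * dataPairing w X (d s)
      (fun x => mpsPartial φ ⟨k, y⟩ x (A s)))
    (ν := fun s => (Φ * (R + 1) * √(∑ j, w j) / β) * dataNorm w (d s)) ht.1
    (fun y => (continuous_apply (⟨k, y⟩ : MPSIndex q D)).comp_continuousOn
      (hA.continuousOn.mono (Set.Icc_subset_Icc_right ht.2)))
    (fun s hs y => (hA s ⟨hs.1.le, hs.2.le.trans ht.2⟩ ⟨k, y⟩).hasDerivAt
      (Icc_mem_nhds hs.1 (hs.2.trans_le ht.2)))
    (fun y => hA.intervalIntegrable_deriv hd ht ⟨k, y⟩)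
    ((hdn.mono_set hsub).const_mul _) ?_
  · refine h.trans ?_
    rw [intervalIntegral.integral_const_mul]
    have h2 : ∫ s in (0 : ℝ)..t, dataNorm w (d s) ≤ ∫ s in (0 : ℝ)..T, dataNorm w (d s) :=
      intervalIntegral.integral_mono_interval le_rfl ht.1 ht.2
        (Eventually.of_forall fun s => dataNorm_nonneg _ _) hdn
    calc Φ * (R + 1) * √(∑ j, w j) / β * ∫ s in (0 : ℝ)..t, dataNorm w (d s)
        ≤ Φ * (R + 1) * √(∑ j, w j) / β * C₀ :=
          mul_le_mul_of_nonneg_left (h2.trans hC₀) (by positivity)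
      _ = _ := by ring
  · intro s hs'
    have e : ∀ y, mpsRate D k * dataPairing w X (d s) (fun x => mpsPartial φ ⟨k, y⟩ x (A s))
        = ∑ j, (mpsRate D k * (w j * d s j)) * mpsPartial φ ⟨k, y⟩ (X j) (A s) := by
      intro y
      simp only [dataPairing, LinearMap.coe_mk, AddHom.coe_mk, Finset.mul_sum]
      exact Finset.sum_congr rfl fun j _ => by ring
    simp_rw [e]
    refine (sqrt_sum_sq_sum_le _ _ _).trans ?_
    -- The rate `β⁻²` times a gradient of norm at most `Φ (R + 1) β` leaves a velocity of order
    -- `β⁻¹`, the scale on which the displacement is to be bounded.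
    have hrate : mpsRate D k = 1 / β ^ 2 := mpsRate_eq D k
    have hj : ∀ j ∈ Finset.univ, |mpsRate D k * (w j * d s j)|
        * √(∑ y, mpsPartial φ ⟨k, y⟩ (X j) (A s) ^ 2)
        ≤ (Φ * (R + 1) / β) * (w j * |d s j|) := by
      intro j _
      rw [sum_mpsPartial_sq φ hN, abs_mul, abs_mul, abs_of_nonneg (hw j), hrate,
        abs_of_pos (by positivity)]
      have h3 := (hA₀.fro_perturbed hN hD hε hε1 hV hΦ hφ hsmall (hs s hs') (hX j) k).2
      calc 1 / β ^ 2 * (w j * |d s j|) * (√(∑ i, φ k (X j k) i ^ 2)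
            * fro (mpsChain φ N (X j) (A s) (k + 1) (n - 1)))
          ≤ 1 / β ^ 2 * (w j * |d s j|) * (Φ * ((R + 1) * β)) :=
            mul_le_mul_of_nonneg_left (mul_le_mul (hφ _ (hX j) k) h3 (fro_nonneg _) hΦ)
              (mul_nonneg (by positivity) (mul_nonneg (hw j) (abs_nonneg _)))
        _ = _ := by field_simp
    refine (Finset.sum_le_sum hj).trans ?_
    rw [← Finset.mul_sum]
    calc Φ * (R + 1) / β * ∑ j, w j * |d s j|
        ≤ Φ * (R + 1) / β * (√(∑ j, w j) * dataNorm w (d s)) :=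
          mul_le_mul_of_nonneg_left (sum_weight_abs_le hw _) (by positivity)
      _ = _ := by ring

/-- Throughout the training the tensors stay close to their typical initial values. -/
theorem IsTypicalInit.tensorNorm_le {S : Set (Fin n → ℝ)} {ε R V Φ C₀ : ℝ}
    (hA₀ : IsTypicalInit φ N S ε R (A 0)) (hN : ∀ k, D k ≤ N) (hD : ∀ k, 0 < D k)
    (hε : 0 ≤ ε) (hε1 : ε ≤ 1) (hV : 0 ≤ V) (hΦ : 0 ≤ Φ) (hR : 0 ≤ R)
    (hφ : ∀ x ∈ S, ∀ k, √(∑ s, φ k (x k) s ^ 2) ≤ Φ)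
    (hsmall : ε ^ 2 * (1 + Φ * V) ^ (n - 1) ≤ 1)
    (hw : ∀ j, 0 ≤ w j) (hX : ∀ j, X j ∈ S) (hA : IsMPSTraining φ w X T d A)
    (hd : ∀ j, IntervalIntegrable (fun t => d t j) volume 0 T)
    (hC₀ : ∫ t in (0 : ℝ)..T, dataNorm w (d t) ≤ C₀)
    (hVC : Φ * (R + 1) * √(∑ j, w j) * C₀ < V) :
    ∀ t ∈ Set.Icc 0 T, ∀ k,
      tensorNorm (A t - A 0) k ≤ V / (bondScale D k * bondScale D (k + 1)) := by
  have hb := bondScale_pos hD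
  have hβ : ∀ k, 0 < bondScale D k * bondScale D (k + 1) := fun k => mul_pos (hb k) (hb (k + 1))
  have hcont : ∀ k, ContinuousOn (fun t => tensorNorm (A t - A 0) k) (Set.Icc 0 T) := by
    intro k
    have h1 : Continuous fun B : MPSIndex q D → ℝ => tensorNorm (B - A 0) k := by
      unfold tensorNorm
      simp only [Pi.sub_apply]
      fun_prop
    exact h1.comp_continuousOn hA.continuousOn
  -- The times at which some tensor has reached the threshold `V`. This set is compact, so a
  -- violation would yield a first such time; up to then the a priori bound holds, and
  -- `tensorNorm_step` together with the strict inequality `hVC` keeps every tensor below the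
  -- threshold at that time as well.
  set Z : Set ℝ := ⋃ k : Fin n, Set.Icc 0 T ∩ {t | V / (bondScale D k * bondScale D (k + 1))
    ≤ tensorNorm (A t - A 0) k} with hZ
  have hZc : IsCompact Z := by
    refine isCompact_iUnion fun k => ?_
    exact isCompact_Icc.of_isClosed_subset
      ((hcont k).preimage_isClosed_of_isClosed isClosed_Icc isClosed_Ici) Set.inter_subset_left
  by_contra hcon
  push Not at hcon
  obtain ⟨t₁, ht₁, k₁, hk₁⟩ := hcon
  have hne : Z.Nonempty := ⟨t₁, Set.mem_iUnion.2 ⟨k₁, ht₁, hk₁.le⟩⟩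
  obtain ⟨t, htZ, hleast⟩ := hZc.exists_isLeast hne
  obtain ⟨k, ht, hk⟩ := Set.mem_iUnion.1 htZ
  have hstep := hA₀.tensorNorm_step hN hD hε hε1 hV hΦ hR hφ hsmall hw hX hA hd hC₀ ht
    (fun s hs l => by
      by_contra hl
      exact absurd (hleast (Set.mem_iUnion.2 ⟨l, ⟨hs.1.le, hs.2.le.trans ht.2⟩,
        (not_le.1 hl).le⟩)) (not_le.2 hs.2)) k
  have h2 := (div_lt_div_iff_of_pos_right (hβ k)).2 hVC
  exact absurd (hk.trans hstep) (not_le.2 h2)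

/-- At any bond dimension the outputs follow the kernel gradient of the current kernel. -/
theorem IsMPSTraining.hasDerivWithinAt_output (hA : IsMPSTraining φ w X T d A) {t : ℝ}
    (ht : t ∈ Set.Icc 0 T) (x : Fin n → ℝ) :
    HasDerivWithinAt (fun s => mpsOutput φ x (A s))
      (kernelMap (mpsNTK φ (A t)) (dataPairing w X (d t)) x) (Set.Icc 0 T) t := by
  have h1 : HasDerivWithinAt A (fun e => mpsRate D e.1 * dataPairing w X (d t)
      (fun x => mpsPartial φ e x (A t))) (Set.Icc 0 T) t :=
    hasDerivWithinAt_pi.2 fun e => hA t ht e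
  have h2 := (differentiable_mpsOutput φ x (A t)).hasFDerivAt.comp_hasDerivWithinAt t h1
  convert! h2 using 1
  have h3 : ∀ u : MPSIndex q D → ℝ, fderiv ℝ (mpsOutput φ x) (A t) u
      = ∑ e, u e * mpsPartial φ e x (A t) := by
    intro u
    conv_lhs => rw [pi_eq_sum_univ' u]
    rw [map_sum]
    refine Finset.sum_congr rfl fun e _ => ?_
    rw [map_smul, smul_eq_mul, mpsPartial]
  rw [h3]
  simp only [kernelMap, dataPairing, LinearMap.coe_mk, AddHom.coe_mk, mpsNTK, Finset.mul_sum,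
    Finset.sum_mul]
  rw [Finset.sum_comm]
  exact Finset.sum_congr rfl fun e _ => Finset.sum_congr rfl fun j _ => by ring

end Training

/-! ### Defects of the limit equation -/

theorem abs_kernelMap_sub_le {n m : ℕ} {w : Fin m → ℝ} {X : Fin m → Fin n → ℝ} (hw : ∀ j, 0 ≤ w j)
    {K K' : (Fin n → ℝ) → (Fin n → ℝ) → ℝ} {x : Fin n → ℝ} {ζ : ℝ}
    (hK : ∀ j, |K x (X j) - K' x (X j)| ≤ ζ) (hζ : 0 ≤ ζ)
    (δ : Fin m → ℝ) :
    |kernelMap K (dataPairing w X δ) x - kernelMap K' (dataPairing w X δ) x|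
      ≤ ζ * √(∑ j, w j) * dataNorm w δ := by
  have e : kernelMap K (dataPairing w X δ) x - kernelMap K' (dataPairing w X δ) x
      = ∑ j, (w j * δ j) * (K x (X j) - K' x (X j)) := by
    simp only [kernelMap, dataPairing, LinearMap.coe_mk, AddHom.coe_mk,
      ← Finset.sum_sub_distrib]
    exact Finset.sum_congr rfl fun j _ => by ring
  rw [e]
  calc |∑ j, (w j * δ j) * (K x (X j) - K' x (X j))|
      ≤ ∑ j, (w j * |δ j|) * ζ := by
        refine (Finset.abs_sum_le_sum_abs _ _).trans (Finset.sum_le_sum fun j _ => ?_)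
        rw [abs_mul, abs_mul, abs_of_nonneg (hw j)]
        exact mul_le_mul_of_nonneg_left (hK j) (mul_nonneg (hw j) (abs_nonneg _))
    _ = ζ * ∑ j, w j * |δ j| := by rw [← Finset.sum_mul, mul_comm]
    _ ≤ ζ * (√(∑ j, w j) * dataNorm w δ) :=
        mul_le_mul_of_nonneg_left (sum_weight_abs_le hw δ) hζ
    _ = _ := by ring

section Defect

variable {n m : ℕ} [NeZero n] {q D : Fin n → ℕ} {φ : ∀ k : Fin n, ℝ → Fin (q k) → ℝ}
  {w : Fin m → ℝ} {X : Fin m → Fin n → ℝ} {T : ℝ} {d : ℝ → Fin m → ℝ} {A : ℝ → MPSIndex q D → ℝ}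

/-- The derivative is the kernel gradient of the current kernel, so the integrand is at most a
multiple of `ζ ‖d_t‖`. With the lower integral no measurability of the derivative is needed. -/
theorem IsMPSTraining.lintegral_defect_le (hA : IsMPSTraining φ w X T d A) (hT : 0 ≤ T)
    (hw : ∀ j, 0 ≤ w j) (hd : ∀ j, IntervalIntegrable (fun t => d t j) volume 0 T)
    {K : (Fin n → ℝ) → (Fin n → ℝ) → ℝ} {x : Fin n → ℝ} {ζ : ℝ} (hζ : 0 ≤ ζ)
    (hK : ∀ t ∈ Set.Icc 0 T, ∀ j, |mpsNTK φ (A t) x (X j) - K x (X j)| ≤ ζ) :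
    ∫⁻ t in Set.Icc (0 : ℝ) T,
        ‖derivWithin (fun s => mpsOutput φ x (A s)) (Set.Icc (0 : ℝ) T) t
          - kernelMap K (dataPairing w X (d t)) x‖ₑ
      ≤ ENNReal.ofReal (ζ * √(∑ j, w j) * ∫ t in (0 : ℝ)..T, dataNorm w (d t)) := by
  -- For `T = 0` the derivative within a single point is not determined, but the domain of
  -- integration is a null set.
  rcases hT.eq_or_lt with h0 | h0
  · rw [setLIntegral_measure_zero _ _ (by simp [← h0])]
    exact zero_le
  · have hdn := intervalIntegrable_dataNorm hw hd
    have hint : IntegrableOn (fun t => ζ * √(∑ j, w j) * dataNorm w (d t)) (Set.Icc 0 T) := by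
      rw [integrableOn_Icc_iff_integrableOn_Ioc]
      exact ((intervalIntegrable_iff_integrableOn_Ioc_of_le hT).1 hdn).const_mul _
    rw [← intervalIntegral.integral_const_mul, intervalIntegral.integral_of_le hT,
      ← integral_Icc_eq_integral_Ioc, ofReal_integral_eq_lintegral_ofReal hint
      (Eventually.of_forall fun t => mul_nonneg (mul_nonneg hζ (Real.sqrt_nonneg _))
        (dataNorm_nonneg _ _))]
    refine setLIntegral_mono' measurableSet_Icc fun t ht => ?_
    rw [(hA.hasDerivWithinAt_output ht x).derivWithin (uniqueDiffOn_Icc h0 t ht),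
      Real.enorm_eq_ofReal_abs]
    exact ENNReal.ofReal_le_ofReal (abs_kernelMap_sub_le hw (hK t ht) hζ _)

/-- The fundamental theorem of calculus turns the defect into the integral of a difference of two
kernel gradients. -/
theorem IsMPSTraining.abs_output_defect_le (hA : IsMPSTraining φ w X T d A)
    (hw : ∀ j, 0 ≤ w j) (hd : ∀ j, IntervalIntegrable (fun t => d t j) volume 0 T)
    {K : (Fin n → ℝ) → (Fin n → ℝ) → ℝ} {x : Fin n → ℝ} {ζ : ℝ} (hζ : 0 ≤ ζ)
    (hK : ∀ t ∈ Set.Icc 0 T, ∀ j, |mpsNTK φ (A t) x (X j) - K x (X j)| ≤ ζ)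
    {t : ℝ} (ht : t ∈ Set.Icc 0 T) :
    |mpsOutput φ x (A t) - (mpsOutput φ x (A 0)
        + ∫ s in (0 : ℝ)..t, kernelMap K (dataPairing w X (d s)) x)|
      ≤ ζ * √(∑ j, w j) * ∫ t in (0 : ℝ)..T, dataNorm w (d t) := by
  have hdn := intervalIntegrable_dataNorm hw hd
  have hsub : Set.uIcc 0 t ⊆ Set.uIcc 0 T := by
    rw [Set.uIcc_of_le ht.1, Set.uIcc_of_le (ht.1.trans ht.2)]
    exact Set.Icc_subset_Icc_right ht.2
  have hcA : ContinuousOn A (Set.Icc 0 t) := hA.continuousOn.mono (Set.Icc_subset_Icc_right ht.2)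
  have hi1 : IntervalIntegrable
      (fun s => kernelMap (mpsNTK φ (A s)) (dataPairing w X (d s)) x) volume 0 t := by
    refine intervalIntegrable_fun_sum Finset.univ fun j _ => IntervalIntegrable.const_mul
      (((hd j).mono_set hsub).mul_continuousOn ?_) _
    rw [Set.uIcc_of_le ht.1]
    exact (continuous_mpsNTK φ x (X j)).comp_continuousOn hcA
  have hi2 : IntervalIntegrable
      (fun s => kernelMap K (dataPairing w X (d s)) x) volume 0 t :=
    intervalIntegrable_fun_sum Finset.univ fun j _ => IntervalIntegrable.const_mul
      (((hd j).mono_set hsub).mul_const _) _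
  have hftc := intervalIntegral.integral_eq_sub_of_hasDerivAt_of_le ht.1
    (f := fun s => mpsOutput φ x (A s))
    ((differentiable_mpsOutput φ x).continuous.comp_continuousOn hcA)
    (fun s hs => (hA.hasDerivWithinAt_output ⟨hs.1.le, hs.2.le.trans ht.2⟩ x).hasDerivAt
      (Icc_mem_nhds hs.1 (hs.2.trans_le ht.2))) hi1
  rw [← sub_sub, ← hftc, ← intervalIntegral.integral_sub hi1 hi2]
  have h1 := intervalIntegral.norm_integral_le_of_norm_le ht.1
    (f := fun s => kernelMap (mpsNTK φ (A s)) (dataPairing w X (d s)) x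
      - kernelMap K (dataPairing w X (d s)) x)
    (g := fun s => ζ * √(∑ j, w j) * dataNorm w (d s)) (μ := volume)
    (Eventually.of_forall fun s hs => abs_kernelMap_sub_le hw
      (hK s ⟨hs.1.le, hs.2.trans ht.2⟩) hζ _) ((hdn.mono_set hsub).const_mul _)
  refine h1.trans ?_
  rw [intervalIntegral.integral_const_mul]
  exact mul_le_mul_of_nonneg_left (intervalIntegral.integral_mono_interval le_rfl ht.1 ht.2
    (Eventually.of_forall fun s => dataNorm_nonneg _ _) hdn)
    (mul_nonneg hζ (Real.sqrt_nonneg _))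

end Defect

/-! ### Typical initial tensors -/

section Tendsto

theorem tendsto_measure_iUnion_zero {α ι : Type*} [Fintype ι] {l : Filter α} {Ω : α → Type*}
    [∀ a, MeasurableSpace (Ω a)] {μ : ∀ a, Measure (Ω a)} {E : ι → ∀ a, Set (Ω a)}
    (h : ∀ i, Tendsto (fun a => μ a (E i a)) l (𝓝 0)) :
    Tendsto (fun a => μ a (⋃ i, E i a)) l (𝓝 0) := by
  have h1 : Tendsto (fun a => ∑ i, μ a (E i a)) l (𝓝 0) := by
    simpa using tendsto_finsetSum Finset.univ fun i _ => h i
  exact tendsto_of_tendsto_of_tendsto_of_le_of_le tendsto_const_nhds h1 (fun _ => zero_le)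
    fun a => measure_iUnion_fintype_le _ _

theorem measure_le_of_integral_le {Ω : Type*} [MeasurableSpace Ω] {μ : Measure Ω}
    [IsFiniteMeasure μ] {f : Ω → ℝ} (hf : Integrable f μ) (h0 : ∀ ω, 0 ≤ f ω) {c B M : ℝ}
    (hc : 0 < c) (hB : 0 < B) (hM : ∫ ω, f ω ∂μ ≤ M * B) :
    μ {ω | c * B ≤ f ω} ≤ ENNReal.ofReal (M / c) := by
  have h := mul_meas_ge_le_integral_of_nonneg (μ := μ) (Eventually.of_forall h0) hf (c * B)
  rw [← ofReal_measureReal]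
  refine ENNReal.ofReal_le_ofReal ?_
  rw [le_div_iff₀ hc]
  have h2 := h.trans hM
  nlinarith

end Tendsto

/-- The padded size used for the site matrices. -/
def padSize {n : ℕ} (D : Fin n → ℕ) : ℕ := ∑ k, D k

theorem le_padSize {n : ℕ} (D : Fin n → ℕ) (k : Fin n) : D k ≤ padSize D :=
  Finset.single_le_sum (f := D) (fun _ _ => Nat.zero_le _) (Finset.mem_univ k)

section Init

open scoped Matrix.Norms.L2Operator

variable {n : ℕ} [NeZero n] {q : Fin n → ℕ} (φ : ∀ k : Fin n, ℝ → Fin (q k) → ℝ)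
  (σ : Fin n → ℝ)

/-- Chains depend on their starting point only modulo `n`, so finitely many bad events cover all
chains. -/
theorem mpsChain_mod {D : Fin n → ℕ} {N : ℕ} (x : Fin n → ℝ) (A : MPSIndex q D → ℝ) (i p : ℕ) :
    mpsChain φ N x A (ringSite n i : ℕ) p = mpsChain φ N x A i p := by
  have h : ∀ j, ringSite n ((ringSite n i : ℕ) + j) = ringSite n (i + j) := by
    intro j
    ext
    simp [ringSite]
  induction p with
  | zero =>
    rw [mpsChain, mpsChain, ringSite_val]
  | succ p ih => rw [mpsChain, mpsChain, ih, h]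

theorem ringSite_val_add (i j : ℕ) : ringSite n ((ringSite n i : ℕ) + j) = ringSite n (i + j) := by
  ext
  simp [ringSite]

/-- The joint limit: once every bond dimension exceeds `K`, the common bound `θ = 1 / (K + 1)`
applies, whatever the ratios of the dimensions. -/
theorem tendsto_measure_of_bounds {E : ∀ D : Fin n → ℕ, Set (MPSIndex q D → ℝ)} {M : ℝ}
    (h : ∀ (D : Fin n → ℕ) (θ : ℝ), (∀ k, 0 < D k) → (∀ k, 1 / (D k : ℝ) ≤ θ) → θ ≤ 1 →
      mpsInitLaw q D σ (E D) ≤ ENNReal.ofReal (M * θ)) :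
    Tendsto (fun D => mpsInitLaw q D σ (E D)) atTop (𝓝 0) := by
  rw [ENNReal.tendsto_nhds_zero]
  intro δ hδ
  obtain ⟨r, hr0, hrδ⟩ : ∃ r : ℝ, 0 < r ∧ ENNReal.ofReal r ≤ δ := by
    rcases eq_or_ne δ ⊤ with rfl | hne
    · exact ⟨1, one_pos, le_top⟩
    · exact ⟨δ.toReal, ENNReal.toReal_pos hδ.ne' hne, (ENNReal.ofReal_toReal hne).le⟩
  obtain ⟨K, hK⟩ := exists_nat_gt (M / r)
  filter_upwards [eventually_ge_atTop (fun _ : Fin n => K + 1)] with D hD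
  have hKpos : (0 : ℝ) < (K : ℝ) + 1 := by positivity
  have hD' : ∀ k, ((K : ℝ) + 1) ≤ D k := fun k => by exact_mod_cast hD k
  refine (h D (1 / ((K : ℝ) + 1)) (fun k => lt_of_lt_of_le (Nat.succ_pos K) (hD k))
    (fun k => one_div_le_one_div_of_le hKpos (hD' k)) ?_).trans
    ((ENNReal.ofReal_le_ofReal ?_).trans hrδ)
  · rw [div_le_one hKpos]
    linarith [Nat.cast_nonneg (α := ℝ) K]
  · rw [mul_one_div, div_le_iff₀ hKpos]
    rw [div_lt_iff₀ hr0] at hK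
    nlinarith

/-- The initial tensors for which the trace of a Gram matrix is away from its limit. -/
def badTrace (x x' : Fin n → ℝ) (i p : ℕ) (ζ : ℝ) (D : Fin n → ℕ) : Set (MPSIndex q D → ℝ) :=
  {A | ζ ^ 2 * ((D (ringSite n i) : ℝ) * D (ringSite n (i + p)))
    ≤ ((mpsGram φ (padSize D) x x' i p A).trace
      - chainFactor φ σ x x' i p * √((D (ringSite n i) : ℝ) * D (ringSite n (i + p)))) ^ 2}

/-- The initial tensors for which a chain has a large operator norm. -/
def badNorm (x : Fin n → ℝ) (i p : ℕ) (ε : ℝ) (D : Fin n → ℕ) : Set (MPSIndex q D → ℝ) :=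
  {A | (ε ^ 2) ^ 2 * ((D (ringSite n i) : ℝ) * D (ringSite n (i + p)))
    ≤ ∑ a, ∑ b, mpsGram φ (padSize D) x x i p A a b ^ 2}

theorem tendsto_badTrace (x x' : Fin n → ℝ) (i p : ℕ) (hp : p ≤ n) {ζ : ℝ} (hζ : 0 < ζ) :
    Tendsto (fun D => mpsInitLaw q D σ (badTrace φ σ x x' i p ζ D)) atTop (𝓝 0) := by
  obtain ⟨C, hC, h⟩ := exists_mpsGram_bounds φ σ x x' i p hp
  refine tendsto_measure_of_bounds σ (M := C / ζ ^ 2) fun D θ hD hθ hθ1 => ?_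
  have hb := (h D (padSize D) θ (le_padSize D) hD hθ hθ1).1
  have hpos : 0 < (D (ringSite n i) : ℝ) * D (ringSite n (i + p)) := by
    have h1 := hD (ringSite n i)
    have h2 := hD (ringSite n (i + p))
    positivity
  rw [mpsInitLaw_eq] at hb ⊢
  have hm : HasAllMoments (fun A => (mpsGram φ (padSize D) x x' i p A).trace
      - chainFactor φ σ x x' i p * √((D (ringSite n i) : ℝ) * D (ringSite n (i + p))))
      (gaussianPi (initVar q D σ)) := by
    simp_rw [sub_eq_add_neg]
    exact (HasAllMoments.sum _ fun a _ => hasAllMoments_mpsGram φ _ x x' i p a a).add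
      (HasAllMoments.const _)
  have := measure_le_of_integral_le (by simpa only [sq] using (hm.mul hm).integrable)
    (fun A => sq_nonneg _) (by positivity : 0 < ζ ^ 2) hpos hb
  rwa [mul_div_right_comm] at this

theorem tendsto_badNorm (x : Fin n → ℝ) (i p : ℕ) (hp : p ≤ n) {ε : ℝ} (hε : 0 < ε) :
    Tendsto (fun D => mpsInitLaw q D σ (badNorm φ x i p ε D)) atTop (𝓝 0) := by
  obtain ⟨C, hC, h⟩ := exists_mpsGram_bounds φ σ x x i p hp
  refine tendsto_measure_of_bounds σ (M := C / (ε ^ 2) ^ 2)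
    fun D θ hD hθ hθ1 => ?_
  have hb := (h D (padSize D) θ (le_padSize D) hD hθ hθ1).2
  have hpos : 0 < (D (ringSite n i) : ℝ) * D (ringSite n (i + p)) := by
    have h1 := hD (ringSite n i)
    have h2 := hD (ringSite n (i + p))
    positivity
  rw [mpsInitLaw_eq] at hb ⊢
  have hm : HasAllMoments (fun A => ∑ a, ∑ b, mpsGram φ (padSize D) x x i p A a b ^ 2)
      (gaussianPi (initVar q D σ)) := by
    simp_rw [sq]
    exact HasAllMoments.sum _ fun a _ => HasAllMoments.sum _ fun b _ =>
      (hasAllMoments_mpsGram φ _ x x i p a b).mul (hasAllMoments_mpsGram φ _ x x i p a b)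
  have := measure_le_of_integral_le hm.integrable
    (fun A => Finset.sum_nonneg fun a _ => Finset.sum_nonneg fun b _ => sq_nonneg _)
    (by positivity : 0 < (ε ^ 2) ^ 2) hpos hb
  rwa [mul_div_right_comm] at this

theorem norm_le_of_notMem_badNorm {x : Fin n → ℝ} {i p : ℕ} {ε : ℝ} (hε : 0 ≤ ε)
    {D : Fin n → ℕ} {A : MPSIndex q D → ℝ} (h : A ∉ badNorm φ x i p ε D) :
    ‖mpsChain φ (padSize D) x A i p‖
      ≤ ε * (bondScale D (ringSite n i) * bondScale D (ringSite n (i + p))) := by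
  set β := bondScale D (ringSite n i) * bondScale D (ringSite n (i + p)) with hβ
  have hβ0 : 0 ≤ β := mul_nonneg (Real.rpow_nonneg (by positivity) _)
    (Real.rpow_nonneg (by positivity) _)
  -- The scale `β` is a fourth root because the chain enters the bad event through the square of the
  -- Frobenius norm of its Gram matrix.
  have h4 : (β ^ 2) ^ 2 = (D (ringSite n i) : ℝ) * D (ringSite n (i + p)) := by
    rw [hβ, bondScale_mul_sq, Real.sq_sqrt (by positivity)]
  have h1 : fro (mpsGram φ (padSize D) x x i p A) ^ 2 < (ε ^ 2 * β ^ 2) ^ 2 := by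
    rw [fro_sq, mul_pow, h4]
    exact not_le.1 h
  have h2 := (pow_lt_pow_iff_left₀ (fro_nonneg _) (by positivity) two_ne_zero).1 h1
  have h3 := (norm_sq_le_fro_gram (mpsChain φ (padSize D) x A i p)).trans h2.le
  rw [← mul_pow] at h3
  exact (pow_le_pow_iff_left₀ (norm_nonneg _) (by positivity) two_ne_zero).1 h3

theorem abs_trace_sub_lt_of_notMem_badTrace {x x' : Fin n → ℝ} {i p : ℕ} {ζ : ℝ} (hζ : 0 ≤ ζ)
    {D : Fin n → ℕ} {A : MPSIndex q D → ℝ} (h : A ∉ badTrace φ σ x x' i p ζ D) :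
    |(mpsGram φ (padSize D) x x' i p A).trace
      - chainFactor φ σ x x' i p * √((D (ringSite n i) : ℝ) * D (ringSite n (i + p)))|
      < ζ * √((D (ringSite n i) : ℝ) * D (ringSite n (i + p))) := by
  have h1 : ((mpsGram φ (padSize D) x x' i p A).trace
      - chainFactor φ σ x x' i p * √((D (ringSite n i) : ℝ) * D (ringSite n (i + p)))) ^ 2
      < ζ ^ 2 * ((D (ringSite n i) : ℝ) * D (ringSite n (i + p))) := not_le.1 h
  refine abs_lt_of_sq_lt_sq ?_ (by positivity)
  rwa [mul_pow, Real.sq_sqrt (by positivity)]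

theorem ringSite_window_end (k : Fin n) : ringSite n ((k : ℕ) + 1 + (n - 1)) = k := by
  rw [show (k : ℕ) + 1 + (n - 1) = k + n by have := NeZero.pos n; omega, ringSite_add_self,
    ringSite_val]

/-- The `n - 1` sites after site `k` are distinct and differ from `k`, so by counting they are all
the other sites. -/
theorem chainFactor_eq_prod_erase (x x' : Fin n → ℝ) (k : Fin n) :
    chainFactor φ σ x x' ((k : ℕ) + 1) (n - 1)
      = ∏ l ∈ Finset.univ.erase k, siteFactor φ σ x x' l := by
  have hinj : Set.InjOn (fun j => ringSite n ((k : ℕ) + 1 + j)) (Finset.range (n - 1)) := by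
    intro j hj j' hj' h
    have h1 := Finset.mem_range.1 (Finset.mem_coe.1 hj)
    have h2 := Finset.mem_range.1 (Finset.mem_coe.1 hj')
    rcases lt_trichotomy j j' with h3 | h3 | h3
    · exact absurd h (ringSite_ne (by omega) (by omega))
    · exact h3
    · exact absurd h.symm (ringSite_ne (by omega) (by omega))
  rw [chainFactor, ← Finset.prod_image (f := siteFactor φ σ x x') hinj]
  congr 1
  refine Finset.eq_of_subset_of_card_le ?_ ?_
  · intro l hl
    obtain ⟨j, hj, rfl⟩ := Finset.mem_image.1 hl
    have hj := Finset.mem_range.1 hj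
    refine Finset.mem_erase.2 ⟨fun h => ?_, Finset.mem_univ _⟩
    refine ringSite_ne (n := n) (l := k) (l' := (k : ℕ) + 1 + j) (by omega) (by omega) ?_
    rw [ringSite_val, h]
  · rw [Finset.card_image_of_injOn hinj, Finset.card_range,
      Finset.card_erase_of_mem (Finset.mem_univ _), Finset.card_univ, Fintype.card_fin]

theorem mpsLimitKernel_eq (x x' : Fin n → ℝ) :
    mpsLimitKernel φ σ x x' = ∑ k : Fin n, (φ k (x k) ⬝ᵥ φ k (x' k))
      * chainFactor φ σ x x' ((k : ℕ) + 1) (n - 1) := by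
  rw [mpsLimitKernel]
  refine Finset.sum_congr rfl fun k _ => ?_
  rw [chainFactor_eq_prod_erase]
  rfl

/-- The rate is the inverse of `√(D_k D_{k+1})`, the normalization in which the Gram trace
concentrates; the relative errors `ζ` add up over the sites. -/
theorem abs_ntk_sub_limit_le {x x' : Fin n → ℝ} {ζ : ℝ} (hζ : 0 ≤ ζ) {D : Fin n → ℕ}
    (hD : ∀ k, 0 < D k) {A : MPSIndex q D → ℝ}
    (h : ∀ k : Fin n, A ∉ badTrace φ σ x x' ((k : ℕ) + 1) (n - 1) ζ D) :
    |mpsNTK φ A x x' - mpsLimitKernel φ σ x x'|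
      ≤ ζ * ∑ k : Fin n, |φ k (x k) ⬝ᵥ φ k (x' k)| := by
  rw [mpsNTK_eq φ (le_padSize D), mpsLimitKernel_eq, ← Finset.sum_sub_distrib, Finset.mul_sum]
  refine (Finset.abs_sum_le_sum_abs _ _).trans (Finset.sum_le_sum fun k _ => ?_)
  have h1 := abs_trace_sub_lt_of_notMem_badTrace φ σ hζ (h k)
  rw [ringSite_window_end, ringSite_succ, ringSite_val, mul_comm (D (k + 1) : ℝ)] at h1
  set s := √((D k : ℝ) * D (k + 1)) with hs
  have hs0 : 0 < s := Real.sqrt_pos.2 (by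
    have h1 := hD k
    have h2 := hD (k + 1)
    positivity)
  have hr : mpsRate D k = 1 / s := by rw [mpsRate_eq, bondScale_mul_sq]
  set t := (mpsGram φ (padSize D) x x' ((k : ℕ) + 1) (n - 1) A).trace
  set L := chainFactor φ σ x x' ((k : ℕ) + 1) (n - 1)
  set c := φ k (x k) ⬝ᵥ φ k (x' k)
  have e : mpsRate D k * (c * t) - c * L = c * ((t - L * s) / s) := by
    rw [hr]; field_simp
  rw [e, abs_mul, abs_div, abs_of_pos hs0, mul_comm]
  exact mul_le_mul_of_nonneg_right ((div_le_iff₀ hs0).2 h1.le) (abs_nonneg _)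

/-- With high probability the initial tensors are typical and their kernel is close to the limit
kernel, for finitely many inputs. -/
theorem exists_tendsto_not_isTypicalInit (S : Finset (Fin n → ℝ)) :
    ∃ R : ℝ, 0 ≤ R ∧ ∀ ε > 0, ∀ ζ > 0,
      Tendsto (fun D : Fin n → ℕ => mpsInitLaw q D σ
        {A | ¬ (IsTypicalInit φ (padSize D) (S : Set (Fin n → ℝ)) ε R A ∧
          ∀ x ∈ S, ∀ x' ∈ S, |mpsNTK φ A x x' - mpsLimitKernel φ σ x x'| ≤ ζ)})
        atTop (𝓝 0) := by
  -- `R` dominates every expected normalised squared Frobenius norm with room for a deviation of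
  -- `1`; it does not depend on `ε`, `ζ` or the bond dimensions.
  set R : ℝ := 1 + ∑ x ∈ S, ∑ k : Fin n, |chainFactor φ σ x x ((k : ℕ) + 1) (n - 1)| with hR
  have hR1 : 1 ≤ R := by
    have : 0 ≤ ∑ x ∈ S, ∑ k : Fin n, |chainFactor φ σ x x ((k : ℕ) + 1) (n - 1)| := by positivity
    linarith
  refine ⟨R, by linarith, fun ε hε ζ hζ => ?_⟩
  set Q : ℝ := 1 + ∑ x ∈ S, ∑ x' ∈ S, ∑ k : Fin n, |φ k (x k) ⬝ᵥ φ k (x' k)| with hQ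
  have hQ0 : 0 < Q := by positivity
  set ζ' := min 1 (ζ / Q) with hζ'
  have hζ'0 : 0 < ζ' := lt_min one_pos (by positivity)
  -- The finitely many bad events: large operator norm for each input, starting site and length
  -- below `n`, and a deviating trace for each pair of inputs and each omitted site.
  have hU := tendsto_measure_iUnion_zero (l := atTop) (μ := fun D => mpsInitLaw q D σ)
    (E := fun (z : (S × Fin n × Fin n) ⊕ (S × S × Fin n)) D => match z with
      | Sum.inl (x, i, p) => badNorm φ x.1 i p ε D
      | Sum.inr (x, x', k) => badTrace φ σ x.1 x'.1 ((k : ℕ) + 1) (n - 1) ζ' D) (by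
    rintro (⟨x, i, p⟩ | ⟨x, x', k⟩)
    · exact tendsto_badNorm φ σ x.1 i p p.2.le hε
    · exact tendsto_badTrace φ σ x.1 x'.1 _ _ (Nat.sub_le _ _) hζ'0)
  refine tendsto_of_tendsto_of_tendsto_of_le_of_le' tendsto_const_nhds hU
    (Eventually.of_forall fun _ => zero_le) ?_
  filter_upwards [eventually_ge_atTop (fun _ : Fin n => 1)] with D hD
  refine measure_mono fun A hA => ?_
  by_contra hcon
  simp only [Set.mem_iUnion, not_exists, Sum.forall, Prod.forall, Subtype.forall] at hcon
  obtain ⟨hn, ht⟩ := hcon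
  refine hA ⟨⟨fun x hx i p hp => ?_, fun x hx k => ?_⟩, fun x hx x' hx' => ?_⟩
  · have h1 := norm_le_of_notMem_badNorm φ hε.le (hn x hx (ringSite n i) ⟨p, hp⟩)
    simp only at h1
    rwa [mpsChain_mod, ringSite_val_add, ringSite_val] at h1
  · have h1 := abs_trace_sub_lt_of_notMem_badTrace φ σ hζ'0.le (ht x hx x hx k)
    rw [ringSite_window_end, ringSite_succ, ringSite_val, mul_comm (D (k + 1) : ℝ)] at h1
    have h2 : fro (mpsChain φ (padSize D) x A ((k : ℕ) + 1) (n - 1)) ^ 2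
        = (mpsGram φ (padSize D) x x ((k : ℕ) + 1) (n - 1) A).trace := by
      rw [fro_sq, Finset.sum_comm]
      simp [mpsGram, Matrix.trace, Matrix.mul_apply, sq]
    have hβ0 : 0 ≤ bondScale D k * bondScale D (k + 1) :=
      mul_nonneg (Real.rpow_nonneg (by positivity) _) (Real.rpow_nonneg (by positivity) _)
    rw [← h2, ← bondScale_mul_sq] at h1
    set β := bondScale D k * bondScale D (k + 1)
    have h3 := (abs_lt.1 h1).2
    have h4 : chainFactor φ σ x x ((k : ℕ) + 1) (n - 1) + 1 ≤ R := by
      have h5 : |chainFactor φ σ x x ((k : ℕ) + 1) (n - 1)|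
          ≤ ∑ k : Fin n, |chainFactor φ σ x x ((k : ℕ) + 1) (n - 1)| :=
        Finset.single_le_sum (f := fun k : Fin n => |chainFactor φ σ x x ((k : ℕ) + 1) (n - 1)|)
          (fun _ _ => abs_nonneg _) (Finset.mem_univ k)
      have h6 := Finset.single_le_sum
        (f := fun x => ∑ k : Fin n, |chainFactor φ σ x x ((k : ℕ) + 1) (n - 1)|)
        (fun _ _ => Finset.sum_nonneg fun _ _ => abs_nonneg _) hx
      have h7 := le_abs_self (chainFactor φ σ x x ((k : ℕ) + 1) (n - 1))
      linarith
    refine (pow_le_pow_iff_left₀ (fro_nonneg _) (by positivity) two_ne_zero).1 ?_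
    have h8 : ζ' ≤ 1 := min_le_left _ _
    -- The concentration bounds the squared Frobenius norm by `R β²`; as `R ≥ 1`, this is at most
    -- `(R β)²`.
    have h9 : chainFactor φ σ x x ((k : ℕ) + 1) (n - 1) + ζ' ≤ R ^ 2 := by nlinarith
    have h10 := mul_le_mul_of_nonneg_right h9 (sq_nonneg β)
    rw [mul_pow]
    linarith
  · refine (abs_ntk_sub_limit_le φ σ hζ'0.le (fun k => hD k) (ht x hx x' hx')).trans ?_
    have h5 : ∑ k : Fin n, |φ k (x k) ⬝ᵥ φ k (x' k)| ≤ Q := by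
      have h6 := Finset.single_le_sum
        (f := fun x' => ∑ k : Fin n, |φ k (x k) ⬝ᵥ φ k (x' k)|)
        (fun _ _ => Finset.sum_nonneg fun _ _ => abs_nonneg _) hx'
      have h7 := Finset.single_le_sum
        (f := fun x => ∑ x' ∈ S, ∑ k : Fin n, |φ k (x k) ⬝ᵥ φ k (x' k)|)
        (fun _ _ => Finset.sum_nonneg fun _ _ => Finset.sum_nonneg fun _ _ => abs_nonneg _) hx
      linarith
    calc ζ' * ∑ k : Fin n, |φ k (x k) ⬝ᵥ φ k (x' k)| ≤ (ζ / Q) * Q :=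
          mul_le_mul (min_le_right _ _) h5 (Finset.sum_nonneg fun _ _ => abs_nonneg _)
            (by positivity)
      _ = ζ := by field_simp

end Init

/-! ### The limit theorem -/

/-- The training on `[0, T]` has cost at most `C` and keeps the kernel within `ζ` of the limit
kernel for the inputs in `S`. -/
structure IsLazyTraining {n m : ℕ} [NeZero n] {q D : Fin n → ℕ}
    (φ : ∀ k : Fin n, ℝ → Fin (q k) → ℝ) (σ : Fin n → ℝ) (w : Fin m → ℝ)
    (X : Fin m → Fin n → ℝ) (T : ℝ) (S : Finset (Fin n → ℝ)) (C ζ : ℝ)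
    (d : ℝ → Fin m → ℝ) (A : ℝ → MPSIndex q D → ℝ) : Prop where
  training : IsMPSTraining φ w X T d A
  integrable : ∀ j, IntervalIntegrable (fun t => d t j) volume 0 T
  cost : ∫ t in (0 : ℝ)..T, dataNorm w (d t) ≤ C
  ntk : ∀ t ∈ Set.Icc (0 : ℝ) T, ∀ x ∈ S, ∀ x' ∈ S,
    |mpsNTK φ (A t) x x' - mpsLimitKernel φ σ x x'| ≤ ζ

theorem exists_pos_sq_mul_le {Q r : ℝ} (hQ : 1 ≤ Q) (hr : 0 < r) (hr1 : r ≤ 1) :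
    ∃ ε : ℝ, 0 < ε ∧ ε ≤ 1 ∧ ε ^ 2 * Q ≤ r := by
  have hQ0 : 0 < Q := by linarith
  have h1 : r / Q ≤ 1 := (div_le_one hQ0).2 (by linarith)
  have h0 : 0 < r / Q := div_pos hr hQ0
  refine ⟨r / Q, h0, h1, ?_⟩
  calc (r / Q) ^ 2 * Q = (r / Q) * r := by field_simp
    _ ≤ r := mul_le_of_le_one_left hr.le h1

/-- With high probability at large bond dimensions the training is lazy. -/
theorem eventually_measure_not_isLazyTraining_le {n m : ℕ} [NeZero n] (q : Fin n → ℕ)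
    (φ : ∀ k : Fin n, ℝ → Fin (q k) → ℝ) (σ : Fin n → ℝ)
    (X : Fin m → Fin n → ℝ) (w : Fin m → ℝ) (hw : ∀ j, 0 ≤ w j) (T : ℝ)
    {Ω : (Fin n → ℕ) → Type*} [∀ D, MeasurableSpace (Ω D)]
    (P : ∀ D, Measure (Ω D))
    (A : ∀ D : Fin n → ℕ, Ω D → ℝ → MPSIndex q D → ℝ)
    (d : ∀ D : Fin n → ℕ, Ω D → ℝ → Fin m → ℝ)
    (hinit : ∀ D, HasLaw (fun ω => A D ω 0) (mpsInitLaw q D σ) (P D))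
    (htrain : ∀ D, ∀ᵐ ω ∂(P D), IsMPSTraining φ w X T (d D ω) (A D ω))
    (hint : ∀ D, ∀ᵐ ω ∂(P D), ∀ j, IntervalIntegrable (fun t => d D ω t j) volume 0 T)
    (hbdd : ∀ δ : ℝ, 0 < δ → ∃ C : ℝ, ∀ᶠ D in (atTop : Filter (Fin n → ℕ)),
      P D {ω | C < ∫ t in (0 : ℝ)..T, dataNorm w (d D ω t)} ≤ ENNReal.ofReal δ)
    (S : Finset (Fin n → ℝ)) (hX : ∀ j, X j ∈ S) (δ : ℝ) (hδ : 0 < δ) :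
    ∃ C : ℝ, 0 ≤ C ∧ ∀ ζ > 0, ∀ᶠ D in (atTop : Filter (Fin n → ℕ)),
      P D {ω | ¬ IsLazyTraining φ σ w X T S C ζ (d D ω) (A D ω)} ≤ ENNReal.ofReal δ := by
  obtain ⟨C', hC'⟩ := hbdd (δ / 2) (by positivity)
  set C := max C' 0 with hC
  obtain ⟨R, hR, hinitial⟩ := exists_tendsto_not_isTypicalInit φ σ S
  refine ⟨C, le_max_right _ _, fun ζ hζ => ?_⟩
  set Φ : ℝ := ∑ x ∈ S, ∑ k : Fin n, √(∑ s, φ k (x k) s ^ 2) with hΦ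
  have hΦ0 : 0 ≤ Φ := Finset.sum_nonneg fun _ _ => Finset.sum_nonneg fun _ _ => Real.sqrt_nonneg _
  have hφ : ∀ x ∈ (S : Set (Fin n → ℝ)), ∀ k, √(∑ s, φ k (x k) s ^ 2) ≤ Φ := by
    intro x hx k
    refine (Finset.single_le_sum (f := fun k : Fin n => √(∑ s, φ k (x k) s ^ 2))
      (fun _ _ => Real.sqrt_nonneg _) (Finset.mem_univ k)).trans ?_
    exact Finset.single_le_sum (f := fun x => ∑ k : Fin n, √(∑ s, φ k (x k) s ^ 2))
      (fun _ _ => Finset.sum_nonneg fun _ _ => Real.sqrt_nonneg _) hx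
  have hC0 : 0 ≤ C := le_max_right _ _
  -- The threshold exceeds the displacement that the cost allows by `1`, to provide the strict
  -- inequality in the first-exit argument.
  set V : ℝ := Φ * (R + 1) * √(∑ j, w j) * C + 1 with hV
  have hV0 : 0 ≤ V := by positivity
  set K : ℝ := (1 + Φ * V) ^ (n - 1) with hK
  have hK1 : 1 ≤ K := one_le_pow₀ (by nlinarith [mul_nonneg hΦ0 hV0])
  -- Both smallness conditions, for the chains and for the kernel, follow from the single
  -- requirement `ε² Q ≤ min 1 (ζ / 2)`.
  set Q : ℝ := K + n * (Φ ^ 2 * ((2 * R + 1) * K)) with hQ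
  have hQ2 : 0 ≤ n * (Φ ^ 2 * ((2 * R + 1) * K)) := by positivity
  obtain ⟨ε, hε0, hε1, hεQ⟩ := exists_pos_sq_mul_le (Q := Q) (r := min 1 (ζ / 2)) (by linarith)
    (lt_min one_pos (by positivity)) (min_le_left _ _)
  have hsmall : ε ^ 2 * K ≤ 1 := by
    have h1 := hεQ.trans (min_le_left _ _)
    have h2 : 0 ≤ ε ^ 2 * (n * (Φ ^ 2 * ((2 * R + 1) * K))) := by positivity
    rw [hQ, mul_add] at h1
    linarith
  have hntk : n * (Φ ^ 2 * ((2 * R + 1) * (ε ^ 2 * K))) ≤ ζ / 2 := by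
    have h1 := hεQ.trans (min_le_right _ _)
    have h2 : 0 ≤ ε ^ 2 * K := by positivity
    rw [hQ, mul_add] at h1
    linarith
  have hδ2 : (0 : ENNReal) < ENNReal.ofReal (δ / 2) := ENNReal.ofReal_pos.2 (by positivity)
  have hev := (ENNReal.tendsto_nhds_zero.1 (hinitial ε hε0 (ζ / 2) (by positivity))) _ hδ2
  filter_upwards [hev, hC', eventually_ge_atTop (fun _ : Fin n => 1)] with D hD1 hD2 hD
  set bad : Set (MPSIndex q D → ℝ) :=
    {A | ¬ (IsTypicalInit φ (padSize D) (S : Set (Fin n → ℝ)) ε R A ∧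
      ∀ x ∈ S, ∀ x' ∈ S, |mpsNTK φ A x x' - mpsLimitKernel φ σ x x'| ≤ ζ / 2)} with hbad
  -- Outside the four exceptional sets (atypical start, excessive cost, failure of the flow or of
  -- integrability) the argument is deterministic.
  have hsub : {ω | ¬ IsLazyTraining φ σ w X T S C ζ (d D ω) (A D ω)}
      ⊆ (((fun ω => A D ω 0) ⁻¹' bad) ∪ {ω | C' < ∫ t in (0 : ℝ)..T, dataNorm w (d D ω t)})
        ∪ ({ω | ¬ IsMPSTraining φ w X T (d D ω) (A D ω)}
          ∪ {ω | ¬ ∀ j, IntervalIntegrable (fun t => d D ω t j) volume 0 T}) := by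
    intro ω hω
    by_contra hcon
    simp only [Set.mem_union, Set.mem_preimage, Set.mem_ofPred_eq, not_or, not_not, not_lt,
      hbad] at hcon
    obtain ⟨⟨⟨htyp, hk0⟩, hcost⟩, htr, hin⟩ := hcon
    have hcost' : ∫ t in (0 : ℝ)..T, dataNorm w (d D ω t) ≤ C := hcost.trans (le_max_left _ _)
    refine hω ⟨htr, hin, hcost', fun t ht x hx x' hx' => ?_⟩
    have hclose := htyp.tensorNorm_le (le_padSize D) (fun k => hD k) hε0.le hε1 hV0 hΦ0 hR hφ
      hsmall hw hX htr hin hcost' (lt_add_one _) t ht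
    have h1 := htyp.ntk_perturbed (le_padSize D) (fun k => hD k) hε0.le hε1 hV0 hΦ0 hφ
      hsmall hclose hx hx'
    have h2 := hk0 x hx x' hx'
    have h3 := abs_sub_le (mpsNTK φ (A D ω t) x x') (mpsNTK φ (A D ω 0) x x')
      (mpsLimitKernel φ σ x x')
    linarith
  have h0 : P D ((fun ω => A D ω 0) ⁻¹' bad) ≤ ENNReal.ofReal (δ / 2) := by
    -- The inequality between a preimage and the image measure holds for arbitrary sets, so the bad
    -- set need not be shown measurable.
    refine (Measure.le_map_apply (hinit D).aemeasurable bad).trans ?_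
    rw [(hinit D).map_eq]
    exact hD1
  have h3 : P D {ω | ¬ IsMPSTraining φ w X T (d D ω) (A D ω)} = 0 := htrain D
  have h4 : P D {ω | ¬ ∀ j, IntervalIntegrable (fun t => d D ω t j) volume 0 T} = 0 := hint D
  calc _ ≤ (P D ((fun ω => A D ω 0) ⁻¹' bad)
        + P D {ω | C' < ∫ t in (0 : ℝ)..T, dataNorm w (d D ω t)})
        + (P D {ω | ¬ IsMPSTraining φ w X T (d D ω) (A D ω)}
          + P D {ω | ¬ ∀ j, IntervalIntegrable (fun t => d D ω t j) volume 0 T}) :=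
        (measure_mono hsub).trans ((measure_union_le _ _).trans
          (add_le_add (measure_union_le _ _) (measure_union_le _ _)))
    _ ≤ (ENNReal.ofReal (δ / 2) + ENNReal.ofReal (δ / 2)) + (0 + 0) := by
        rw [h3, h4]
        gcongr
    _ = ENNReal.ofReal δ := by
        rw [← ENNReal.ofReal_add (by positivity) (by positivity), add_zero, add_zero, add_halves]

theorem tendsto_measure_zero_of_forall_ofReal {α : Type*} {l : Filter α} {f : α → ENNReal}
    (h : ∀ δ : ℝ, 0 < δ → ∀ᶠ a in l, f a ≤ ENNReal.ofReal δ) : Tendsto f l (𝓝 0) := by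
  rw [ENNReal.tendsto_nhds_zero]
  intro δ hδ
  rcases eq_or_ne δ ⊤ with rfl | hne
  · exact Eventually.of_forall fun _ => le_top
  · simpa [ENNReal.ofReal_toReal hne] using h δ.toReal (ENNReal.toReal_pos hδ.ne' hne)

end

theorem mainTheorem2 {n m : ℕ} [NeZero n] (q : Fin n → ℕ)
    (φ : ∀ k : Fin n, ℝ → Fin (q k) → ℝ) (σ : Fin n → ℝ)
    (X : Fin m → Fin n → ℝ) (w : Fin m → ℝ) (hw : ∀ j, 0 ≤ w j)
    (T : ℝ) (hT : 0 ≤ T)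
    {Ω : (Fin n → ℕ) → Type*} [∀ D, MeasurableSpace (Ω D)]
    (P : ∀ D, Measure (Ω D)) [∀ D, IsProbabilityMeasure (P D)]
    (A : ∀ D : Fin n → ℕ, Ω D → ℝ → MPSIndex q D → ℝ)
    (d : ∀ D : Fin n → ℕ, Ω D → ℝ → Fin m → ℝ)
    -- Gaussian initialization
    (hinit : ∀ D, HasLaw (fun ω => A D ω 0) (mpsInitLaw q D σ) (P D))
    -- gradient-flow training
    (htrain : ∀ D, ∀ᵐ ω ∂(P D), IsMPSTraining φ w X T (d D ω) (A D ω))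
    -- the time integral of the norm of the training direction is bounded in probability
    (hint : ∀ D, ∀ᵐ ω ∂(P D), ∀ j, IntervalIntegrable (fun t => d D ω t j) volume 0 T)
    (hbdd : ∀ δ : ℝ, 0 < δ → ∃ C : ℝ, ∀ᶠ D in (atTop : Filter (Fin n → ℕ)),
      P D {ω | C < ∫ t in (0 : ℝ)..T, dataNorm w (d D ω t)} ≤ ENNReal.ofReal δ) :
    -- the NTK stays at the constant limit kernel, uniformly on `[0, T]`, in probability
    (∀ x x' : Fin n → ℝ, ∀ ε : ℝ, 0 < ε →
      Tendsto (fun D : Fin n → ℕ => P D {ω | ∃ t ∈ Set.Icc (0 : ℝ) T,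
        ε ≤ |mpsNTK φ (A D ω t) x x' - mpsLimitKernel φ σ x x'|}) atTop (𝓝 0)) ∧
    -- at finite bond dimension the outputs follow the kernel gradient of the current NTK
    (∀ D, ∀ᵐ ω ∂(P D), ∀ t ∈ Set.Icc (0 : ℝ) T, ∀ x : Fin n → ℝ,
      HasDerivWithinAt (fun s => mpsOutput φ x (A D ω s))
        (kernelMap (mpsNTK φ (A D ω t)) (dataPairing w X (d D ω t)) x)
        (Set.Icc (0 : ℝ) T) t) ∧
    -- in the limit they follow the kernel gradient of the limit kernel: the defect in the
    -- differential equation vanishes in `L¹([0, T])`, in probability,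
    (∀ x : Fin n → ℝ, ∀ ε : ℝ, 0 < ε →
      Tendsto (fun D : Fin n → ℕ => P D {ω | ENNReal.ofReal ε ≤
        ∫⁻ t in Set.Icc (0 : ℝ) T,
          ‖derivWithin (fun s => mpsOutput φ x (A D ω s)) (Set.Icc (0 : ℝ) T) t
            - kernelMap (mpsLimitKernel φ σ) (dataPairing w X (d D ω t)) x‖ₑ}) atTop (𝓝 0)) ∧
    -- and the outputs approach its solution with the same initial value, uniformly on `[0, T]`
    (∀ x : Fin n → ℝ, ∀ ε : ℝ, 0 < ε →
      Tendsto (fun D : Fin n → ℕ => P D {ω | ∃ t ∈ Set.Icc (0 : ℝ) T,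
        ε ≤ |mpsOutput φ x (A D ω t) - (mpsOutput φ x (A D ω 0)
          + ∫ s in (0 : ℝ)..t,
              kernelMap (mpsLimitKernel φ σ) (dataPairing w X (d D ω s)) x)|})
        atTop (𝓝 0)) := by
  classical
  have lazy := eventually_measure_not_isLazyTraining_le q φ σ X w hw T P A d hinit htrain hint hbdd
  -- An event has vanishing probability as soon as lazy training excludes it for every cost bound
  -- `C` and all `ζ` small relative to `ε` and `C`.
  have main : ∀ S : Finset (Fin n → ℝ), (∀ j, X j ∈ S) → ∀ ε : ℝ, 0 < ε →
      ∀ E : ∀ D, Set (Ω D), (∀ C ζ : ℝ, 0 ≤ ζ → ζ < ε → ζ * √(∑ j, w j) * C < ε → ∀ D ω,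
        IsLazyTraining φ σ w X T S C ζ (d D ω) (A D ω) → ω ∉ E D) →
      Tendsto (fun D => P D (E D)) atTop (𝓝 0) := by
    intro S hS ε hε E hE
    refine tendsto_measure_zero_of_forall_ofReal fun δ hδ => ?_
    obtain ⟨C, hC, h⟩ := lazy S hS δ hδ
    have hW : 0 ≤ √(∑ j, w j) * C := mul_nonneg (Real.sqrt_nonneg _) hC
    -- The cost bound `C` depends on `δ` only, so the tolerance may be chosen after it; this value
    -- makes both `ζ` and `ζ √(∑ w) C` smaller than `ε`.
    set ζ := ε / (2 * (1 + √(∑ j, w j) * C)) with hζ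
    have hζ0 : 0 < ζ := by positivity
    have hζ1 : ζ * (2 * (1 + √(∑ j, w j) * C)) = ε := by rw [hζ]; field_simp
    have hζW : 0 ≤ ζ * (√(∑ j, w j) * C) := mul_nonneg hζ0.le hW
    filter_upwards [h ζ hζ0] with D hD
    refine (measure_mono fun ω hω => ?_).trans hD
    intro hlazy
    exact hE C ζ hζ0.le (by linarith) (by linarith) D ω hlazy hω
  refine ⟨fun x x' ε hε => ?_, fun D => ?_, fun x ε hε => ?_, fun x ε hε => ?_⟩
  · refine main (insert x (insert x' (Finset.univ.image X))) (by simp) ε hε _ ?_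
    rintro C ζ - hζε - D ω hlazy ⟨t, ht, hle⟩
    have := hlazy.ntk t ht x (by simp) x' (by simp)
    linarith
  · filter_upwards [htrain D] with ω hω t ht x
    exact hω.hasDerivWithinAt_output ht x
  · refine main (insert x (Finset.univ.image X)) (by simp) ε hε _ ?_
    intro C ζ hζ _ hC D ω hlazy hle
    have h1 := hlazy.training.lintegral_defect_le (x := x) hT hw hlazy.integrable hζ
      fun t ht j => hlazy.ntk t ht x (by simp) (X j) (by simp)
    have h2 := (ENNReal.ofReal_le_ofReal_iff' .. |>.1 (le_trans hle h1)).resolve_right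
      (not_le.2 hε)
    have h3 := mul_le_mul_of_nonneg_left hlazy.cost (mul_nonneg hζ (Real.sqrt_nonneg (∑ j, w j)))
    linarith
  · refine main (insert x (Finset.univ.image X)) (by simp) ε hε _ ?_
    rintro C ζ hζ - hC D ω hlazy ⟨t, ht, hle⟩
    have h1 := hlazy.training.abs_output_defect_le (x := x) hw hlazy.integrable hζ
      (fun t ht j => hlazy.ntk t ht x (by simp) (X j) (by simp)) ht
    have h3 := mul_le_mul_of_nonneg_left hlazy.cost (mul_nonneg hζ (Real.sqrt_nonneg (∑ j, w j)))
    linarith
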